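/- Let $1<p<\infty$, and let $T$ be the Ahlfors–Beurling transform on $L^p(\mathbb{R}^2)=L^p(\mathbb{C})$ (complex-valued functions, Lebesgue area measure $m$), that is, the unique bounded linear operator on $L^p(\mathbb{C})$ (it exists) which on Schwartz functions $f$ is given, for almost every $z\in\mathbb{C}$, by $$Tf(z)=-\frac1\pi\,\lim_{\varepsilon\to0^+}\int_{|\zeta-z|>\varepsilon}\frac{f(\zeta)}{(\zeta-z)^2}\,dm(\zeta).$$ For a bounded operator $\Lambda$ on a complex Banach space $X$ put $\sigma(\Lambda)=\{\lambda\in\mathbb{C}:\Lambda-\lambda I\text{ is not invertible}\}$ and $$\sigma_c(\Lambda)=\{\lambda\in\sigma(\Lambda):\Lambda-\lambda I\text{ has trivial kernel and dense range in }X\}.$$ Then on $L^p(\mathbb{R}^2)$ we have $$\sigma(T)=\sigma_c(T)=\{\lambda\in\mathbb{C}:|\lambda|=1\}.$$ In particular, for every $\lambda$ with $|\lambda|=1$ the operator $T-\lambda I$ has trivial kernel and dense range but is not invertible. -/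

import Mathlib

open MeasureTheory Filter Topology
open scoped ENNReal SchwartzMap

/-- The continuous spectrum of a bounded operator `Λ` on a complex normed space `X`: the points `l`
of the spectrum for which `Λ - l I` has trivial kernel and dense range. -/
def continuousSpectrum {X : Type*} [NormedAddCommGroup X] [NormedSpace ℂ X] (Λ : X →L[ℂ] X) :
    Set ℂ :=
  {l | l ∈ spectrum ℂ Λ ∧
    (∀ x : X, (Λ - l • ContinuousLinearMap.id ℂ X) x = 0 → x = 0) ∧
    DenseRange (Λ - l • ContinuousLinearMap.id ℂ X)}

/-- The truncated Ahlfors-Beurling integral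
`-(1/π) ∫_{|ζ - z| > ε} f(ζ) / (ζ - z)² dm(ζ)`, where `m` is the area measure on `ℂ`. -/
noncomputable def ahlforsBeurlingTrunc (f : ℂ → ℂ) (ε : ℝ) (z : ℂ) : ℂ :=
  -(1 / (Real.pi : ℂ)) * ∫ ζ in {ζ : ℂ | ε < ‖ζ - z‖}, f ζ / (ζ - z) ^ 2

/-- `T` is the Ahlfors-Beurling transform on `L^p(ℂ)`: a bounded operator on `L^p(ℂ)` that is given
on Schwartz functions, almost everywhere, by the principal value integral
`T f (z) = -(1/π) p.v. ∫ f(ζ) / (ζ - z)² dm(ζ)`. -/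
def IsAhlforsBeurling (p : ℝ≥0∞) [Fact (1 ≤ p)]
    (T : Lp ℂ p (volume : Measure ℂ) →L[ℂ] Lp ℂ p (volume : Measure ℂ)) : Prop :=
  ∀ f : 𝓢(ℂ, ℂ), ∀ᵐ z : ℂ,
    Tendsto (fun ε : ℝ => ahlforsBeurlingTrunc f ε z) (𝓝[>] 0) (𝓝 (T (f.toLp p volume) z))

/-! On the Fourier side `T` is multiplication by `conj ξ / ξ`, which takes every unimodular value,
each one on a line through the origin. On `L²` this settles everything; on `L^p` three points need
an argument.

The spectrum lies in the circle. The double Hilbert transform, with symbol `-sign(ξ₁ ξ₂)`, is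
bounded on `L^p` by the theorem of M. Riesz used in each variable
(`exists_eLpNorm_conjPoissonIntegral_le`: contour integration of a power of a holomorphic function
for `p ≤ 2`, duality for `p ≥ 2`). Its symbol is a square wave in the doubled angle, and the
coefficients of that wave at odd frequencies `n` have size `1 / |n|`. Averaging rotated copies
against a character therefore isolates `(conj ξ / ξ) ^ n` and shows that its multiplier norm is
`O(|n|)` for odd `n` of either sign (`exists_eLpNorm_multiplierOperator_le`). So the odd powers of
`T` and of its inverse grow at most linearly, and neither operator has spectrum outside the closed
unit disc. The case `n = 1` also yields the existence of `T`, once the multiplier is identified with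
the principal value by comparing kernels (`multiplierOperator_eq_beurlingPV`).

Kernel and range. `T` sends `∂f/∂(conj z)` to `∂f/∂z`, and for `‖μ‖ = 1` the operator `∂/∂z - μ²
∂/∂(conj z)` is a nonzero multiple of a real directional derivative. A functional on `L^p` that
kills all derivatives in one direction takes equal values on all translates of a test function in
that direction. Since `N` far apart translates have a sum of norm only `N^(1/p)` times that of one,
it vanishes when `p > 1`. This gives dense range, and, in the dual exponent and by the symmetry of
`T`, trivial kernel.

The whole circle is attained. Conjugation by the rotation `u` turns `T` into `u² T`, so the nonempty
spectrum is invariant under all rotations. -/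

/-! ### Minkowski's integral inequality -/

theorem eLpNorm_rpow_toReal {α E : Type*} [MeasurableSpace α] [NormedAddCommGroup E]
    {ν : Measure α} {p : ℝ≥0∞} (hp : 1 ≤ p) (hp_top : p ≠ ∞) (f : α → E) :
    eLpNorm f p ν ^ p.toReal = ∫⁻ x, ‖f x‖ₑ ^ p.toReal ∂ν := by
  have h0 : p ≠ 0 := (zero_lt_one.trans_le hp).ne'
  rw [eLpNorm_eq_lintegral_rpow_enorm_toReal h0 hp_top, ← ENNReal.rpow_mul,
    one_div_mul_cancel (ENNReal.toReal_pos h0 hp_top).ne', ENNReal.rpow_one]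

/-- Minkowski's integral inequality for a finite measure and a uniform bound. -/
theorem eLpNorm_integral_le_of_forall {α Θ E : Type*} [MeasurableSpace α] [MeasurableSpace Θ]
    [NormedAddCommGroup E] [NormedSpace ℝ E] {ν : Measure α} [SFinite ν] {μ : Measure Θ}
    [IsFiniteMeasure μ] {p : ℝ≥0∞} (hp : 1 ≤ p) (hp_top : p ≠ ∞) {h : α → Θ → E}
    (hm : AEStronglyMeasurable (Function.uncurry h) (ν.prod μ)) {C : ℝ≥0∞}
    (hC : ∀ θ, eLpNorm (fun x => h x θ) p ν ≤ C) :
    eLpNorm (fun x => ∫ θ, h x θ ∂μ) p ν ≤ μ Set.univ * C := by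
  have h0 : p ≠ 0 := (zero_lt_one.trans_le hp).ne'
  have hr : 0 < p.toReal := ENNReal.toReal_pos h0 hp_top
  have hr1 : 1 ≤ p.toReal := by
    simpa using (ENNReal.toReal_le_toReal ENNReal.one_ne_top hp_top).2 hp
  have hsec : ∀ᵐ x ∂ν, AEStronglyMeasurable (h x) μ := hm.prodMk_left
  -- Hölder against the constant `1` in the inner variable; Tonelli then does the rest.
  have key : ∀ᵐ x ∂ν, ‖∫ θ, h x θ ∂μ‖ₑ ^ p.toReal ≤
      μ Set.univ ^ (p.toReal - 1) * ∫⁻ θ, ‖h x θ‖ₑ ^ p.toReal ∂μ := by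
    filter_upwards [hsec] with x hx
    have h1 : ‖∫ θ, h x θ ∂μ‖ₑ ≤ eLpNorm (h x) p μ * μ Set.univ ^ (1 - 1 / p.toReal) := by
      refine (enorm_integral_le_lintegral_enorm _).trans ?_
      rw [← eLpNorm_one_eq_lintegral_enorm]
      simpa using eLpNorm_le_eLpNorm_mul_rpow_measure_univ hp hx
    calc ‖∫ θ, h x θ ∂μ‖ₑ ^ p.toReal
        ≤ (eLpNorm (h x) p μ * μ Set.univ ^ (1 - 1 / p.toReal)) ^ p.toReal := by gcongr
      _ = _ := by
          rw [ENNReal.mul_rpow_of_nonneg _ _ hr.le, eLpNorm_rpow_toReal hp hp_top,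
            ← ENNReal.rpow_mul, mul_comm]
          congr 2
          field_simp
  rw [← ENNReal.rpow_le_rpow_iff hr, eLpNorm_rpow_toReal hp hp_top]
  calc ∫⁻ x, ‖∫ θ, h x θ ∂μ‖ₑ ^ p.toReal ∂ν
      ≤ ∫⁻ x, μ Set.univ ^ (p.toReal - 1) * ∫⁻ θ, ‖h x θ‖ₑ ^ p.toReal ∂μ ∂ν :=
        lintegral_mono_ae key
    _ = μ Set.univ ^ (p.toReal - 1) * ∫⁻ x, ∫⁻ θ, ‖h x θ‖ₑ ^ p.toReal ∂μ ∂ν :=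
        lintegral_const_mul' _ _ (ENNReal.rpow_ne_top_of_nonneg (by linarith) (measure_ne_top _ _))
    _ = μ Set.univ ^ (p.toReal - 1) * ∫⁻ θ, ∫⁻ x, ‖h x θ‖ₑ ^ p.toReal ∂ν ∂μ := by
        rw [lintegral_lintegral_swap]
        exact hm.enorm.pow_const _
    _ ≤ μ Set.univ ^ (p.toReal - 1) * ∫⁻ _θ, C ^ p.toReal ∂μ := by
        gcongr with θ
        rw [← eLpNorm_rpow_toReal hp hp_top]
        exact ENNReal.rpow_le_rpow (hC θ) hr.le
    _ = (μ Set.univ * C) ^ p.toReal := by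
        rw [lintegral_const, ENNReal.mul_rpow_of_nonneg _ _ hr.le, mul_comm (C ^ _), ← mul_assoc]
        congr 1
        nth_rewrite 2 [← ENNReal.rpow_one (μ Set.univ)]
        rcases eq_or_ne (μ Set.univ) 0 with h | h
        · simp [h, hr]
        · rw [← ENNReal.rpow_add _ _ h (measure_ne_top _ _), sub_add_cancel]

/-! ### Two tools for the theorem of M. Riesz -/

/-- The pointwise inequality behind the theorem of M. Riesz. -/
theorem exists_norm_rpow_le_of_re_pos {p : ℝ} (hp : 1 < p) (hp2 : p ≤ 2) :
    ∃ A B : ℝ, 0 ≤ A ∧ ∀ z : ℂ, 0 < z.re →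
      ‖z‖ ^ p ≤ A * z.re ^ p - B * (z ^ (p : ℂ)).re := by
  have hp0 : 0 < p := by linarith
  -- The midpoint of `π / (2p)` and `π / 2`, so that `π / 2 < p φ₀ < π` and `cos (p φ₀) < 0`. For
  -- angles beyond `φ₀` the term `-B cos (p φ)` alone is at least `1`; for smaller angles `cos φ ≥
  -- cos φ₀`, and `A` is large enough to absorb `1 + B`.
  set φ₀ : ℝ := (Real.pi / 2 + Real.pi / (2 * p)) / 2 with hφ₀
  have hpi := Real.pi_pos
  have e1 : p * φ₀ = (p * (Real.pi / 2) + Real.pi / 2) / 2 := by rw [hφ₀]; field_simp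
  have hpφ : Real.pi / 2 < p * φ₀ := by rw [e1]; nlinarith
  have hpφ' : p * φ₀ < p * (Real.pi / 2) := by rw [e1]; nlinarith
  have hφlt : φ₀ < Real.pi / 2 := lt_of_mul_lt_mul_left hpφ' hp0.le
  have hφpos : 0 < φ₀ := by rw [hφ₀]; positivity
  have hc : Real.cos (p * φ₀) < 0 :=
    Real.cos_neg_of_pi_div_two_lt_of_lt hpφ (by nlinarith)
  have hc0 : 0 < Real.cos φ₀ := Real.cos_pos_of_mem_Ioo ⟨by linarith, hφlt⟩
  set B : ℝ := (-Real.cos (p * φ₀))⁻¹ with hB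
  have hBpos : 0 < B := inv_pos.2 (by linarith)
  set A : ℝ := (1 + B) / Real.cos φ₀ ^ p with hA
  have hApos : 0 < A := by positivity
  have angle : ∀ φ : ℝ, 0 ≤ φ → φ < Real.pi / 2 →
      1 ≤ A * Real.cos φ ^ p - B * Real.cos (p * φ) := by
    intro φ h0 h1
    have hcφ : 0 < Real.cos φ := Real.cos_pos_of_mem_Ioo ⟨by linarith, h1⟩
    rcases le_total φ φ₀ with h | h
    · have : Real.cos φ₀ ≤ Real.cos φ :=
        Real.cos_le_cos_of_nonneg_of_le_pi h0 (by linarith) h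
      have h2 : Real.cos φ₀ ^ p ≤ Real.cos φ ^ p := Real.rpow_le_rpow hc0.le this hp0.le
      have h3 : 1 + B ≤ A * Real.cos φ ^ p := by
        calc 1 + B = A * Real.cos φ₀ ^ p := by rw [hA]; field_simp
          _ ≤ _ := by gcongr
      have := mul_le_mul_of_nonneg_left (Real.cos_le_one (p * φ)) hBpos.le
      linarith
    · have h2 : Real.cos (p * φ) ≤ Real.cos (p * φ₀) :=
        Real.cos_le_cos_of_nonneg_of_le_pi (by positivity) (by nlinarith) (by gcongr)
      have h3 : B * Real.cos (p * φ₀) = -1 := by rw [hB, inv_neg, neg_mul, inv_mul_cancel₀ hc.ne]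
      have h4 : 0 ≤ A * Real.cos φ ^ p := by positivity
      have := mul_le_mul_of_nonneg_left h2 hBpos.le
      linarith
  refine ⟨A, B, hApos.le, fun z hz => ?_⟩
  have hz0 : z ≠ 0 := by rintro rfl; simp at hz
  have hnz : 0 < ‖z‖ := norm_pos_iff.2 hz0
  have harg : |Complex.arg z| < Real.pi / 2 := Complex.abs_arg_lt_pi_div_two_iff.2 (Or.inl hz)
  have hre : z.re = ‖z‖ * Real.cos |Complex.arg z| := by
    rw [Real.cos_abs, Complex.norm_mul_cos_arg]
  have hpow : (z ^ (p : ℂ)).re = ‖z‖ ^ p * Real.cos (p * |Complex.arg z|) := by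
    rw [Complex.cpow_ofReal_re, ← Real.cos_abs (p * |Complex.arg z|), abs_mul, abs_abs,
      ← abs_mul, Real.cos_abs, mul_comm p]
  rw [hpow, hre, Real.mul_rpow hnz.le (Real.cos_pos_of_mem_Ioo ⟨by
    linarith [abs_nonneg (Complex.arg z)], harg⟩).le]
  have := mul_le_mul_of_nonneg_left (angle _ (abs_nonneg _) harg) (Real.rpow_nonneg hnz.le p)
  linarith

/-- Cauchy's theorem on a half-plane, for functions with an integrable majorant. -/
theorem integral_horizontal_line_eq_zero {G : ℂ → ℂ} {y : ℝ}
    (hG : ∀ z : ℂ, y ≤ z.im → DifferentiableAt ℂ G z) {b : ℝ → ℝ} (hb : Integrable b)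
    (hbt : Tendsto b atTop (𝓝 0)) (hbb : Tendsto b atBot (𝓝 0))
    (hbound : ∀ x η : ℝ, y ≤ η → ‖G (x + η * Complex.I)‖ ≤ b x)
    (hlim : ∀ x : ℝ, Tendsto (fun η : ℝ => G (x + η * Complex.I)) atTop (𝓝 0)) :
    ∫ x : ℝ, G (x + y * Complex.I) = 0 := by
  have hcont : ∀ η : ℝ, y ≤ η → Continuous fun x : ℝ => G (x + η * Complex.I) := by
    intro η hη
    rw [continuous_iff_continuousAt]
    intro x
    have : ContinuousAt G (x + η * Complex.I) := (hG _ (by simpa using hη)).continuousAt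
    exact ContinuousAt.comp (f := fun x : ℝ => (x + η * Complex.I : ℂ)) this (by fun_prop)
  have hint : ∀ η : ℝ, y ≤ η → Integrable fun x : ℝ => G (x + η * Complex.I) := fun η hη =>
    hb.mono' (hcont η hη).aestronglyMeasurable (Eventually.of_forall fun x => hbound x η hη)
  -- Cauchy's theorem on rectangles: the vertical sides at `±R` contribute at most `b (±R) |η - y|`,
  -- so the line integral does not depend on the height, which may then tend to infinity.
  have hline : ∀ η : ℝ, y ≤ η →
      ∫ x : ℝ, G (x + y * Complex.I) = ∫ x : ℝ, G (x + η * Complex.I) := by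
    intro η hη
    have hside : ∀ x : ℝ, ‖Complex.I • ∫ t : ℝ in y..η, G (x + t * Complex.I)‖ ≤ b x * |η - y| := by
      intro x
      rw [norm_smul, Complex.norm_I, one_mul]
      refine intervalIntegral.norm_integral_le_of_norm_le_const fun t ht => hbound x t ?_
      rw [Set.uIoc_of_le hη] at ht
      exact ht.1.le
    have hR : ∀ R : ℝ, (∫ x : ℝ in -R..R, G (x + y * Complex.I)) -
        (∫ x : ℝ in -R..R, G (x + η * Complex.I)) =
        Complex.I • (∫ t : ℝ in y..η, G ((-R : ℝ) + t * Complex.I)) -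
        Complex.I • (∫ t : ℝ in y..η, G (R + t * Complex.I)) := by
      intro R
      have h := Complex.integral_boundary_rect_eq_zero_of_differentiableOn G
        (-R + y * Complex.I) (R + η * Complex.I) (by
          intro z hz
          refine (hG z ?_).differentiableWithinAt
          have := hz.2
          simp [Set.uIcc_of_le hη] at this
          exact this.1)
      simp only [Complex.add_re, Complex.neg_re, Complex.ofReal_re, Complex.mul_re, Complex.I_re,
        mul_zero, Complex.ofReal_im, Complex.I_im, mul_one, sub_self, add_zero, Complex.add_im,
        Complex.neg_im, neg_zero, Complex.mul_im, zero_add] at h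
      linear_combination h
    have h1 := (intervalIntegral_tendsto_integral (hint y le_rfl) tendsto_neg_atTop_atBot
      tendsto_id).sub (intervalIntegral_tendsto_integral (hint η hη) tendsto_neg_atTop_atBot
      tendsto_id)
    have h2 : Tendsto (fun R : ℝ => Complex.I • (∫ t : ℝ in y..η, G ((-R : ℝ) + t * Complex.I)) -
        Complex.I • (∫ t : ℝ in y..η, G (R + t * Complex.I))) atTop (𝓝 (0 - 0)) := by
      refine Tendsto.sub ?_ ?_
      · refine squeeze_zero_norm (fun R => hside (-R)) ?_
        simpa using (hbb.comp tendsto_neg_atTop_atBot).mul_const |η - y|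
      · refine squeeze_zero_norm (fun R => hside R) ?_
        simpa using hbt.mul_const |η - y|
    have h3 := tendsto_nhds_unique (h1.congr fun R => hR R) h2
    rw [sub_zero, sub_eq_zero] at h3
    exact h3
  have hl : Tendsto (fun η : ℝ => ∫ x : ℝ, G (x + η * Complex.I)) atTop (𝓝 (∫ _ : ℝ, (0 : ℂ))) := by
    refine tendsto_integral_filter_of_dominated_convergence b ?_ ?_ hb ?_
    · filter_upwards [eventually_ge_atTop y] with η hη using (hcont η hη).aestronglyMeasurable
    · filter_upwards [eventually_ge_atTop y] with η hη using
        Eventually.of_forall fun x => hbound x η hη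
    · exact Eventually.of_forall hlim
  rw [integral_zero] at hl
  refine tendsto_nhds_unique (tendsto_const_nhds.congr' ?_) hl
  filter_upwards [eventually_ge_atTop y] with η hη using hline η hη

/-! ### Poisson and conjugate Poisson integrals -/

/-- The Poisson kernel of the upper half-plane. -/
noncomputable def poissonKernelHalfPlane (y x : ℝ) : ℝ := y / (Real.pi * (x ^ 2 + y ^ 2))

/-- The conjugate Poisson kernel of the upper half-plane. -/
noncomputable def conjPoissonKernel (y x : ℝ) : ℝ := x / (Real.pi * (x ^ 2 + y ^ 2))

/-- Supplies the total mass `1` of the Poisson kernel. -/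
theorem poissonKernelHalfPlane_eq_cauchyPDFReal {y : ℝ} (hy : 0 < y) (x : ℝ) :
    poissonKernelHalfPlane y x = ProbabilityTheory.cauchyPDFReal 0 y.toNNReal x := by
  rw [ProbabilityTheory.cauchyPDFReal_def, poissonKernelHalfPlane]
  rw [Real.coe_toNNReal _ hy.le, sub_zero]
  field_simp

theorem continuous_poissonKernelHalfPlane {y : ℝ} (hy : 0 < y) :
    Continuous (poissonKernelHalfPlane y) := by
  unfold poissonKernelHalfPlane
  exact continuous_const.div (by fun_prop) fun x => by positivity

theorem continuous_conjPoissonKernel {y : ℝ} (hy : 0 < y) : Continuous (conjPoissonKernel y) := by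
  unfold conjPoissonKernel
  exact continuous_id.div (by fun_prop) fun x => by positivity

theorem poissonKernelHalfPlane_pos {y : ℝ} (hy : 0 < y) (x : ℝ) :
    0 < poissonKernelHalfPlane y x := by
  unfold poissonKernelHalfPlane; positivity

theorem poissonKernelHalfPlane_le {y : ℝ} (hy : 0 < y) (x : ℝ) :
    poissonKernelHalfPlane y x ≤ 1 / (Real.pi * y) := by
  unfold poissonKernelHalfPlane
  have := Real.pi_pos
  rw [div_le_div_iff₀ (by positivity) (by positivity)]
  nlinarith [sq_nonneg x, mul_nonneg this.le (sq_nonneg x)]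

theorem abs_conjPoissonKernel_le {y : ℝ} (hy : 0 < y) (x : ℝ) :
    |conjPoissonKernel y x| ≤ 1 / (Real.pi * y) := by
  unfold conjPoissonKernel
  have := Real.pi_pos
  rw [abs_div, abs_of_pos (show 0 < Real.pi * (x ^ 2 + y ^ 2) by positivity),
    div_le_div_iff₀ (by positivity) (by positivity), one_mul]
  have h : |x| * y ≤ x ^ 2 + y ^ 2 := by nlinarith [sq_nonneg (|x| - y), sq_abs x, sq_nonneg y]
  calc |x| * (Real.pi * y) = Real.pi * (|x| * y) := by ring
    _ ≤ _ := by gcongr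

theorem conjPoissonKernel_neg (y x : ℝ) : conjPoissonKernel y (-x) = -conjPoissonKernel y x := by
  simp [conjPoissonKernel, neg_div]

theorem integrable_kernel_mul {k : ℝ → ℝ} (hk : Continuous k) {B : ℝ} (hB : ∀ x, |k x| ≤ B)
    {g : ℝ → ℝ} (hg : Integrable g) (x : ℝ) : Integrable fun t => k (x - t) * g t :=
  hg.bdd_mul (c := B) (by fun_prop) (Eventually.of_forall fun t => by simpa using hB (x - t))

/-- The Poisson integral averages translates of `g` against a probability measure, so Minkowski's
inequality has constant `1`. -/
theorem eLpNorm_poisson_le {p : ℝ≥0∞} (hp : 1 ≤ p) (hp_top : p ≠ ∞) {y : ℝ} (hy : 0 < y)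
    {g : ℝ → ℝ} (hg : Measurable g) :
    eLpNorm (fun x => ∫ t, poissonKernelHalfPlane y (x - t) * g t) p ≤ eLpNorm g p := by
  set γ : NNReal := y.toNNReal
  have hγ : γ ≠ 0 := (Real.toNNReal_pos.2 hy).ne'
  set μ : Measure ℝ := volume.withDensity (ProbabilityTheory.cauchyPDF 0 γ) with hμ
  have huniv : μ Set.univ = 1 := by
    rw [hμ, withDensity_apply _ MeasurableSet.univ, Measure.restrict_univ,
      ProbabilityTheory.lintegral_cauchyPDF_eq_one 0 hγ]
  have : IsProbabilityMeasure μ := ⟨huniv⟩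
  have e : ∀ x, ∫ t, poissonKernelHalfPlane y (x - t) * g t = ∫ t, g (x - t) ∂μ := by
    intro x
    rw [hμ, integral_withDensity_eq_integral_toReal_smul
      (ProbabilityTheory.measurable_cauchyPDF 0 γ)
      (Eventually.of_forall fun t => by simp [ProbabilityTheory.cauchyPDF_def]),
      ← integral_sub_left_eq_self _ volume x]
    refine integral_congr_ae (Eventually.of_forall fun t => ?_)
    simp only [sub_sub_cancel, smul_eq_mul, ProbabilityTheory.cauchyPDF_def]
    rw [ENNReal.toReal_ofReal, poissonKernelHalfPlane_eq_cauchyPDFReal hy]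
    exact (ProbabilityTheory.cauchyPDF_pos 0 hγ t).le
  simp_rw [e]
  have := eLpNorm_integral_le_of_forall (ν := (volume : Measure ℝ)) (μ := μ) hp hp_top
    (h := fun x t => g (x - t)) (C := eLpNorm g p)
    (by
      have : Measurable (Function.uncurry fun x t : ℝ => g (x - t)) := by
        unfold Function.uncurry; fun_prop
      exact this.aestronglyMeasurable)
    (fun t => by
      have h := eLpNorm_comp_measurePreserving (p := p) hg.aestronglyMeasurable
        (measurePreserving_sub_right (volume : Measure ℝ) t)
      exact h.le)
  rwa [huniv, one_mul] at this

/-- `u + i v`, where `u` and `v` are the Poisson and the conjugate Poisson integral of `g`. -/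
noncomputable def analyticExtension (g : ℝ → ℝ) (z : ℂ) : ℂ :=
  ∫ t : ℝ, Complex.I / Real.pi * g t / (z - t)

/-- With `s = x - t`, `i / (s + i y) = (y + i s) / (s² + y²)`. -/
theorem analyticExtension_eq {g : ℝ → ℝ} (hg : Integrable g) {y : ℝ} (hy : 0 < y) (x : ℝ) :
    analyticExtension g (x + y * Complex.I) =
      ((∫ t, poissonKernelHalfPlane y (x - t) * g t : ℝ) : ℂ) +
      ((∫ t, conjPoissonKernel y (x - t) * g t : ℝ) : ℂ) * Complex.I := by
  have hP := integrable_kernel_mul (continuous_poissonKernelHalfPlane hy) (fun x => by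
    rw [abs_of_pos (poissonKernelHalfPlane_pos hy x)]; exact poissonKernelHalfPlane_le hy x) hg x
  have hQ := integrable_kernel_mul (continuous_conjPoissonKernel hy)
    (abs_conjPoissonKernel_le hy) hg x
  rw [← integral_complex_ofReal, ← integral_complex_ofReal, ← integral_mul_const, ← integral_add]
  · refine integral_congr_ae (Eventually.of_forall fun t => ?_)
    have h1 : ((x - t : ℝ) : ℂ) + y * Complex.I ≠ 0 := fun h => by
      have := congrArg Complex.im h
      simp [hy.ne'] at this
    have h2 : ((x - t : ℝ) : ℂ) - y * Complex.I ≠ 0 := fun h => by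
      have := congrArg Complex.im h
      simp [hy.ne'] at this
    have h3 : ((x - t : ℝ) : ℂ) ^ 2 + (y : ℂ) ^ 2 =
        (((x - t : ℝ) : ℂ) + y * Complex.I) * (((x - t : ℝ) : ℂ) - y * Complex.I) := by
      ring_nf; rw [Complex.I_sq]; ring
    have h4 : (Real.pi : ℂ) ≠ 0 := by exact_mod_cast Real.pi_ne_zero
    have h5 : (x + y * Complex.I - t : ℂ) = ((x - t : ℝ) : ℂ) + y * Complex.I := by
      push_cast; ring
    simp only [poissonKernelHalfPlane, conjPoissonKernel, Complex.ofReal_mul, Complex.ofReal_div,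
      Complex.ofReal_add, Complex.ofReal_pow, h5]
    have h6 : (y : ℂ) + ((x - t : ℝ) : ℂ) * Complex.I =
        Complex.I * (((x - t : ℝ) : ℂ) - y * Complex.I) := by
      linear_combination (y : ℂ) * Complex.I_sq
    rw [h3]
    generalize ((x - t : ℝ) : ℂ) + y * Complex.I = a at *
    generalize ((x - t : ℝ) : ℂ) - y * Complex.I = b at *
    calc Complex.I / Real.pi * (g t : ℂ) / a
        = Complex.I * b * g t / (Real.pi * (a * b)) := by field_simp
      _ = _ := by rw [← h6]; ring
  · exact hP.ofReal
  · exact hQ.ofReal.mul_const _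

theorem differentiableAt_analyticExtension {g : ℝ → ℝ} (hg : Integrable g) {z : ℂ}
    (hz : 0 < z.im) : DifferentiableAt ℂ (analyticExtension g) z := by
  have him : ∀ w ∈ Metric.ball z (z.im / 2), ∀ t : ℝ, z.im / 2 ≤ ‖w - t‖ := by
    intro w hw t
    have h1 : |w.im - z.im| ≤ ‖w - z‖ := by simpa using Complex.abs_im_le_norm (w - z)
    have h2 : ‖w - z‖ < z.im / 2 := by simpa [dist_eq_norm] using hw
    have h3 : |w.im| ≤ ‖w - t‖ := by simpa using Complex.abs_im_le_norm (w - t)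
    have := abs_lt.1 (h1.trans_lt h2)
    exact le_trans (by linarith) ((le_abs_self _).trans h3)
  have hne : ∀ w ∈ Metric.ball z (z.im / 2), ∀ t : ℝ, w - (t : ℂ) ≠ 0 := fun w hw t =>
    norm_pos_iff.1 ((half_pos hz).trans_le (him w hw t))
  have hmeas : AEStronglyMeasurable (fun t : ℝ => Complex.I / Real.pi * g t : ℝ → ℂ) :=
    (hg.ofReal.const_mul _).aestronglyMeasurable
  refine (hasDerivAt_integral_of_dominated_loc_of_deriv_le (μ := volume)
    (F := fun w (t : ℝ) => Complex.I / Real.pi * g t / (w - t))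
    (F' := fun w (t : ℝ) => -(Complex.I / Real.pi * g t) / (w - t) ^ 2)
    (bound := fun t => ‖Complex.I / Real.pi * (g t : ℂ)‖ / (z.im / 2) ^ 2)
    (Metric.ball_mem_nhds z (half_pos hz)) ?_ ?_ ?_ ?_ ?_ ?_).2.differentiableAt
  · exact Eventually.of_forall fun w => by
      simp_rw [div_eq_mul_inv _ (_ - _)]
      exact hmeas.mul (by fun_prop : Measurable fun t : ℝ => (w - t : ℂ)⁻¹).aestronglyMeasurable
  · refine ((hg.ofReal.const_mul (Complex.I / Real.pi)).norm.div_const (z.im / 2)).mono' ?_ ?_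
    · simp_rw [div_eq_mul_inv _ (_ - _)]
      exact hmeas.mul (by fun_prop : Measurable fun t : ℝ => (z - t : ℂ)⁻¹).aestronglyMeasurable
    · refine Eventually.of_forall fun t => ?_
      rw [norm_div]
      exact div_le_div_of_nonneg_left (norm_nonneg _) (half_pos hz)
        (him z (Metric.mem_ball_self (half_pos hz)) t)
  · simp_rw [div_eq_mul_inv]
    exact hmeas.neg.mul
      (by fun_prop : Measurable fun t : ℝ => ((z - t : ℂ) ^ 2)⁻¹).aestronglyMeasurable
  · refine Eventually.of_forall fun t w hw => ?_
    rw [norm_div, norm_neg, norm_pow]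
    gcongr
    exact him w hw t
  · exact (hg.ofReal.const_mul _).norm.div_const _
  · refine Eventually.of_forall fun t w hw => ?_
    have h := ((hasDerivAt_id w).sub_const (t : ℂ)).fun_inv (hne w hw t)
    have h2 : HasDerivAt (fun w : ℂ => Complex.I / Real.pi * g t / (w - t))
        (Complex.I / Real.pi * g t * (-1 / (w - t) ^ 2)) w := by
      simp_rw [div_eq_mul_inv _ (_ - (t : ℂ))]
      exact h.const_mul (Complex.I / Real.pi * (g t : ℂ))
    exact h2.congr_deriv (by ring)

/-- For `g` of bounded support the extension decays like the reciprocal distance to that support, so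
its `r`-th power, `r > 1`, has an integrable majorant common to all lines above a fixed height. -/
theorem norm_analyticExtension_le {g : ℝ → ℝ} (hg : Integrable g) {M : ℝ}
    (hM : ∀ t, M < |t| → g t = 0) {d : ℝ} (hd : 0 < d) {z : ℂ}
    (hz : ∀ t : ℝ, |t| ≤ M → d ≤ ‖z - t‖) :
    ‖analyticExtension g z‖ ≤ (∫ t, |g t|) / d := by
  rw [← integral_div]
  refine norm_integral_le_of_norm_le (hg.abs.div_const d) (Eventually.of_forall fun t => ?_)
  rcases le_or_gt |t| M with h | h
  · rw [norm_div, norm_mul, norm_div, Complex.norm_I, Complex.norm_real, Complex.norm_real,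
      Real.norm_eq_abs, Real.norm_eq_abs, abs_of_pos Real.pi_pos]
    have h1 : 1 / Real.pi ≤ 1 := by
      rw [div_le_one Real.pi_pos]; linarith [Real.pi_gt_three]
    calc 1 / Real.pi * |g t| / ‖z - t‖ ≤ 1 * |g t| / d := by
          gcongr
          exact hz t h
      _ = _ := by rw [one_mul]
  · simp [hM t h]

theorem integrable_japanese_rpow {r : ℝ} (hr : 1 < r) (K : ℝ) (hK : 0 ≤ K) :
    Integrable fun x : ℝ => (K / (1 + |x|)) ^ r := by
  have h := (integrable_one_add_norm (E := ℝ) (μ := volume) (r := r) (by simpa using hr)).const_mul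
    (K ^ r)
  refine h.congr (Eventually.of_forall fun x => ?_)
  simp only [Real.norm_eq_abs]
  rw [Real.div_rpow hK (by positivity), Real.rpow_neg (by positivity)]
  rfl

theorem tendsto_japanese_rpow {r : ℝ} (hr : 0 < r) (K : ℝ) {l : Filter ℝ}
    (hl : Tendsto (fun x : ℝ => |x|) l atTop) :
    Tendsto (fun x : ℝ => (K / (1 + |x|)) ^ r) l (𝓝 0) := by
  have h1 : Tendsto (fun x : ℝ => K / (1 + |x|)) l (𝓝 0) :=
    (tendsto_atTop_add_const_left _ 1 hl).const_div_atTop K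
  have h2 := h1.rpow_const (p := r) (Or.inr hr.le)
  rwa [Real.zero_rpow hr.ne'] at h2

/-! ### The theorem of M. Riesz on the line -/

/-- Riesz's argument. For `g ≥ 0` the function `F = u + i v` has positive real part, so `F ^ r` is
holomorphic in the upper half-plane and its integral over a horizontal line is zero. Integrating
`|F|^r ≤ A u^r - B Re (F^r)` removes the last term and leaves `∫ |v|^r ≤ ∫ |F|^r ≤ A ∫ u^r`. -/
theorem exists_lintegral_conjPoisson_le {r : ℝ} (hr : 1 < r) (hr2 : r ≤ 2) :
    ∃ A : ℝ, 0 ≤ A ∧ ∀ y : ℝ, 0 < y → ∀ g : ℝ → ℝ, Integrable g → (∀ t, 0 ≤ g t) →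
      ∀ M : ℝ, (∀ t, M < |t| → g t = 0) →
      ∫⁻ x, ‖∫ t, conjPoissonKernel y (x - t) * g t‖ₑ ^ r ≤
        ENNReal.ofReal A * ∫⁻ x, ‖∫ t, poissonKernelHalfPlane y (x - t) * g t‖ₑ ^ r := by
  obtain ⟨A, B, hA, hAB⟩ := exists_norm_rpow_le_of_re_pos hr hr2
  refine ⟨A, hA, fun y hy g hg hg0 M hM => ?_⟩
  have hr0 : 0 < r := by linarith
  -- Otherwise the Poisson integral is strictly positive, which keeps `F` off the branch cut of the
  -- power.
  by_cases hz : g =ᵐ[volume] 0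
  · have : ∀ x, ∫ t, conjPoissonKernel y (x - t) * g t = 0 := fun x =>
      integral_eq_zero_of_ae (hz.mono fun t ht => by simp [ht])
    simp [this, hr0]
  set u : ℝ → ℝ := fun x => ∫ t, poissonKernelHalfPlane y (x - t) * g t with hu
  set v : ℝ → ℝ := fun x => ∫ t, conjPoissonKernel y (x - t) * g t with hv
  set F := analyticExtension g with hF
  have hFeq : ∀ x : ℝ, F (x + y * Complex.I) = (u x : ℂ) + (v x : ℂ) * Complex.I :=
    analyticExtension_eq hg hy
  have hpos : ∀ (η : ℝ), 0 < η → ∀ x, 0 < ∫ t, poissonKernelHalfPlane η (x - t) * g t := by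
    intro η hη x
    have hint := integrable_kernel_mul (continuous_poissonKernelHalfPlane hη) (fun x => by
      rw [abs_of_pos (poissonKernelHalfPlane_pos hη x)]; exact poissonKernelHalfPlane_le hη x) hg x
    have hnn : ∀ t, 0 ≤ poissonKernelHalfPlane η (x - t) * g t := fun t =>
      mul_nonneg (poissonKernelHalfPlane_pos hη _).le (hg0 t)
    refine lt_of_le_of_ne (integral_nonneg hnn) fun h => hz ?_
    filter_upwards [(integral_eq_zero_iff_of_nonneg hnn hint).1 h.symm] with t ht
    exact (mul_eq_zero.1 ht).resolve_left (poissonKernelHalfPlane_pos hη _).ne'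
  have hre : ∀ z : ℂ, 0 < z.im → 0 < (F z).re := by
    intro z hz
    have h := analyticExtension_eq hg hz z.re
    rw [Complex.re_add_im] at h
    rw [hF, h]
    simpa using hpos _ hz z.re
  set M' : ℝ := max M 0
  -- Chosen so that `1 + |x| ≤ c ‖x + iη - t‖` for `|t| ≤ M'` and `η ≥ y`: the first summand pays
  -- for `1 + M'` since the norm is at least `y`, the second for `|x| - |t|`.
  set c : ℝ := (1 + M') / y + 1 with hc
  have hM'0 : 0 ≤ M' := le_max_right _ _
  have hc0 : 0 < c := by positivity
  set K : ℝ := c * ∫ t, |g t|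
  have hK : 0 ≤ K := mul_nonneg hc0.le (integral_nonneg fun _ => abs_nonneg _)
  have hbd : ∀ x η : ℝ, y ≤ η → ‖F (x + η * Complex.I)‖ ≤ K / (1 + |x|) := by
    intro x η hη
    have h := norm_analyticExtension_le hg hM (d := (1 + |x|) / c) (by positivity)
      (z := x + η * Complex.I) (by
        intro t ht
        have h1 : |x - t| ≤ ‖(x + η * Complex.I - t : ℂ)‖ := by
          simpa using Complex.abs_re_le_norm (x + η * Complex.I - t : ℂ)
        have h2 : y ≤ ‖(x + η * Complex.I - t : ℂ)‖ := by
          have := Complex.abs_im_le_norm (x + η * Complex.I - t : ℂ)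
          simp at this
          exact hη.trans ((le_abs_self _).trans this)
        have h3 : |x| ≤ |x - t| + |t| := by
          simpa using abs_add_le (x - t) t
        have h4 : |t| ≤ M' := ht.trans (le_max_left _ _)
        rw [div_le_iff₀ hc0, hc, mul_add, mul_one]
        have h5 : 1 + M' ≤ ‖(x + η * Complex.I - t : ℂ)‖ * ((1 + M') / y) := by
          calc 1 + M' = y * ((1 + M') / y) := by field_simp
            _ ≤ _ := by gcongr
        linarith)
    refine h.trans (le_of_eq ?_)
    show _ = (c * ∫ t, |g t|) / (1 + |x|)
    field_simp
  have hzero : ∫ x : ℝ, F (x + y * Complex.I) ^ (r : ℂ) = 0 := by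
    refine integral_horizontal_line_eq_zero (G := fun z => F z ^ (r : ℂ))
      (b := fun x => (K / (1 + |x|)) ^ r) ?_ (integrable_japanese_rpow hr K hK)
      (tendsto_japanese_rpow hr0 K tendsto_abs_atTop_atTop)
      (tendsto_japanese_rpow hr0 K tendsto_abs_atBot_atTop) ?_ ?_
    · intro z hz
      exact (differentiableAt_analyticExtension hg (hy.trans_le hz)).cpow
        (differentiableAt_const _) (Or.inl (hre z (hy.trans_le hz)))
    · intro x η hη
      rw [Complex.norm_cpow_real]
      exact Real.rpow_le_rpow (norm_nonneg _) (hbd x η hη) hr0.le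
    · intro x
      rw [tendsto_zero_iff_norm_tendsto_zero]
      simp_rw [Complex.norm_cpow_real]
      have h1 : Tendsto (fun η : ℝ => ‖F (x + η * Complex.I)‖) atTop (𝓝 0) := by
        refine squeeze_zero' (Eventually.of_forall fun _ => norm_nonneg _) ?_
          (tendsto_id.const_div_atTop (∫ t, |g t|))
        filter_upwards [eventually_gt_atTop 0] with η hη
        refine norm_analyticExtension_le hg hM hη fun t _ => ?_
        have := Complex.abs_im_le_norm (x + η * Complex.I - t : ℂ)
        simp at this
        exact (le_abs_self _).trans this
      have h2 := h1.rpow_const (p := r) (Or.inr hr0.le)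
      rwa [Real.zero_rpow hr0.ne'] at h2
  have hGc : Continuous fun x : ℝ => F (x + y * Complex.I) := by
    rw [continuous_iff_continuousAt]
    intro x
    exact ContinuousAt.comp (f := fun x : ℝ => (x + y * Complex.I : ℂ))
      (differentiableAt_analyticExtension hg (by simpa using hy)).continuousAt (by fun_prop)
  have hu_re : ∀ x : ℝ, u x = (F (x + y * Complex.I)).re := fun x => by rw [hFeq]; simp
  have hv_im : ∀ x : ℝ, v x = (F (x + y * Complex.I)).im := fun x => by rw [hFeq]; simp
  have hupos : ∀ x, 0 < u x := hpos y hy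
  have i1 : Integrable fun x : ℝ => ‖F (x + y * Complex.I)‖ ^ r := by
    refine (integrable_japanese_rpow hr K hK).mono' (hGc.norm.rpow_const fun _ =>
      Or.inr hr0.le).aestronglyMeasurable (Eventually.of_forall fun x => ?_)
    rw [Real.norm_of_nonneg (by positivity)]
    exact Real.rpow_le_rpow (norm_nonneg _) (hbd x y le_rfl) hr0.le
  have i2 : Integrable fun x => u x ^ r := by
    refine i1.mono' ?_ (Eventually.of_forall fun x => ?_)
    · simp_rw [hu_re]
      exact ((Complex.continuous_re.comp hGc).rpow_const
        fun _ => Or.inr hr0.le).aestronglyMeasurable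
    · rw [Real.norm_of_nonneg (Real.rpow_nonneg (hupos x).le _)]
      refine Real.rpow_le_rpow (hupos x).le ?_ hr0.le
      rw [hu_re]
      exact (le_abs_self _).trans (Complex.abs_re_le_norm _)
  have i3 : Integrable fun x : ℝ => F (x + y * Complex.I) ^ (r : ℂ) := by
    refine i1.mono' (hGc.measurable.pow_const _).aestronglyMeasurable
      (Eventually.of_forall fun x => ?_)
    rw [Complex.norm_cpow_real]
  have hle : ∫ x : ℝ, ‖F (x + y * Complex.I)‖ ^ r ≤ A * ∫ x, u x ^ r := by
    calc ∫ x : ℝ, ‖F (x + y * Complex.I)‖ ^ r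
        ≤ ∫ x : ℝ, (A * u x ^ r - B * (F (x + y * Complex.I) ^ (r : ℂ)).re) := by
          refine integral_mono i1 ((i2.const_mul A).sub (i3.re.const_mul B)) fun x => ?_
          have := hAB (F (x + y * Complex.I)) (by rw [← hu_re]; exact hupos x)
          simpa only [hu_re] using this
      _ = A * ∫ x, u x ^ r := by
          have h0 : ∫ x : ℝ, (F (x + y * Complex.I) ^ (r : ℂ)).re = 0 := by
            have := integral_re i3
            simp only [RCLike.re_to_complex] at this
            rw [this, hzero, Complex.zero_re]
          have i3' : Integrable fun x : ℝ => (F (x + y * Complex.I) ^ (r : ℂ)).re := i3.re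
          rw [integral_sub (i2.const_mul A) (i3'.const_mul B), integral_const_mul,
            integral_const_mul]
          simp [h0]
  calc ∫⁻ x, ‖v x‖ₑ ^ r
      ≤ ∫⁻ x : ℝ, ENNReal.ofReal (‖F (x + y * Complex.I)‖ ^ r) := by
        refine lintegral_mono fun x => ?_
        rw [← ENNReal.ofReal_rpow_of_nonneg (norm_nonneg _) hr0.le, ← ofReal_norm]
        gcongr
        rw [hv_im, Real.norm_eq_abs]
        exact Complex.abs_im_le_norm _
    _ = ENNReal.ofReal (∫ x : ℝ, ‖F (x + y * Complex.I)‖ ^ r) :=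
        (ofReal_integral_eq_lintegral_ofReal i1
          (Eventually.of_forall fun x => by positivity)).symm
    _ ≤ ENNReal.ofReal (A * ∫ x, u x ^ r) := ENNReal.ofReal_le_ofReal hle
    _ = ENNReal.ofReal A * ∫⁻ x, ‖u x‖ₑ ^ r := by
        rw [ENNReal.ofReal_mul hA, ofReal_integral_eq_lintegral_ofReal i2
          (Eventually.of_forall fun x => Real.rpow_nonneg (hupos x).le _)]
        congr 1
        refine lintegral_congr fun x => ?_
        rw [← ENNReal.ofReal_rpow_of_nonneg (hupos x).le hr0.le, Real.enorm_of_nonneg (hupos x).le]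

/-- The conjugate Poisson integral of `g`, at height `y`. -/
noncomputable def conjPoissonIntegral (y : ℝ) (g : ℝ → ℂ) (x : ℝ) : ℂ :=
  ∫ t, (conjPoissonKernel y (x - t) : ℂ) * g t

theorem integrable_conjPoissonKernel_mul {y : ℝ} (hy : 0 < y) {g : ℝ → ℂ} (hg : Integrable g)
    (x : ℝ) : Integrable fun t => (conjPoissonKernel y (x - t) : ℂ) * g t :=
  hg.bdd_mul (c := 1 / (Real.pi * y))
    (Complex.continuous_ofReal.comp ((continuous_conjPoissonKernel hy).comp
      (continuous_const.sub continuous_id))).aestronglyMeasurable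
    (Eventually.of_forall fun t => by
      simpa only [Complex.norm_real, Real.norm_eq_abs] using abs_conjPoissonKernel_le hy (x - t))

theorem stronglyMeasurable_conjPoissonIntegral {y : ℝ} (hy : 0 < y) {g : ℝ → ℂ}
    (hg : Measurable g) : StronglyMeasurable (conjPoissonIntegral y g) := by
  refine StronglyMeasurable.integral_prod_right
    (f := fun x t : ℝ => (conjPoissonKernel y (x - t) : ℂ) * g t) ?_
  refine Measurable.stronglyMeasurable ?_
  have := (continuous_conjPoissonKernel hy).measurable
  unfold Function.uncurry
  fun_prop

theorem norm_conjPoissonIntegral_le {y : ℝ} (hy : 0 < y) {g : ℝ → ℂ} (hg : Integrable g) (x : ℝ) :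
    ‖conjPoissonIntegral y g x‖ ≤ 1 / (Real.pi * y) * ∫ t, ‖g t‖ := by
  rw [← integral_const_mul]
  refine norm_integral_le_of_norm_le (hg.norm.const_mul _) (Eventually.of_forall fun t => ?_)
  rw [norm_mul, Complex.norm_real, Real.norm_eq_abs]
  exact mul_le_mul_of_nonneg_right (abs_conjPoissonKernel_le hy _) (norm_nonneg _)

theorem exists_eLpNorm_conjPoissonIntegral_ofReal_le {p : ℝ≥0∞} (hp : 1 < p) (hp2 : p ≤ 2) :
    ∃ C : NNReal, ∀ y : ℝ, 0 < y → ∀ g : ℝ → ℝ, Measurable g → Integrable g → (∀ t, 0 ≤ g t) →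
      ∀ M : ℝ, (∀ t, M < |t| → g t = 0) →
      eLpNorm (conjPoissonIntegral y fun t => (g t : ℂ)) p volume ≤ C * eLpNorm g p volume := by
  have hp_top : p ≠ ∞ := ne_top_of_le_ne_top ENNReal.ofNat_ne_top hp2
  have hr : 1 < p.toReal := by
    simpa using (ENNReal.toReal_lt_toReal ENNReal.one_ne_top hp_top).2 hp
  have hr2 : p.toReal ≤ 2 := by
    simpa using (ENNReal.toReal_le_toReal hp_top ENNReal.ofNat_ne_top).2 hp2
  have hr0 : 0 < p.toReal := by linarith
  obtain ⟨A, hA, h⟩ := exists_lintegral_conjPoisson_le hr hr2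
  refine ⟨(A ^ (1 / p.toReal)).toNNReal, fun y hy g hgm hg hg0 M hM => ?_⟩
  rw [← ENNReal.rpow_le_rpow_iff hr0, ENNReal.mul_rpow_of_nonneg _ _ hr0.le,
    eLpNorm_rpow_toReal hp.le hp_top]
  have hAr : ((A ^ (1 / p.toReal)).toNNReal : ℝ≥0∞) ^ p.toReal = ENNReal.ofReal A := by
    rw [← ENNReal.ofReal, ENNReal.ofReal_rpow_of_nonneg (by positivity) hr0.le,
      ← Real.rpow_mul hA, one_div_mul_cancel hr0.ne', Real.rpow_one]
  rw [hAr]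
  calc ∫⁻ x, ‖conjPoissonIntegral y (fun t => (g t : ℂ)) x‖ₑ ^ p.toReal
      = ∫⁻ x, ‖∫ t, conjPoissonKernel y (x - t) * g t‖ₑ ^ p.toReal := by
        refine lintegral_congr fun x => ?_
        congr 1
        rw [conjPoissonIntegral, ← ofReal_norm, ← ofReal_norm, ← Complex.norm_real,
          ← integral_complex_ofReal]
        simp only [Complex.ofReal_mul]
    _ ≤ ENNReal.ofReal A *
        ∫⁻ x, ‖∫ t, poissonKernelHalfPlane y (x - t) * g t‖ₑ ^ p.toReal := h y hy g hg hg0 M hM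
    _ ≤ ENNReal.ofReal A * eLpNorm g p volume ^ p.toReal := by
        rw [← eLpNorm_rpow_toReal hp.le hp_top]
        gcongr
        exact eLpNorm_poisson_le hp.le hp_top hy hgm

/-- The positive and negative parts of `Re g` and `Im g` are each dominated by `‖g‖`; four of them
make the constant `4 C`. -/
theorem exists_eLpNorm_conjPoissonIntegral_le_of_bounded_support {p : ℝ≥0∞} (hp : 1 < p)
    (hp2 : p ≤ 2) :
    ∃ C : NNReal, ∀ y : ℝ, 0 < y → ∀ g : ℝ → ℂ, Measurable g → Integrable g →
      ∀ M : ℝ, (∀ t, M < |t| → g t = 0) →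
      eLpNorm (conjPoissonIntegral y g) p volume ≤ C * eLpNorm g p volume := by
  obtain ⟨C, hC⟩ := exists_eLpNorm_conjPoissonIntegral_ofReal_le hp hp2
  have key : ∀ y : ℝ, 0 < y → ∀ (g : ℝ → ℂ) (a : ℝ → ℝ), Integrable g → Measurable a →
      (∀ t, |a t| ≤ ‖g t‖) → ∀ M : ℝ, (∀ t, M < |t| → g t = 0) →
      eLpNorm (conjPoissonIntegral y fun t => (max (a t) 0 : ℝ)) p volume ≤ C * eLpNorm g p volume := by
    intro y hy g a hg ha hag M hM
    have hle : ∀ t, ‖max (a t) 0‖ ≤ ‖g t‖ := fun t => by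
      rw [Real.norm_of_nonneg (le_max_right _ _)]
      exact max_le ((le_abs_self _).trans (hag t)) (norm_nonneg _)
    have hm : Measurable fun t => max (a t) 0 := ha.max measurable_const
    refine (hC y hy (fun t => max (a t) 0) hm
      (hg.mono hm.aestronglyMeasurable (Eventually.of_forall hle))
      (fun t => le_max_right _ _) M fun t ht => ?_).trans ?_
    · have := hle t
      rw [hM t ht, norm_zero] at this
      exact norm_le_zero_iff.1 this
    · gcongr
      exact eLpNorm_mono hle
  refine ⟨4 * C, fun y hy g hgm hg M hM => ?_⟩
  have hre : Measurable fun t => (g t).re := Complex.measurable_re.comp hgm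
  have him : Measurable fun t => (g t).im := Complex.measurable_im.comp hgm
  have hre' : Measurable fun t => -(g t).re := hre.neg
  have him' : Measurable fun t => -(g t).im := him.neg
  have hmax : ∀ a : ℝ → ℝ, Measurable a → (∀ t, |a t| ≤ ‖g t‖) →
      Measurable (fun t => ((max (a t) 0 : ℝ) : ℂ)) ∧ Integrable fun t => ((max (a t) 0 : ℝ) : ℂ) := by
    intro a ha hag
    have hm : Measurable fun t => ((max (a t) 0 : ℝ) : ℂ) :=
      Complex.measurable_ofReal.comp (ha.max measurable_const)
    refine ⟨hm, hg.mono hm.aestronglyMeasurable (Eventually.of_forall fun t => ?_)⟩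
    rw [Complex.norm_real, Real.norm_of_nonneg (le_max_right _ _)]
    exact max_le ((le_abs_self _).trans (hag t)) (norm_nonneg _)
  have b1 : ∀ t, |(g t).re| ≤ ‖g t‖ := fun t => Complex.abs_re_le_norm _
  have b2 : ∀ t, |-(g t).re| ≤ ‖g t‖ := fun t => by rw [abs_neg]; exact b1 t
  have b3 : ∀ t, |(g t).im| ≤ ‖g t‖ := fun t => Complex.abs_im_le_norm _
  have b4 : ∀ t, |-(g t).im| ≤ ‖g t‖ := fun t => by rw [abs_neg]; exact b3 t
  obtain ⟨m1, i1⟩ := hmax _ hre b1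
  obtain ⟨m2, i2⟩ := hmax _ hre' b2
  obtain ⟨m3, i3⟩ := hmax _ him b3
  obtain ⟨m4, i4⟩ := hmax _ him' b4
  have e : conjPoissonIntegral y g =
      (conjPoissonIntegral y (fun t => ((max (g t).re 0 : ℝ) : ℂ)) -
        conjPoissonIntegral y (fun t => ((max (-(g t).re) 0 : ℝ) : ℂ))) +
      Complex.I • (conjPoissonIntegral y (fun t => ((max (g t).im 0 : ℝ) : ℂ)) -
        conjPoissonIntegral y (fun t => ((max (-(g t).im) 0 : ℝ) : ℂ))) := by
    funext x
    have j1 := integrable_conjPoissonKernel_mul hy i1 x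
    have j2 := integrable_conjPoissonKernel_mul hy i2 x
    have j3 := integrable_conjPoissonKernel_mul hy i3 x
    have j4 := integrable_conjPoissonKernel_mul hy i4 x
    simp only [conjPoissonIntegral, Pi.add_apply, Pi.sub_apply, Pi.smul_apply, smul_eq_mul]
    have j12 : Integrable fun t => (conjPoissonKernel y (x - t) : ℂ) * ((max (g t).re 0 : ℝ) : ℂ) -
        (conjPoissonKernel y (x - t) : ℂ) * ((max (-(g t).re) 0 : ℝ) : ℂ) := j1.sub j2
    have j34 : Integrable fun t => Complex.I *
        ((conjPoissonKernel y (x - t) : ℂ) * ((max (g t).im 0 : ℝ) : ℂ) -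
        (conjPoissonKernel y (x - t) : ℂ) * ((max (-(g t).im) 0 : ℝ) : ℂ)) :=
      (j3.sub j4).const_mul _
    rw [← integral_sub j1 j2, ← integral_sub j3 j4, ← integral_const_mul, ← integral_add j12 j34]
    refine integral_congr_ae (Eventually.of_forall fun t => ?_)
    have hmx : ∀ a : ℝ, a = max a 0 - max (-a) 0 := fun a => (max_zero_sub_max_neg_zero_eq_self a).symm
    have hgt : g t = ((max (g t).re 0 - max (-(g t).re) 0 : ℝ) : ℂ) +
        Complex.I * ((max (g t).im 0 - max (-(g t).im) 0 : ℝ) : ℂ) := by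
      rw [← hmx, ← hmx, mul_comm, Complex.re_add_im]
    simp only
    nth_rewrite 1 [hgt]
    push_cast
    ring
  have s := fun {f : ℝ → ℂ} (hf : Measurable f) =>
    (stronglyMeasurable_conjPoissonIntegral hy hf).aestronglyMeasurable (μ := volume)
  have k1 := key y hy g (fun t => (g t).re) hg hre b1 M hM
  have k2 := key y hy g (fun t => -(g t).re) hg hre' b2 M hM
  have k3 := key y hy g (fun t => (g t).im) hg him b3 M hM
  have k4 := key y hy g (fun t => -(g t).im) hg him' b4 M hM
  rw [e]
  refine (eLpNorm_add_le ((s m1).sub (s m2)) (((s m3).sub (s m4)).const_smul _) hp.le).trans ?_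
  rw [eLpNorm_const_smul, ← ofReal_norm, Complex.norm_I, ENNReal.ofReal_one, one_mul]
  calc _ ≤ (C * eLpNorm g p volume + C * eLpNorm g p volume) + (C * eLpNorm g p volume + C * eLpNorm g p volume) :=
        add_le_add ((eLpNorm_sub_le (s m1) (s m2) hp.le).trans (add_le_add k1 k2))
          ((eLpNorm_sub_le (s m3) (s m4) hp.le).trans (add_le_add k3 k4))
    _ = _ := by push_cast; ring

theorem eLpNorm_le_of_indicator_Icc_le {p : ℝ≥0∞} {G : ℝ → ℂ} (hG : StronglyMeasurable G)
    {C : ℝ≥0∞} (h : ∀ N : ℕ, eLpNorm ((Set.Icc (-N : ℝ) N).indicator G) p volume ≤ C) :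
    eLpNorm G p volume ≤ C := by
  refine (Lp.eLpNorm_lim_le_liminf_eLpNorm
    (fun N => (hG.indicator measurableSet_Icc).aestronglyMeasurable) G
    (Eventually.of_forall fun x => ?_)).trans
    ((liminf_le_liminf (Eventually.of_forall h)).trans (by simp))
  refine tendsto_const_nhds.congr' ?_
  obtain ⟨n, hn⟩ := exists_nat_ge |x|
  filter_upwards [eventually_ge_atTop n] with N hN
  have : |x| ≤ N := hn.trans (by exact_mod_cast hN)
  rw [Set.indicator_of_mem]
  exact abs_le.1 this

/-- The bound for bounded support does not depend on the size of the support, so Fatou's lemma along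
truncations of `g` removes that hypothesis. -/
theorem exists_eLpNorm_conjPoissonIntegral_le_of_le_two {p : ℝ≥0∞} (hp : 1 < p) (hp2 : p ≤ 2) :
    ∃ C : NNReal, ∀ y : ℝ, 0 < y → ∀ g : ℝ → ℂ, Measurable g → Integrable g →
      eLpNorm (conjPoissonIntegral y g) p volume ≤ C * eLpNorm g p volume := by
  obtain ⟨C, hC⟩ := exists_eLpNorm_conjPoissonIntegral_le_of_bounded_support hp hp2
  refine ⟨C, fun y hy g hgm hg => ?_⟩
  set gN : ℕ → ℝ → ℂ := fun N => (Set.Icc (-N : ℝ) N).indicator g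
  have hgNm : ∀ N, Measurable (gN N) := fun N => hgm.indicator measurableSet_Icc
  have hle : ∀ N t, ‖gN N t‖ ≤ ‖g t‖ := fun N t => norm_indicator_le_norm_self _ _
  refine (Lp.eLpNorm_lim_le_liminf_eLpNorm (f := fun N => conjPoissonIntegral y (gN N))
    (fun N => (stronglyMeasurable_conjPoissonIntegral hy (hgNm N)).aestronglyMeasurable) _
    (Eventually.of_forall fun x => ?_)).trans
    ((liminf_le_liminf (v := fun _ => C * eLpNorm g p volume)
      (Eventually.of_forall fun N => ?_)).trans (by simp))
  · have hgx := integrable_conjPoissonKernel_mul hy hg x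
    have hm : Measurable fun t => (conjPoissonKernel y (x - t) : ℂ) :=
      Complex.measurable_ofReal.comp ((continuous_conjPoissonKernel hy).measurable.comp
        (measurable_const.sub measurable_id))
    refine tendsto_integral_of_dominated_convergence
      (fun t => ‖(conjPoissonKernel y (x - t) : ℂ) * g t‖)
      (fun N => (hm.mul (hgNm N)).aestronglyMeasurable) hgx.norm
      (fun N => Eventually.of_forall fun t => ?_) (Eventually.of_forall fun t => ?_)
    · rw [norm_mul, norm_mul]
      exact mul_le_mul_of_nonneg_left (hle N t) (norm_nonneg _)
    · refine tendsto_const_nhds.congr' ?_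
      obtain ⟨n, hn⟩ := exists_nat_ge |t|
      filter_upwards [eventually_ge_atTop n] with N hN
      have : |t| ≤ N := hn.trans (by exact_mod_cast hN)
      simp only [gN]
      rw [Set.indicator_of_mem (show t ∈ Set.Icc (-N : ℝ) N from abs_le.1 this)]
  · refine (hC y hy (gN N) (hgNm N) (hg.mono (hgNm N).aestronglyMeasurable
      (Eventually.of_forall (hle N))) N fun t ht => ?_).trans ?_
    · exact Set.indicator_of_notMem
        (show t ∉ Set.Icc (-N : ℝ) N from fun h => (not_le.2 ht) (abs_le.2 h)) g
    · gcongr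
      exact eLpNorm_mono (hle N)

/-- Fubini and the oddness of the kernel: the operator is antisymmetric for the bilinear pairing, so
bounds pass to the conjugate exponent. -/
theorem integral_conjPoissonIntegral_mul {y : ℝ} (hy : 0 < y) {g h : ℝ → ℂ} (hg : Integrable g)
    (hh : Integrable h) :
    ∫ x, conjPoissonIntegral y g x * h x = -∫ t, g t * conjPoissonIntegral y h t := by
  have hint : Integrable (Function.uncurry fun x t : ℝ =>
      (conjPoissonKernel y (x - t) : ℂ) * (h x * g t)) (volume.prod volume) := by
    refine (hh.mul_prod hg).bdd_mul (c := 1 / (Real.pi * y)) ?_ (Eventually.of_forall fun z => ?_)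
    · exact (Complex.continuous_ofReal.comp ((continuous_conjPoissonKernel hy).comp
        (continuous_fst.sub continuous_snd))).aestronglyMeasurable
    · simpa only [Complex.norm_real, Real.norm_eq_abs] using abs_conjPoissonKernel_le hy (z.1 - z.2)
  calc ∫ x, conjPoissonIntegral y g x * h x
      = ∫ x, ∫ t, (conjPoissonKernel y (x - t) : ℂ) * (h x * g t) := by
        simp only [conjPoissonIntegral, ← integral_mul_const]
        refine integral_congr_ae (Eventually.of_forall fun x => ?_)
        refine integral_congr_ae (Eventually.of_forall fun t => ?_)
        simp only; ring
    _ = ∫ t, ∫ x, (conjPoissonKernel y (x - t) : ℂ) * (h x * g t) := integral_integral_swap hint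
    _ = _ := by
        simp only [conjPoissonIntegral, ← integral_const_mul, ← integral_neg]
        refine integral_congr_ae (Eventually.of_forall fun t => ?_)
        refine integral_congr_ae (Eventually.of_forall fun x => ?_)
        simp only
        rw [← neg_sub, conjPoissonKernel_neg]
        push_cast; ring

/-- Duality with an explicit test function: on `[-N, N]` the image `G` of `g` is paired with `h =
conj G |G|^(r-2)`. The pairing is `J = ∫ |G|^r`, and `h` has `L^q` norm `J^(1/s)`. Moving the
operator onto `h` gives `J ≤ ‖g‖ C J^(1/s)`. The truncation and the sup bound on `G` make `J`
finite, so that `J^(1/s)` can be cancelled. -/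
theorem exists_eLpNorm_conjPoissonIntegral_le_of_conjugate {p q : ℝ≥0∞} [p.HolderConjugate q]
    (hp : 1 < p) (hp_top : p ≠ ∞)
    (hq : ∃ C : NNReal, ∀ y : ℝ, 0 < y → ∀ g : ℝ → ℂ, Measurable g → Integrable g →
      eLpNorm (conjPoissonIntegral y g) q volume ≤ C * eLpNorm g q volume) :
    ∃ C : NNReal, ∀ y : ℝ, 0 < y → ∀ g : ℝ → ℂ, Measurable g → Integrable g →
      eLpNorm (conjPoissonIntegral y g) p volume ≤ C * eLpNorm g p volume := by
  obtain ⟨C, hC⟩ := hq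
  have hr1 : 1 < p.toReal := by
    simpa using (ENNReal.toReal_lt_toReal ENNReal.one_ne_top hp_top).2 hp
  have hconj : p.toReal.HolderConjugate q.toReal := ENNReal.HolderConjugate.toReal hr1
  have hq1 : 1 ≤ q := ENNReal.HolderConjugate.one_le q p
  have hq_top : q ≠ ∞ := (ENNReal.toReal_ne_zero.1 hconj.symm.pos.ne').2
  set r := p.toReal with hr
  set s := q.toReal with hs
  have hr0 : 0 < r := hconj.pos
  have hs0 : 0 < s := hconj.symm.pos
  refine ⟨C, fun y hy g hgm hg => eLpNorm_le_of_indicator_Icc_le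
    (stronglyMeasurable_conjPoissonIntegral hy hgm) fun N => ?_⟩
  set G := conjPoissonIntegral y g with hG
  have hGm : Measurable G := (stronglyMeasurable_conjPoissonIntegral hy hgm).measurable
  set S := Set.Icc (-N : ℝ) N with hSdef
  have hS : MeasurableSet S := measurableSet_Icc
  set h : ℝ → ℂ := S.indicator fun x => (starRingEnd ℂ) (G x) * ((‖G x‖ ^ (r - 2) : ℝ) : ℂ) with hh
  have hhm : Measurable h :=
    ((Complex.continuous_conj.measurable.comp hGm).mul
      (Complex.measurable_ofReal.comp (hGm.norm.pow_const _))).indicator hS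
  have hnh : ∀ x, ‖h x‖ = S.indicator (fun x => ‖G x‖ ^ (r - 1)) x := by
    intro x
    by_cases hx : x ∈ S
    · simp only [hh, Set.indicator_of_mem hx, norm_mul, RCLike.norm_conj, Complex.norm_real,
        Real.norm_eq_abs]
      rw [abs_of_nonneg (by positivity)]
      rcases (norm_nonneg (G x)).eq_or_lt with h0 | h0
      · rw [← h0, zero_mul, Real.zero_rpow (by linarith)]
      · rw [← Real.rpow_one_add' h0.le (by linarith)]
        ring_nf
    · simp only [hh, Set.indicator_of_notMem hx, norm_zero]
  have hGh : ∀ x, G x * h x = ((S.indicator (fun x => ‖G x‖ ^ r) x : ℝ) : ℂ) := by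
    intro x
    by_cases hx : x ∈ S
    · simp only [hh, Set.indicator_of_mem hx]
      rw [← mul_assoc, Complex.mul_conj, Complex.normSq_eq_norm_sq, ← Complex.ofReal_mul]
      congr 1
      rcases (norm_nonneg (G x)).eq_or_lt with h0 | h0
      · rw [← h0, Real.zero_rpow hr0.ne']; simp
      · rw [← Real.rpow_natCast, ← Real.rpow_add h0]
        congr 1; push_cast; ring
    · simp only [hh, Set.indicator_of_notMem hx, mul_zero, Complex.ofReal_zero]
  set B : ℝ := 1 / (Real.pi * y) * ∫ t, ‖g t‖ with hB
  have hGB : ∀ x, ‖G x‖ ≤ B := norm_conjPoissonIntegral_le hy hg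
  have hSfin : volume S < ∞ := by rw [hSdef, Real.volume_Icc]; exact ENNReal.ofReal_lt_top
  have hhint : Integrable h := by
    rw [hh, integrable_indicator_iff hS]
    refine IntegrableOn.of_bound hSfin
      ((Complex.continuous_conj.measurable.comp hGm).mul
        (Complex.measurable_ofReal.comp (hGm.norm.pow_const _))).aestronglyMeasurable
      (B ^ (r - 1)) ?_
    rw [ae_restrict_iff' hS]
    refine Eventually.of_forall fun x hx => ?_
    have := hnh x
    simp only [hh, Set.indicator_of_mem hx] at this
    rw [this]
    exact Real.rpow_le_rpow (norm_nonneg _) (hGB x) (by linarith)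
  set J : ℝ≥0∞ := ∫⁻ x in S, ‖G x‖ₑ ^ r with hJ
  have hJfin : J ≠ ∞ := by
    refine ne_top_of_le_ne_top ?_ (lintegral_mono (g := fun _ => ENNReal.ofReal B ^ r) fun x => ?_)
    · rw [lintegral_const, Measure.restrict_apply_univ]
      exact ENNReal.mul_ne_top (ENNReal.rpow_ne_top_of_nonneg hr0.le ENNReal.ofReal_ne_top) hSfin.ne
    · rw [← ofReal_norm]
      exact ENNReal.rpow_le_rpow (ENNReal.ofReal_le_ofReal (hGB x)) hr0.le
  have hJ1 : ‖∫ x, G x * h x‖ₑ = J := by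
    have hnn : 0 ≤ᵐ[volume] S.indicator fun x => ‖G x‖ ^ r :=
      Eventually.of_forall fun x => Set.indicator_nonneg (fun _ _ => by positivity) x
    simp_rw [hGh]
    rw [integral_complex_ofReal, ← ofReal_norm, Complex.norm_real, Real.norm_of_nonneg
      (integral_nonneg_of_ae hnn), integral_eq_lintegral_of_nonneg_ae hnn
      ((hGm.norm.pow_const _).indicator hS).aestronglyMeasurable]
    have e : ∫⁻ x, ENNReal.ofReal (S.indicator (fun x => ‖G x‖ ^ r) x) = J := by
      rw [hJ, ← lintegral_indicator hS]
      refine lintegral_congr fun x => ?_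
      by_cases hx : x ∈ S
      · simp only [Set.indicator_of_mem hx]
        rw [← ofReal_norm, ENNReal.ofReal_rpow_of_nonneg (norm_nonneg _) hr0.le]
      · simp only [Set.indicator_of_notMem hx, ENNReal.ofReal_zero]
    rw [e, ENNReal.ofReal_toReal hJfin]
  have hnormh : eLpNorm h q volume = J ^ (1 / s) := by
    rw [eLpNorm_eq_lintegral_rpow_enorm_toReal (zero_lt_one.trans_le hq1).ne' hq_top, hJ,
      ← lintegral_indicator hS]
    congr 1
    refine lintegral_congr fun x => ?_
    rw [← ofReal_norm, hnh]
    by_cases hx : x ∈ S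
    · simp only [Set.indicator_of_mem hx]
      rw [← ENNReal.ofReal_rpow_of_nonneg (norm_nonneg _) (by linarith), ← ENNReal.rpow_mul,
        ofReal_norm, ← hs, hconj.sub_one_mul_conj]
    · simp only [Set.indicator_of_notMem hx, ENNReal.ofReal_zero, ← hs]
      exact ENNReal.zero_rpow_of_pos hs0
  have hle : J ≤ eLpNorm g p volume * (C * J ^ (1 / s)) := by
    refine hJ1.symm.trans_le ?_
    rw [hG, integral_conjPoissonIntegral_mul hy hg hhint, enorm_neg]
    refine (enorm_integral_le_lintegral_enorm _).trans ?_
    simp_rw [enorm_mul]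
    refine (ENNReal.lintegral_mul_le_Lp_mul_Lq volume hconj hgm.enorm.aemeasurable
      (stronglyMeasurable_conjPoissonIntegral hy hhm).measurable.enorm.aemeasurable).trans ?_
    rw [← eLpNorm_eq_lintegral_rpow_enorm_toReal (zero_lt_one.trans hp).ne' hp_top,
      ← eLpNorm_eq_lintegral_rpow_enorm_toReal (zero_lt_one.trans_le hq1).ne' hq_top]
    gcongr
    rw [← hnormh]
    exact hC y hy h hhm hhint
  have hnormG : eLpNorm (S.indicator G) p volume = J ^ (1 / r) := by
    rw [eLpNorm_indicator_eq_eLpNorm_restrict hS,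
      eLpNorm_eq_lintegral_rpow_enorm_toReal (zero_lt_one.trans hp).ne' hp_top]
  rw [hnormG]
  rcases eq_or_ne J 0 with h0 | h0
  · rw [h0, ENNReal.zero_rpow_of_pos (by positivity)]; exact zero_le
  have hexp : J ^ (1 / r) * J ^ (1 / s) = J := by
    rw [← ENNReal.rpow_add _ _ h0 hJfin, one_div, one_div, hconj.inv_add_inv_eq_one,
      ENNReal.rpow_one]
  have hJs0 : J ^ (1 / s) ≠ 0 := by simp [h0, hJfin]
  have hJst : J ^ (1 / s) ≠ ∞ := ENNReal.rpow_ne_top_of_nonneg (by positivity) hJfin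
  rw [← ENNReal.mul_le_mul_iff_left hJs0 hJst, hexp]
  calc J ≤ _ := hle
    _ = _ := by ring

/-- The `L^p` bound of M. Riesz: taking the conjugate Poisson integral is bounded on `L^p(ℝ)`,
`1 < p < ∞`, uniformly in the height. -/
theorem exists_eLpNorm_conjPoissonIntegral_le {p : ℝ≥0∞} (hp : 1 < p) (hp_top : p ≠ ∞) :
    ∃ C : NNReal, ∀ y : ℝ, 0 < y → ∀ g : ℝ → ℂ, Measurable g → Integrable g →
      eLpNorm (conjPoissonIntegral y g) p volume ≤ C * eLpNorm g p volume := by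
  rcases le_total p 2 with h2 | h2
  · exact exists_eLpNorm_conjPoissonIntegral_le_of_le_two hp h2
  · have : Fact (1 ≤ p) := ⟨hp.le⟩
    have hq := ENNReal.HolderConjugate.conjExponent hp.le
    refine exists_eLpNorm_conjPoissonIntegral_le_of_conjugate (q := p.conjExponent) hp hp_top
      (exists_eLpNorm_conjPoissonIntegral_le_of_le_two ?_ ?_)
    · exact (ENNReal.HolderConjugate.lt_top_iff_one_lt p p.conjExponent).1 hp_top.lt_top
    · rw [ENNReal.conjExponent]
      have h1 : 1 ≤ p - 1 := by
        rw [ENNReal.le_sub_iff_add_le_right ENNReal.one_ne_top hp.le, one_add_one_eq_two]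
        exact h2
      calc 1 + (p - 1)⁻¹ ≤ 1 + 1 := by gcongr; exact ENNReal.inv_le_one.2 h1
        _ = 2 := one_add_one_eq_two

/-! ### Double Hilbert transforms in the plane and their rotation averages -/

/-- The kernel is a tensor product, so the operator is the one-dimensional one applied in the second
variable (giving `g s b`) and then in the first. Tonelli combines the two bounds into `C * C`. -/
theorem exists_eLpNorm_prod_conjPoisson_le {p : ℝ≥0∞} (hp : 1 < p) (hp_top : p ≠ ∞) :
    ∃ C : NNReal, ∀ y : ℝ, 0 < y → ∀ f : ℝ × ℝ → ℂ, Measurable f → Integrable f →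
      eLpNorm (fun z : ℝ × ℝ => ∫ w : ℝ × ℝ, (conjPoissonKernel y (z.1 - w.1) *
        conjPoissonKernel y (z.2 - w.2) : ℂ) * f w) p volume ≤ C * eLpNorm f p volume := by
  obtain ⟨C, hC⟩ := exists_eLpNorm_conjPoissonIntegral_le hp hp_top
  have hr0 : 0 < p.toReal := ENNReal.toReal_pos (zero_lt_one.trans hp).ne' hp_top
  refine ⟨C * C, fun y hy f hfm hf => ?_⟩
  have hQ : Measurable (conjPoissonKernel y) := (continuous_conjPoissonKernel hy).measurable
  have hC' : ∀ g : ℝ → ℂ, Measurable g → Integrable g →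
      ∫⁻ x, ‖conjPoissonIntegral y g x‖ₑ ^ p.toReal ≤
        (C : ℝ≥0∞) ^ p.toReal * ∫⁻ x, ‖g x‖ₑ ^ p.toReal := by
    intro g hgm hg
    rw [← eLpNorm_rpow_toReal hp.le hp_top, ← eLpNorm_rpow_toReal hp.le hp_top,
      ← ENNReal.mul_rpow_of_nonneg _ _ hr0.le]
    exact ENNReal.rpow_le_rpow (hC y hy g hgm hg) hr0.le
  set g : ℝ → ℝ → ℂ := fun s b => conjPoissonIntegral y (fun t => f (s, t)) b with hg
  have hgm : Measurable (Function.uncurry g) := by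
    refine (StronglyMeasurable.integral_prod_right (f := fun (sb : ℝ × ℝ) (t : ℝ) =>
      (conjPoissonKernel y (sb.2 - t) : ℂ) * f (sb.1, t)) ?_).measurable
    refine Measurable.stronglyMeasurable ?_
    unfold Function.uncurry
    fun_prop
  have hgint : ∀ b, Integrable fun s => g s b := by
    intro b
    have h1 : Integrable fun s => 1 / (Real.pi * y) * ∫ t, ‖f (s, t)‖ :=
      hf.integral_norm_prod_left.const_mul _
    refine h1.mono' (hgm.comp (measurable_id.prodMk measurable_const)).aestronglyMeasurable ?_
    filter_upwards [hf.prod_right_ae] with s hs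
    exact norm_conjPoissonIntegral_le hy hs b
  have hG : ∀ z : ℝ × ℝ, ∫ w : ℝ × ℝ, (conjPoissonKernel y (z.1 - w.1) *
      conjPoissonKernel y (z.2 - w.2) : ℂ) * f w = conjPoissonIntegral y (fun s => g s z.2) z.1 := by
    intro z
    have hint : Integrable fun w : ℝ × ℝ => (conjPoissonKernel y (z.1 - w.1) *
        conjPoissonKernel y (z.2 - w.2) : ℂ) * f w := by
      refine hf.bdd_mul (c := 1 / (Real.pi * y) * (1 / (Real.pi * y))) ?_
        (Eventually.of_forall fun w => ?_)
      · exact Measurable.aestronglyMeasurable (by fun_prop)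
      · rw [norm_mul, Complex.norm_real, Complex.norm_real]
        exact mul_le_mul (abs_conjPoissonKernel_le hy _) (abs_conjPoissonKernel_le hy _)
          (abs_nonneg _) (by positivity)
    rw [Measure.volume_eq_prod, integral_prod _ hint, conjPoissonIntegral]
    refine integral_congr_ae (Eventually.of_forall fun s => ?_)
    simp only [hg, conjPoissonIntegral, ← integral_const_mul]
    refine integral_congr_ae (Eventually.of_forall fun t => ?_)
    simp only
    ring
  simp_rw [hG]
  have hGm : Measurable fun z : ℝ × ℝ => conjPoissonIntegral y (fun s => g s z.2) z.1 := by
    refine (StronglyMeasurable.integral_prod_right (f := fun (z : ℝ × ℝ) (s : ℝ) =>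
      (conjPoissonKernel y (z.1 - s) : ℂ) * g s z.2) ?_).measurable
    refine Measurable.stronglyMeasurable ?_
    have : Measurable fun q : (ℝ × ℝ) × ℝ => g q.2 q.1.2 :=
      hgm.comp (measurable_snd.prodMk (measurable_snd.comp measurable_fst))
    unfold Function.uncurry
    fun_prop
  rw [← ENNReal.rpow_le_rpow_iff hr0, ENNReal.mul_rpow_of_nonneg _ _ hr0.le,
    eLpNorm_rpow_toReal hp.le hp_top, eLpNorm_rpow_toReal hp.le hp_top, Measure.volume_eq_prod,
    lintegral_prod_symm _ (hGm.enorm.pow_const _).aemeasurable,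
    lintegral_prod _ (hfm.enorm.pow_const _).aemeasurable, ENNReal.coe_mul,
    ENNReal.mul_rpow_of_nonneg _ _ hr0.le, mul_assoc]
  have hCt : (C : ℝ≥0∞) ^ p.toReal ≠ ∞ := ENNReal.rpow_ne_top_of_nonneg hr0.le ENNReal.coe_ne_top
  calc ∫⁻ b, ∫⁻ a, ‖conjPoissonIntegral y (fun s => g s b) a‖ₑ ^ p.toReal
      ≤ ∫⁻ b, (C : ℝ≥0∞) ^ p.toReal * ∫⁻ s, ‖g s b‖ₑ ^ p.toReal := by
        refine lintegral_mono fun b => hC' _ ?_ (hgint b)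
        exact hgm.comp (measurable_id.prodMk measurable_const)
    _ = (C : ℝ≥0∞) ^ p.toReal * ∫⁻ s, ∫⁻ b, ‖g s b‖ₑ ^ p.toReal := by
        rw [lintegral_const_mul' _ _ hCt, lintegral_lintegral_swap]
        exact ((hgm.comp measurable_swap).enorm.pow_const _).aemeasurable
    _ ≤ (C : ℝ≥0∞) ^ p.toReal * ∫⁻ s, (C : ℝ≥0∞) ^ p.toReal * ∫⁻ t, ‖f (s, t)‖ₑ ^ p.toReal := by
        gcongr 1
        refine lintegral_mono_ae ?_
        filter_upwards [hf.prod_right_ae] with s hs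
        exact hC' _ (hfm.comp (measurable_const.prodMk measurable_id)) hs
    _ = _ := by rw [lintegral_const_mul' _ _ hCt]

/-- The tensor product of two conjugate Poisson kernels, a regularization of `1 / (π² x y)`. -/
noncomputable def doubleConjPoissonKernel (y : ℝ) (w : ℂ) : ℝ :=
  conjPoissonKernel y w.re * conjPoissonKernel y w.im

/-- The regularized double Hilbert transform of `f` along the coordinate axes rotated by `u⁻¹`. -/
noncomputable def doubleConjPoissonIntegral (y : ℝ) (u : Circle) (f : ℂ → ℂ) (z : ℂ) : ℂ :=
  ∫ w, (doubleConjPoissonKernel y (u * (z - w)) : ℂ) * f w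

theorem continuous_doubleConjPoissonKernel {y : ℝ} (hy : 0 < y) :
    Continuous (doubleConjPoissonKernel y) :=
  ((continuous_conjPoissonKernel hy).comp Complex.continuous_re).mul
    ((continuous_conjPoissonKernel hy).comp Complex.continuous_im)

theorem abs_doubleConjPoissonKernel_le {y : ℝ} (hy : 0 < y) (w : ℂ) :
    |doubleConjPoissonKernel y w| ≤ 1 / (Real.pi * y) * (1 / (Real.pi * y)) := by
  rw [doubleConjPoissonKernel, abs_mul]
  exact mul_le_mul (abs_conjPoissonKernel_le hy _) (abs_conjPoissonKernel_le hy _)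
    (abs_nonneg _) (by positivity)

/-- Rotations preserve area, and the operator along rotated axes is the unrotated one conjugated by
a rotation; hence one constant serves all `u`. -/
theorem exists_eLpNorm_doubleConjPoissonIntegral_le {p : ℝ≥0∞} (hp : 1 < p) (hp_top : p ≠ ∞) :
    ∃ C : NNReal, ∀ y : ℝ, 0 < y → ∀ (u : Circle) (f : ℂ → ℂ), Measurable f → Integrable f →
      eLpNorm (doubleConjPoissonIntegral y u f) p volume ≤ C * eLpNorm f p volume := by
  obtain ⟨C, hC⟩ := exists_eLpNorm_prod_conjPoisson_le hp hp_top
  have base : ∀ y : ℝ, 0 < y → ∀ (f : ℂ → ℂ), Measurable f → Integrable f →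
      Measurable (doubleConjPoissonIntegral y 1 f) ∧
      eLpNorm (doubleConjPoissonIntegral y 1 f) p volume ≤ C * eLpNorm f p volume := by
    intro y hy f hfm hf
    have hmeas : Measurable (doubleConjPoissonIntegral y 1 f) := by
      refine (StronglyMeasurable.integral_prod_right (f := fun z w : ℂ =>
        (doubleConjPoissonKernel y ((1 : Circle) * (z - w)) : ℂ) * f w) ?_).measurable
      refine Measurable.stronglyMeasurable ?_
      have := (continuous_doubleConjPoissonKernel hy).measurable
      unfold Function.uncurry
      fun_prop
    refine ⟨hmeas, ?_⟩
    have hmp := Complex.volume_preserving_equiv_real_prod.symm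
    have hfm' : Measurable (f ∘ Complex.measurableEquivRealProd.symm) :=
      hfm.comp Complex.measurableEquivRealProd.symm.measurable
    have hf' : Integrable (f ∘ Complex.measurableEquivRealProd.symm) :=
      hmp.integrable_comp_of_integrable hf
    rw [← eLpNorm_comp_measurePreserving hf.aestronglyMeasurable hmp,
      ← eLpNorm_comp_measurePreserving hmeas.aestronglyMeasurable hmp]
    refine le_trans (le_of_eq ?_) (hC y hy _ hfm' hf')
    congr 1
    funext z
    simp only [Function.comp_apply, doubleConjPoissonIntegral]
    rw [← hmp.integral_comp Complex.measurableEquivRealProd.symm.measurableEmbedding]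
    refine integral_congr_ae (Eventually.of_forall fun w => ?_)
    simp [doubleConjPoissonKernel, Complex.measurableEquivRealProd_symm_apply]
  refine ⟨C, fun y hy u f hfm hf => ?_⟩
  have hu := (rotation u).measurePreserving
  have hu' := (rotation u).symm.measurePreserving
  have hme : MeasurableEmbedding (rotation u).symm :=
    (rotation u).symm.toHomeomorph.measurableEmbedding
  have e : doubleConjPoissonIntegral y u f =
      doubleConjPoissonIntegral y 1 (f ∘ (rotation u).symm) ∘ rotation u := by
    funext z
    simp only [Function.comp_apply, doubleConjPoissonIntegral]
    rw [← hu'.integral_comp hme]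
    refine integral_congr_ae (Eventually.of_forall fun w => ?_)
    have h1 : (u : ℂ) * (z - (rotation u).symm w) = rotation u z - w := by
      rw [mul_sub, ← rotation_apply, ← rotation_apply, LinearIsometryEquiv.apply_symm_apply]
    simp [h1]
  obtain ⟨hm, hb⟩ := base y hy (f ∘ (rotation u).symm) (hfm.comp hu'.measurable)
    (hu'.integrable_comp_of_integrable hf)
  rw [e, eLpNorm_comp_measurePreserving hm.aestronglyMeasurable hu]
  refine hb.trans (le_of_eq ?_)
  rw [eLpNorm_comp_measurePreserving hf.aestronglyMeasurable hu']

/-- The average over all rotations of the regularized double Hilbert transforms, weighted by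
the character of degree `-2n`. -/
noncomputable def rotationAverage (y : ℝ) (n : ℤ) (f : ℂ → ℂ) (z : ℂ) : ℂ :=
  ∫ θ in Set.Ioc 0 (2 * Real.pi), Complex.exp (-(2 * n * θ * Complex.I)) *
    doubleConjPoissonIntegral y (Circle.exp (-θ)) f z

theorem measurable_rotationAverage_integrand {y : ℝ} (hy : 0 < y) (n : ℤ) {f : ℂ → ℂ}
    (hf : Measurable f) : Measurable (Function.uncurry fun (z : ℂ) (θ : ℝ) =>
      Complex.exp (-(2 * n * θ * Complex.I)) *
        doubleConjPoissonIntegral y (Circle.exp (-θ)) f z) := by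
  have h : Measurable fun q : ℂ × ℝ => doubleConjPoissonIntegral y (Circle.exp (-q.2)) f q.1 := by
    refine (StronglyMeasurable.integral_prod_right (f := fun (q : ℂ × ℝ) (w : ℂ) =>
        (doubleConjPoissonKernel y ((Circle.exp (-q.2) : Circle) * (q.1 - w)) : ℂ) * f w)
          ?_).measurable
    refine Measurable.stronglyMeasurable ?_
    have h1 := (continuous_doubleConjPoissonKernel hy).measurable
    simp only [Circle.coe_exp]
    unfold Function.uncurry
    fun_prop
  unfold Function.uncurry
  fun_prop

theorem stronglyMeasurable_rotationAverage {y : ℝ} (hy : 0 < y) (n : ℤ) {f : ℂ → ℂ}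
    (hf : Measurable f) : StronglyMeasurable (rotationAverage y n f) :=
  (measurable_rotationAverage_integrand hy n hf).stronglyMeasurable.integral_prod_right

/-- Minkowski's inequality over the angle. The character is unimodular, so the constant is
independent of `n` as well as of `y`. -/
theorem exists_eLpNorm_rotationAverage_le {p : ℝ≥0∞} (hp : 1 < p) (hp_top : p ≠ ∞) :
    ∃ C : NNReal, ∀ y : ℝ, 0 < y → ∀ (n : ℤ) (f : ℂ → ℂ), Measurable f → Integrable f →
      eLpNorm (rotationAverage y n f) p volume ≤ C * eLpNorm f p volume := by
  obtain ⟨C, hC⟩ := exists_eLpNorm_doubleConjPoissonIntegral_le hp hp_top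
  refine ⟨(2 * Real.pi).toNNReal * C, fun y hy n f hfm hf => ?_⟩
  have h := eLpNorm_integral_le_of_forall (ν := (volume : Measure ℂ))
    (μ := volume.restrict (Set.Ioc 0 (2 * Real.pi))) hp.le hp_top
    (measurable_rotationAverage_integrand hy n hfm).aestronglyMeasurable
    (C := C * eLpNorm f p volume) (fun θ => by
      refine le_trans (eLpNorm_mono fun z => ?_) (hC y hy (Circle.exp (-θ)) f hfm hf)
      rw [norm_mul, show -(2 * n * θ * Complex.I) = ((-(2 * n * θ) : ℝ) : ℂ) * Complex.I by
        push_cast; ring, Complex.norm_exp_ofReal_mul_I, one_mul])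
  refine h.trans (le_of_eq ?_)
  rw [Measure.restrict_apply_univ, Real.volume_Ioc, sub_zero, ENNReal.coe_mul, mul_assoc]
  rfl
-- Fourier symbols of the regularized kernels
open scoped FourierTransform

/-- The Fourier symbol of the convolution with the conjugate Poisson kernel at height `y`. -/
noncomputable def conjPoissonSymbol (y ξ : ℝ) : ℂ :=
  -Complex.I * Real.sign ξ * Real.exp (-(2 * Real.pi * y * |ξ|))

theorem measurable_realSign : Measurable Real.sign := by
  unfold Real.sign
  exact Measurable.ite measurableSet_Iio measurable_const
    (Measurable.ite measurableSet_Ioi measurable_const measurable_const)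

theorem measurable_conjPoissonSymbol (y : ℝ) : Measurable (conjPoissonSymbol y) := by
  have := measurable_realSign
  unfold conjPoissonSymbol
  fun_prop

theorem abs_realSign_le (x : ℝ) : |Real.sign x| ≤ 1 := by
  rcases Real.sign_apply_eq x with h | h | h <;> simp [h]

theorem norm_conjPoissonSymbol_le_exp (y ξ : ℝ) :
    ‖conjPoissonSymbol y ξ‖ ≤ Real.exp (-(2 * Real.pi * y * |ξ|)) := by
  rw [conjPoissonSymbol, norm_mul, norm_mul, norm_neg, Complex.norm_I, one_mul, Complex.norm_real,
    Complex.norm_real, Real.norm_eq_abs, Real.norm_eq_abs, Real.abs_exp]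
  exact mul_le_of_le_one_left (Real.exp_pos _).le (abs_realSign_le ξ)

theorem norm_conjPoissonSymbol_le {y : ℝ} (hy : 0 ≤ y) (ξ : ℝ) : ‖conjPoissonSymbol y ξ‖ ≤ 1 :=
  (norm_conjPoissonSymbol_le_exp y ξ).trans (Real.exp_le_one_iff.2 (by
    have := Real.pi_pos
    have := abs_nonneg ξ
    simp only [Left.neg_nonpos_iff]
    positivity))

/-- On each half-line the integrand is a single exponential, with rate `a` or `b`, which decays
because `y > 0`. -/
theorem hasIntegral_conjPoissonSymbol_mul_exp {y : ℝ} (hy : 0 < y) (x : ℝ) :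
    Integrable (fun ξ : ℝ => conjPoissonSymbol y ξ * Complex.exp (2 * Real.pi * x * ξ * Complex.I)) ∧
    ∫ ξ : ℝ, conjPoissonSymbol y ξ * Complex.exp (2 * Real.pi * x * ξ * Complex.I) =
      conjPoissonKernel y x := by
  have hpi := Real.pi_pos
  set a : ℂ := 2 * Real.pi * (-y + x * Complex.I) with ha
  set b : ℂ := 2 * Real.pi * (y + x * Complex.I) with hb
  have har : a.re < 0 := by simp [ha]; positivity
  have hbr : 0 < b.re := by simp [hb]; positivity
  have e1 : Set.EqOn (fun ξ : ℝ => conjPoissonSymbol y ξ *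
      Complex.exp (2 * Real.pi * x * ξ * Complex.I))
      (fun ξ : ℝ => -Complex.I * Complex.exp (a * ξ)) (Set.Ioi 0) := by
    intro ξ hξ
    simp only [conjPoissonSymbol, Real.sign_of_pos hξ, abs_of_pos (show 0 < ξ from hξ), ha]
    push_cast
    rw [mul_one, mul_assoc, ← Complex.exp_add]
    ring_nf
  have e2 : Set.EqOn (fun ξ : ℝ => conjPoissonSymbol y ξ *
      Complex.exp (2 * Real.pi * x * ξ * Complex.I))
      (fun ξ : ℝ => Complex.I * Complex.exp (b * ξ)) (Set.Iio 0) := by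
    intro ξ hξ
    simp only [conjPoissonSymbol, Real.sign_of_neg hξ, abs_of_neg (show ξ < 0 from hξ), hb]
    push_cast
    rw [mul_neg, mul_one, neg_neg, mul_assoc, ← Complex.exp_add]
    ring_nf
  have i1 : IntegrableOn (fun ξ : ℝ => conjPoissonSymbol y ξ *
      Complex.exp (2 * Real.pi * x * ξ * Complex.I)) (Set.Ioi 0) :=
    IntegrableOn.congr_fun ((integrableOn_exp_mul_complex_Ioi har 0).const_mul _) e1.symm
      measurableSet_Ioi
  have i2 : IntegrableOn (fun ξ : ℝ => conjPoissonSymbol y ξ *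
      Complex.exp (2 * Real.pi * x * ξ * Complex.I)) (Set.Iic 0) := by
    rw [integrableOn_Iic_iff_integrableOn_Iio]
    exact IntegrableOn.congr_fun
      ((((integrableOn_exp_mul_complex_Iic hbr 0).mono_set Set.Iio_subset_Iic_self)).const_mul _)
      e2.symm measurableSet_Iio
  have hI : Integrable (fun ξ : ℝ => conjPoissonSymbol y ξ *
      Complex.exp (2 * Real.pi * x * ξ * Complex.I)) := by
    rw [← integrableOn_univ, ← Set.Iic_union_Ioi (a := (0 : ℝ))]
    exact i2.union i1
  refine ⟨hI, ?_⟩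
  rw [← intervalIntegral.integral_Iic_add_Ioi i2 i1, setIntegral_congr_fun measurableSet_Ioi e1,
    integral_Iic_eq_integral_Iio, setIntegral_congr_fun measurableSet_Iio e2,
    ← integral_Iic_eq_integral_Iio, integral_const_mul, integral_const_mul,
    integral_exp_mul_complex_Ioi har, integral_exp_mul_complex_Iic hbr]
  simp only [Complex.ofReal_zero, mul_zero, Complex.exp_zero]
  have ha0 : -(y : ℂ) + x * Complex.I ≠ 0 := fun h => by
    have := congrArg Complex.re h; simp [hy.ne'] at this
  have hb0 : (y : ℂ) + x * Complex.I ≠ 0 := fun h => by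
    have := congrArg Complex.re h; simp [hy.ne'] at this
  have hpi0 : (Real.pi : ℂ) ≠ 0 := by exact_mod_cast hpi.ne'
  have hsq : (x : ℂ) ^ 2 + (y : ℂ) ^ 2 = -((-(y : ℂ) + x * Complex.I) * (y + x * Complex.I)) := by
    ring_nf; rw [Complex.I_sq]; ring
  rw [conjPoissonKernel, Complex.ofReal_div, Complex.ofReal_mul, Complex.ofReal_add,
    Complex.ofReal_pow, Complex.ofReal_pow, hsq, ha, hb]
  have hx : (x : ℂ) = -Complex.I * ((-(y : ℂ) + x * Complex.I) + (y + x * Complex.I)) / 2 := by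
    ring_nf; rw [Complex.I_sq]; ring
  nth_rewrite 3 [hx]
  generalize -(y : ℂ) + x * Complex.I = c at *
  generalize (y : ℂ) + x * Complex.I = d at *
  field_simp

/-- The Fourier symbol of the convolution with `doubleConjPoissonKernel y`. -/
noncomputable def doubleConjPoissonSymbol (y : ℝ) (ξ : ℂ) : ℂ :=
  conjPoissonSymbol y ξ.re * conjPoissonSymbol y ξ.im

theorem measurable_doubleConjPoissonSymbol (y : ℝ) : Measurable (doubleConjPoissonSymbol y) :=
  ((measurable_conjPoissonSymbol y).comp Complex.measurable_re).mul
    ((measurable_conjPoissonSymbol y).comp Complex.measurable_im)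

theorem norm_doubleConjPoissonSymbol_le {y : ℝ} (hy : 0 ≤ y) (ξ : ℂ) :
    ‖doubleConjPoissonSymbol y ξ‖ ≤ 1 := by
  rw [doubleConjPoissonSymbol, norm_mul]
  exact mul_le_one₀ (norm_conjPoissonSymbol_le hy _) (norm_nonneg _)
    (norm_conjPoissonSymbol_le hy _)

theorem hasFourierInv_doubleConjPoissonSymbol {y : ℝ} (hy : 0 < y) :
    Integrable (doubleConjPoissonSymbol y) ∧
    ∀ w : ℂ, 𝓕⁻ (doubleConjPoissonSymbol y) w = doubleConjPoissonKernel y w := by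
  have hmp := Complex.volume_preserving_equiv_real_prod.symm
  have hem := Complex.measurableEquivRealProd.symm.measurableEmbedding
  constructor
  · rw [← hmp.integrable_comp_emb hem]
    have h := (hasIntegral_conjPoissonSymbol_mul_exp hy 0).1
    simp only [Complex.ofReal_zero, mul_zero, zero_mul, Complex.exp_zero, mul_one] at h
    exact h.mul_prod h
  · intro w
    rw [Real.fourierInv_eq', ← hmp.integral_comp hem, doubleConjPoissonKernel, Complex.ofReal_mul,
      ← (hasIntegral_conjPoissonSymbol_mul_exp hy w.re).2,
      ← (hasIntegral_conjPoissonSymbol_mul_exp hy w.im).2, ← integral_prod_mul,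
      ← Measure.volume_eq_prod]
    refine integral_congr_ae (Eventually.of_forall fun q => ?_)
    simp only [Complex.measurableEquivRealProd_symm_apply, doubleConjPoissonSymbol, smul_eq_mul,
      Complex.inner, Complex.mul_re, Complex.conj_re, Complex.conj_im]
    rw [mul_mul_mul_comm, ← Complex.exp_add, mul_comm (_ * _) (Complex.exp _)]
    congr 2
    push_cast
    ring

/-! ### Multipliers as limits of rotation averages -/

/-- The Fourier multiplier operator with symbol `m`. -/
noncomputable def multiplierOperator (m : ℂ → ℂ) (f : ℂ → ℂ) : ℂ → ℂ :=
  𝓕⁻ fun ξ => m ξ * 𝓕 f ξ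

theorem fourierInv_comp_rotation (m : ℂ → ℂ) (u : Circle) (w : ℂ) :
    𝓕⁻ (fun ξ => m (u * ξ)) w = 𝓕⁻ m (u * w) := by
  have hu := (rotation u).measurePreserving
  have hme : MeasurableEmbedding (rotation u) := (rotation u).toHomeomorph.measurableEmbedding
  rw [Real.fourierInv_eq', Real.fourierInv_eq']
  conv_rhs => rw [← hu.integral_comp hme]
  refine integral_congr_ae (Eventually.of_forall fun ξ => ?_)
  simp only [← rotation_apply, LinearIsometryEquiv.inner_map_map]

theorem integrable_fourier_schwartz (f : 𝓢(ℂ, ℂ)) : Integrable (𝓕 (f : ℂ → ℂ)) := by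
  rw [← SchwartzMap.fourier_coe]
  exact (𝓕 f).integrable

/-- At positive height the symbol is integrable, so Fubini exchanges the two Fourier integrals; this
is the reason for regularizing. -/
theorem doubleConjPoissonIntegral_eq_multiplierOperator {y : ℝ} (hy : 0 < y) (u : Circle)
    (f : 𝓢(ℂ, ℂ)) (z : ℂ) :
    doubleConjPoissonIntegral y u f z =
      multiplierOperator (fun ξ => doubleConjPoissonSymbol y (u * ξ)) f z := by
  obtain ⟨hM, hK⟩ := hasFourierInv_doubleConjPoissonSymbol hy
  have hu := (rotation u).measurePreserving
  have hMu : Integrable fun ξ => doubleConjPoissonSymbol y (u * ξ) :=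
    hu.integrable_comp_of_integrable hM
  have hint : Integrable (Function.uncurry fun w ξ : ℂ =>
      Complex.exp ((2 * Real.pi * inner ℝ ξ (z - w) : ℝ) * Complex.I) *
        (f w * doubleConjPoissonSymbol y (u * ξ))) (volume.prod volume) := by
    refine (f.integrable.mul_prod hMu).bdd_mul (c := 1) ?_ (Eventually.of_forall fun q => ?_)
    · exact Continuous.aestronglyMeasurable (by fun_prop)
    · rw [Complex.norm_exp_ofReal_mul_I]
  calc doubleConjPoissonIntegral y u f z
      = ∫ w, ∫ ξ, Complex.exp ((2 * Real.pi * inner ℝ ξ (z - w) : ℝ) * Complex.I) *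
        (f w * doubleConjPoissonSymbol y (u * ξ)) := by
        refine integral_congr_ae (Eventually.of_forall fun w => ?_)
        simp only
        rw [← hK, ← fourierInv_comp_rotation, Real.fourierInv_eq', ← integral_mul_const]
        refine integral_congr_ae (Eventually.of_forall fun ξ => ?_)
        simp only [smul_eq_mul]
        ring
    _ = ∫ ξ, ∫ w, Complex.exp ((2 * Real.pi * inner ℝ ξ (z - w) : ℝ) * Complex.I) *
        (f w * doubleConjPoissonSymbol y (u * ξ)) := integral_integral_swap hint
    _ = _ := by
        rw [multiplierOperator, Real.fourierInv_eq']
        refine integral_congr_ae (Eventually.of_forall fun ξ => ?_)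
        simp only [smul_eq_mul]
        rw [Real.fourier_eq', ← integral_const_mul, ← integral_const_mul]
        refine integral_congr_ae (Eventually.of_forall fun w => ?_)
        simp only [smul_eq_mul]
        have : Complex.exp ((2 * Real.pi * inner ℝ ξ (z - w) : ℝ) * Complex.I) =
            Complex.exp ((2 * Real.pi * inner ℝ ξ z : ℝ) * Complex.I) *
            Complex.exp ((-2 * Real.pi * inner ℝ w ξ : ℝ) * Complex.I) := by
          rw [← Complex.exp_add, inner_sub_right, real_inner_comm ξ w]
          congr 1
          push_cast
          ring
        rw [this]
        ring

theorem realSign_mul (a b : ℝ) : Real.sign (a * b) = Real.sign a * Real.sign b := by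
  rcases lt_trichotomy a 0 with ha | rfl | ha <;> rcases lt_trichotomy b 0 with hb | rfl | hb <;>
    simp [Real.sign_of_pos, Real.sign_of_neg, mul_pos_of_neg_of_neg, mul_neg_of_neg_of_pos,
      mul_neg_of_pos_of_neg, *]

theorem doubleConjPoissonSymbol_zero (ξ : ℂ) :
    doubleConjPoissonSymbol 0 ξ = -Real.sign (ξ.re * ξ.im) := by
  rw [doubleConjPoissonSymbol, conjPoissonSymbol, conjPoissonSymbol, realSign_mul]
  simp only [mul_zero, zero_mul, neg_zero, Real.exp_zero, Complex.ofReal_one, mul_one,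
    Complex.ofReal_mul]
  linear_combination (Real.sign ξ.re * Real.sign ξ.im : ℂ) * Complex.I_sq

/-- At height zero the symbol depends only on the direction of `ξ`: it is a square wave in the
doubled angle. -/
theorem doubleConjPoissonSymbol_zero_rotation {ξ : ℂ} (hξ : ξ ≠ 0) (θ : ℝ) :
    doubleConjPoissonSymbol 0 (Circle.exp (-θ) * ξ) =
      -Real.sign (Real.sin (2 * (Complex.arg ξ - θ))) := by
  have h : (Circle.exp (-θ) : ℂ) * ξ =
      ‖ξ‖ * Complex.exp ((Complex.arg ξ - θ : ℝ) * Complex.I) := by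
    nth_rewrite 1 [← Complex.norm_mul_exp_arg_mul_I ξ]
    rw [Circle.coe_exp, mul_left_comm, ← Complex.exp_add]
    congr 2
    push_cast
    ring
  rw [doubleConjPoissonSymbol_zero, h, Complex.re_ofReal_mul, Complex.im_ofReal_mul,
    Complex.exp_ofReal_mul_I_re, Complex.exp_ofReal_mul_I_im, Real.sin_two_mul,
    show ‖ξ‖ * Real.cos (Complex.arg ξ - θ) * (‖ξ‖ * Real.sin (Complex.arg ξ - θ)) =
      (‖ξ‖ ^ 2 / 2) * (2 * Real.sin (Complex.arg ξ - θ) * Real.cos (Complex.arg ξ - θ)) by ring,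
    realSign_mul, Real.sign_of_pos (by positivity), one_mul]

/-- Fourier coefficients of the square wave; at even `n` they vanish, so only odd powers are
reached. The factor `1 / n` is the origin of the linear growth of the multiplier norms. -/
theorem integral_exp_mul_sign_sin {n : ℤ} (hn : Odd n) :
    ∫ β in (0 : ℝ)..2 * Real.pi,
      Complex.exp (2 * n * β * Complex.I) * Real.sign (Real.sin (2 * β)) = 4 * Complex.I / n := by
  have hpi := Real.pi_pos
  have hn0 : (n : ℂ) ≠ 0 := by
    rintro h
    rw [Int.cast_eq_zero] at h
    simp [h] at hn
  set h : ℝ → ℂ := fun β => Complex.exp (2 * n * β * Complex.I) * Real.sign (Real.sin (2 * β))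
    with hh
  have hper : Function.Periodic h Real.pi := by
    intro β
    simp only [hh]
    rw [mul_add, Real.sin_add_two_pi]
    congr 1
    rw [Complex.exp_eq_exp_iff_exists_int]
    exact ⟨n, by push_cast; ring⟩
  have hmeas : Measurable h := by
    have := measurable_realSign
    simp only [hh]
    fun_prop
  have hint : ∀ a b : ℝ, IntervalIntegrable h volume a b := by
    intro a b
    refine (intervalIntegrable_const (c := (1 : ℝ))).mono_fun hmeas.aestronglyMeasurable
      (Eventually.of_forall fun β => ?_)
    simp only [hh]
    rw [norm_mul, show (2 * n * β * Complex.I : ℂ) = ((2 * n * β : ℝ) : ℂ) * Complex.I by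
      push_cast; ring, Complex.norm_exp_ofReal_mul_I, one_mul, Complex.norm_real, norm_one]
    exact abs_realSign_le _
  have hc0 : (2 * n * Complex.I : ℂ) ≠ 0 := by simp [hn0]
  have e1 : ∫ β in (0 : ℝ)..(Real.pi / 2), h β =
      (Complex.exp (2 * n * Complex.I * (Real.pi / 2 : ℝ)) -
        Complex.exp (2 * n * Complex.I * (0 : ℝ))) / (2 * n * Complex.I) := by
    rw [← integral_exp_mul_complex hc0, intervalIntegral.integral_of_le (by positivity),
      intervalIntegral.integral_of_le (by positivity), integral_Ioc_eq_integral_Ioo,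
      integral_Ioc_eq_integral_Ioo]
    refine setIntegral_congr_fun measurableSet_Ioo fun β hβ => ?_
    have : 0 < Real.sin (2 * β) := Real.sin_pos_of_pos_of_lt_pi (by linarith [hβ.1])
      (by linarith [hβ.2])
    simp only [hh, Real.sign_of_pos this, Complex.ofReal_one, mul_one]
    ring_nf
  have e2 : ∫ β in (Real.pi / 2)..Real.pi, h β =
      -((Complex.exp (2 * n * Complex.I * (Real.pi : ℝ)) -
        Complex.exp (2 * n * Complex.I * (Real.pi / 2 : ℝ))) / (2 * n * Complex.I)) := by
    rw [← integral_exp_mul_complex hc0, ← intervalIntegral.integral_neg,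
      intervalIntegral.integral_of_le (by linarith),
      intervalIntegral.integral_of_le (by linarith), integral_Ioc_eq_integral_Ioo,
      integral_Ioc_eq_integral_Ioo]
    refine setIntegral_congr_fun measurableSet_Ioo fun β hβ => ?_
    have : Real.sin (2 * β) < 0 := by
      rw [← Real.sin_sub_two_pi]
      exact Real.sin_neg_of_neg_of_neg_pi_lt (by linarith [hβ.2]) (by linarith [hβ.1])
    simp only [hh, Real.sign_of_neg this, Complex.ofReal_neg, Complex.ofReal_one, mul_neg, mul_one]
    ring_nf
  have x1 : Complex.exp (2 * n * Complex.I * (Real.pi / 2 : ℝ)) = -1 := by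
    rw [show (2 * n * Complex.I * (Real.pi / 2 : ℝ) : ℂ) = n * (Real.pi * Complex.I) by
      push_cast; ring, Complex.exp_int_mul, Complex.exp_pi_mul_I, hn.neg_one_zpow]
  have x2 : Complex.exp (2 * n * Complex.I * (Real.pi : ℝ)) = 1 := by
    rw [show (2 * n * Complex.I * (Real.pi : ℝ) : ℂ) = n * (2 * Real.pi * Complex.I) by ring,
      Complex.exp_int_mul, Complex.exp_two_pi_mul_I, one_zpow]
  have e3 : ∫ β in (0 : ℝ)..Real.pi, h β = 2 * Complex.I / n := by
    rw [← intervalIntegral.integral_add_adjacent_intervals (hint 0 (Real.pi / 2)) (hint _ _), e1,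
      e2, x1, x2, Complex.ofReal_zero, mul_zero, Complex.exp_zero]
    field_simp
    rw [Complex.I_sq]
    norm_num
  have e4 : ∫ β in Real.pi..2 * Real.pi, h β = 2 * Complex.I / n := by
    rw [← e3, two_mul, hper.intervalIntegral_add_eq Real.pi 0, zero_add]
  rw [← intervalIntegral.integral_add_adjacent_intervals (hint 0 Real.pi) (hint _ _), e3, e4]
  ring

theorem exp_arg_eq_conj_div {ξ : ℂ} (hξ : ξ ≠ 0) (n : ℤ) :
    Complex.exp (-(2 * n * Complex.arg ξ * Complex.I)) = ((starRingEnd ℂ) ξ / ξ) ^ n := by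
  have h : (starRingEnd ℂ) ξ / ξ = Complex.exp (-(2 * Complex.arg ξ * Complex.I)) := by
    rw [div_eq_iff hξ]
    have e := Complex.norm_mul_exp_arg_mul_I ξ
    calc (starRingEnd ℂ) ξ = (starRingEnd ℂ) (‖ξ‖ * Complex.exp (Complex.arg ξ * Complex.I)) := by
          rw [e]
      _ = Complex.exp (-(2 * Complex.arg ξ * Complex.I)) *
          (‖ξ‖ * Complex.exp (Complex.arg ξ * Complex.I)) := by
          rw [map_mul, Complex.conj_ofReal, ← Complex.exp_conj, mul_left_comm, ← Complex.exp_add]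
          congr 2
          simp only [map_mul, Complex.conj_ofReal, Complex.conj_I]
          ring
      _ = _ := by rw [e]
  rw [h, ← Complex.exp_int_mul]
  congr 1
  ring

/-- The substitution `β = arg ξ - θ` separates the Fourier coefficient from `exp (-2 i n arg ξ) =
(conj ξ / ξ) ^ n`. -/
theorem integral_exp_mul_doubleConjPoissonSymbol_zero {n : ℤ} (hn : Odd n) {ξ : ℂ} (hξ : ξ ≠ 0) :
    ∫ θ in Set.Ioc 0 (2 * Real.pi), Complex.exp (-(2 * n * θ * Complex.I)) *
      doubleConjPoissonSymbol 0 (Circle.exp (-θ) * ξ) =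
      -(4 * Complex.I / n) * ((starRingEnd ℂ) ξ / ξ) ^ n := by
  have hper : Function.Periodic (fun β : ℝ => Complex.exp (2 * n * β * Complex.I) *
      Real.sign (Real.sin (2 * β))) (2 * Real.pi) := by
    intro β
    simp only
    congr 1
    · rw [Complex.exp_eq_exp_iff_exists_int]
      exact ⟨2 * n, by push_cast; ring⟩
    · rw [mul_add, two_mul (2 * Real.pi), ← add_assoc, Real.sin_add_two_pi, Real.sin_add_two_pi]
  rw [← intervalIntegral.integral_of_le (by positivity), ← exp_arg_eq_conj_div hξ,
    ← integral_exp_mul_sign_sin hn]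
  have h := hper.intervalIntegral_add_eq (Complex.arg ξ - 2 * Real.pi) 0
  rw [sub_add_cancel, zero_add] at h
  rw [← h]
  have h2 := intervalIntegral.integral_comp_sub_left (a := 0) (b := 2 * Real.pi)
    (fun β : ℝ => Complex.exp (2 * n * β * Complex.I) * (Real.sign (Real.sin (2 * β)) : ℂ))
    (Complex.arg ξ)
  rw [sub_zero] at h2
  rw [← h2, neg_mul, ← intervalIntegral.integral_mul_const,
    ← intervalIntegral.integral_neg]
  refine intervalIntegral.integral_congr fun θ _ => ?_
  have e : Complex.exp (-(2 * n * θ * Complex.I)) =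
      Complex.exp (2 * n * (Complex.arg ξ - θ : ℝ) * Complex.I) *
        Complex.exp (-(2 * n * Complex.arg ξ * Complex.I)) := by
    rw [← Complex.exp_add]
    congr 1
    push_cast
    ring
  rw [doubleConjPoissonSymbol_zero_rotation hξ, e]
  ring

theorem continuous_doubleConjPoissonSymbol_height (ξ : ℂ) :
    Continuous fun y : ℝ => doubleConjPoissonSymbol y ξ := by
  unfold doubleConjPoissonSymbol conjPoissonSymbol
  fun_prop

/-- Dominated convergence in angle and frequency together: the symbols are bounded by `1` and the
Fourier transform of `f` is integrable. In the limit Fubini performs the angular integral first. -/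
theorem tendsto_rotationAverage (f : 𝓢(ℂ, ℂ)) {n : ℤ} (hn : Odd n) (z : ℂ) :
    Tendsto (fun y => rotationAverage y n f z) (𝓝[>] 0)
      (𝓝 (-(4 * Complex.I / n) *
        multiplierOperator (fun ξ => ((starRingEnd ℂ) ξ / ξ) ^ n) f z)) := by
  set μ : Measure ℝ := volume.restrict (Set.Ioc 0 (2 * Real.pi)) with hμ
  set F : ℝ → ℝ → ℂ → ℂ := fun y θ ξ => Complex.exp (-(2 * n * θ * Complex.I)) *
    (Complex.exp ((2 * Real.pi * inner ℝ ξ z : ℝ) * Complex.I) •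
      (doubleConjPoissonSymbol y (Circle.exp (-θ) * ξ) * 𝓕 (f : ℂ → ℂ) ξ)) with hF
  have hfi := integrable_fourier_schwartz f
  have hfc : Measurable (𝓕 (f : ℂ → ℂ)) := by
    rw [← SchwartzMap.fourier_coe]
    exact (𝓕 f).continuous.measurable
  have hFm : ∀ y, Measurable (Function.uncurry (F y)) := by
    intro y
    have := measurable_doubleConjPoissonSymbol y
    simp only [hF, Circle.coe_exp, smul_eq_mul]
    unfold Function.uncurry
    fun_prop
  have hFn : ∀ y, 0 ≤ y → ∀ θ ξ, ‖F y θ ξ‖ ≤ ‖(1 : ℂ)‖ * ‖𝓕 (f : ℂ → ℂ) ξ‖ := by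
    intro y hy θ ξ
    simp only [hF, smul_eq_mul]
    rw [norm_mul, norm_mul, norm_mul, Complex.norm_exp_ofReal_mul_I,
      show -(2 * n * θ * Complex.I) = ((-(2 * n * θ) : ℝ) : ℂ) * Complex.I by
        push_cast; ring, Complex.norm_exp_ofReal_mul_I, one_mul, one_mul, norm_one, one_mul]
    exact mul_le_of_le_one_left (norm_nonneg _) (norm_doubleConjPoissonSymbol_le hy _)
  have hdom : Integrable (fun q : ℝ × ℂ => ‖(1 : ℂ)‖ * ‖𝓕 (f : ℂ → ℂ) q.2‖) (μ.prod volume) :=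
    (integrable_const (μ := μ) (1 : ℂ)).norm.mul_prod hfi.norm
  have hFi : ∀ y, 0 ≤ y → Integrable (Function.uncurry (F y)) (μ.prod volume) := fun y hy =>
    hdom.mono' (hFm y).aestronglyMeasurable (Eventually.of_forall fun q => hFn y hy q.1 q.2)
  have hlim : Tendsto (fun y => ∫ q, Function.uncurry (F y) q ∂(μ.prod volume)) (𝓝[>] 0)
      (𝓝 (∫ q, Function.uncurry (F 0) q ∂(μ.prod volume))) := by
    refine tendsto_integral_filter_of_dominated_convergence _
      (Eventually.of_forall fun y => (hFm y).aestronglyMeasurable) ?_ hdom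
      (Eventually.of_forall fun q => ?_)
    · filter_upwards [self_mem_nhdsWithin] with y hy using
        Eventually.of_forall fun q => hFn y (le_of_lt hy) q.1 q.2
    · have hc : Continuous fun y => Function.uncurry (F y) q := by
        have := continuous_doubleConjPoissonSymbol_height (Circle.exp (-q.1) * q.2)
        simp only [hF, Function.uncurry_def]
        fun_prop
      exact hc.continuousAt.tendsto.mono_left nhdsWithin_le_nhds
  have e0 : ∫ q, Function.uncurry (F 0) q ∂(μ.prod volume) = -(4 * Complex.I / n) *
        multiplierOperator (fun ξ => ((starRingEnd ℂ) ξ / ξ) ^ n) f z := by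
    rw [integral_prod_symm _ (hFi 0 le_rfl), multiplierOperator, Real.fourierInv_eq',
      ← integral_const_mul]
    refine integral_congr_ae ?_
    filter_upwards [compl_mem_ae_iff.2 (measure_singleton (0 : ℂ))] with ξ hξ
    simp only [hF, Function.uncurry_apply_pair, smul_eq_mul]
    have : ∀ θ : ℝ, Complex.exp (-(2 * n * θ * Complex.I)) *
        (Complex.exp ((2 * Real.pi * inner ℝ ξ z : ℝ) * Complex.I) *
          (doubleConjPoissonSymbol 0 (Circle.exp (-θ) * ξ) * 𝓕 (f : ℂ → ℂ) ξ)) =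
        (Complex.exp (-(2 * n * θ * Complex.I)) *
          doubleConjPoissonSymbol 0 (Circle.exp (-θ) * ξ)) *
        (Complex.exp ((2 * Real.pi * inner ℝ ξ z : ℝ) * Complex.I) * 𝓕 (f : ℂ → ℂ) ξ) := by
      intro θ; ring
    simp_rw [this]
    rw [integral_mul_const, hμ, integral_exp_mul_doubleConjPoissonSymbol_zero hn hξ]
    ring
  rw [← e0]
  refine hlim.congr' ?_
  filter_upwards [self_mem_nhdsWithin] with y hy
  rw [integral_prod _ (hFi y (le_of_lt hy)), rotationAverage]
  refine integral_congr_ae (Eventually.of_forall fun θ => ?_)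
  simp only [hF, Function.uncurry_apply_pair]
  rw [integral_const_mul, doubleConjPoissonIntegral_eq_multiplierOperator hy, multiplierOperator,
    Real.fourierInv_eq']

/-- Fatou's lemma along heights tending to zero bounds `c` times the multiplier operator, where `‖c‖
= 4 / |n|`; the factor `4` is given away. -/
theorem exists_eLpNorm_multiplierOperator_le {p : ℝ≥0∞} (hp : 1 < p) (hp_top : p ≠ ∞) :
    ∃ C : NNReal, ∀ (n : ℤ), Odd n → ∀ f : 𝓢(ℂ, ℂ),
      eLpNorm (multiplierOperator (fun ξ => ((starRingEnd ℂ) ξ / ξ) ^ n) f) p volume ≤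
        C * ‖(n : ℝ)‖ₑ * eLpNorm f p volume := by
  obtain ⟨C, hC⟩ := exists_eLpNorm_rotationAverage_le hp hp_top
  refine ⟨C, fun n hn f => ?_⟩
  have hn0 : (n : ℂ) ≠ 0 := by
    rintro h
    rw [Int.cast_eq_zero] at h
    simp [h] at hn
  obtain ⟨s, hs0, hs⟩ : ∃ s : ℕ → ℝ, (∀ k, 0 < s k) ∧ Tendsto s atTop (𝓝[>] 0) := by
    refine ⟨fun k => 1 / ((k : ℝ) + 1), fun k => by positivity, ?_⟩
    exact tendsto_nhdsWithin_iff.2 ⟨tendsto_one_div_add_atTop_nhds_zero_nat,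
      Eventually.of_forall fun k => by simp only [Set.mem_Ioi]; positivity⟩
  set c : ℂ := -(4 * Complex.I / n) with hc
  have hc0 : c ≠ 0 := by simp [hc, hn0]
  have h1 : eLpNorm (c • multiplierOperator (fun ξ => ((starRingEnd ℂ) ξ / ξ) ^ n) f) p volume ≤
      C * eLpNorm f p volume := by
    refine (Lp.eLpNorm_lim_le_liminf_eLpNorm (f := fun k => rotationAverage (s k) n f)
      (fun k => (stronglyMeasurable_rotationAverage (hs0 k) n
        f.continuous.measurable).aestronglyMeasurable) _
      (Eventually.of_forall fun z => (tendsto_rotationAverage f hn z).comp hs)).trans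
      ((liminf_le_liminf (v := fun _ => C * eLpNorm f p volume)
        (Eventually.of_forall fun k => hC _ (hs0 k) n f f.continuous.measurable
          f.integrable)).trans (by simp))
  rw [eLpNorm_const_smul] at h1
  have hcn : ‖c‖ₑ * ‖(n : ℝ)‖ₑ = 4 := by
    rw [show ‖(n : ℝ)‖ₑ = ‖(n : ℂ)‖ₑ by rw [← ofReal_norm, ← ofReal_norm]; simp, ← enorm_mul, hc,
      neg_mul, div_mul_cancel₀ _ hn0, ← ofReal_norm]
    simp
  calc eLpNorm (multiplierOperator (fun ξ => ((starRingEnd ℂ) ξ / ξ) ^ n) f) p volume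
      ≤ 4 * eLpNorm (multiplierOperator (fun ξ => ((starRingEnd ℂ) ξ / ξ) ^ n) f) p volume := by
        nth_rewrite 1 [← one_mul (eLpNorm _ _ _)]
        gcongr
        norm_num
    _ = ‖(n : ℝ)‖ₑ * (‖c‖ₑ *
        eLpNorm (multiplierOperator (fun ξ => ((starRingEnd ℂ) ξ / ξ) ^ n) f) p volume) := by
        rw [← hcn]; ring
    _ ≤ ‖(n : ℝ)‖ₑ * (C * eLpNorm f p volume) := by gcongr
    _ = _ := by ring

/-! ### The principal value and its identification with a multiplier -/

theorem integrable_indicator_closedBall_inv_norm :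
    Integrable fun w : ℂ => if ‖w‖ ≤ 1 then ‖w‖⁻¹ else 0 := by
  rw [integrable_fun_norm_addHaar (E := ℂ) volume (f := fun r : ℝ => if r ≤ 1 then r⁻¹ else 0)]
  simp only [Complex.finrank_real_complex, Nat.add_one_sub_one, pow_one, smul_eq_mul]
  have h : IntegrableOn (fun _ : ℝ => (1 : ℝ)) (Set.Ioc 0 1) := by simp
  have h2 : IntegrableOn ((Set.Ioc (0 : ℝ) 1).indicator fun _ : ℝ => (1 : ℝ)) (Set.Ioi 0) :=
    (h.integrable_indicator measurableSet_Ioc).integrableOn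
  refine h2.congr_fun (fun r hr => ?_) measurableSet_Ioi
  have hr0 : (0 : ℝ) < r := hr
  by_cases h1 : r ≤ 1
  · simp [h1, hr0, hr0.ne']
  · simp [h1]

theorem exists_schwartz_lipschitz (g : 𝓢(ℂ, ℂ)) : ∃ L : ℝ, 0 ≤ L ∧ ∀ w, ‖g w - g 0‖ ≤ L * ‖w‖ := by
  refine ⟨SchwartzMap.seminorm ℝ 0 1 g, apply_nonneg _ _, fun w => ?_⟩
  have := Convex.norm_image_sub_le_of_norm_fderiv_le (𝕜 := ℝ) (f := g) (s := Set.univ)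
    (C := SchwartzMap.seminorm ℝ 0 1 g) (x := 0) (y := w) (fun x _ => g.differentiableAt)
    (fun x _ => by
      have := g.norm_iteratedFDeriv_le_seminorm ℝ 1 x
      rwa [norm_iteratedFDeriv_one] at this) convex_univ trivial trivial
  simpa using this

/-- Near the origin the Lipschitz bound lowers the singularity to `1 / ‖w‖`, which is integrable in
the plane; outside the unit disc nothing is subtracted and the denominator is at least `1`. -/
theorem integrable_sub_indicator_div_sq (g : 𝓢(ℂ, ℂ)) :
    Integrable fun w : ℂ => ‖g w - (if ‖w‖ ≤ 1 then g 0 else 0)‖ / ‖w‖ ^ 2 := by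
  obtain ⟨L, hL, hLg⟩ := exists_schwartz_lipschitz g
  refine ((integrable_indicator_closedBall_inv_norm.const_mul L).add g.integrable.norm).mono' ?_
    (Eventually.of_forall fun w => ?_)
  · refine Measurable.aestronglyMeasurable ?_
    have := g.continuous.measurable
    have h2 : Measurable fun w : ℂ => if ‖w‖ ≤ 1 then g 0 else 0 :=
      Measurable.ite (measurableSet_le (by fun_prop) (by fun_prop)) measurable_const measurable_const
    fun_prop
  · rw [Real.norm_of_nonneg (by positivity), Pi.add_apply]
    split_ifs with h
    · rcases eq_or_ne w 0 with rfl | hw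
      · simp
      have hw0 : 0 < ‖w‖ := norm_pos_iff.2 hw
      have : ‖g w - g 0‖ / ‖w‖ ^ 2 ≤ L * ‖w‖⁻¹ := by
        rw [div_le_iff₀ (by positivity)]
        calc ‖g w - g 0‖ ≤ L * ‖w‖ := hLg w
          _ = L * ‖w‖⁻¹ * ‖w‖ ^ 2 := by field_simp
      exact this.trans (le_add_of_nonneg_right (norm_nonneg _))
    · rw [sub_zero, mul_zero, zero_add]
      push Not at h
      exact div_le_self (norm_nonneg _) (one_le_pow₀ h.le)

/-- Convolution kernels with the cancellation of `1 / w ^ 2` that approximate `c / w ^ 2` converge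
to the corresponding principal value. -/
theorem tendsto_integral_kernel_mul (g : 𝓢(ℂ, ℂ)) {k : ℝ → ℂ → ℂ} {B : ℝ} {c : ℂ}
    (hm : ∀ ε, 0 < ε → Measurable (k ε)) (hb : ∀ ε, 0 < ε → ∀ w, ‖k ε w‖ ≤ B / ‖w‖ ^ 2)
    (hbd : ∀ ε, 0 < ε → ∃ A, ∀ w, ‖k ε w‖ ≤ A)
    (hodd : ∀ ε, 0 < ε → ∀ w, k ε (Complex.I * w) = -k ε w)
    (hlim : ∀ w, w ≠ 0 → Tendsto (fun ε => k ε w) (𝓝[>] 0) (𝓝 (c / w ^ 2))) :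
    Tendsto (fun ε => ∫ w, k ε w * g w) (𝓝[>] 0)
      (𝓝 (∫ w, c / w ^ 2 * (g w - (if ‖w‖ ≤ 1 then g 0 else 0)))) := by
  have hg := g.continuous.measurable
  have hite : Measurable fun w : ℂ => if ‖w‖ ≤ 1 then g 0 else 0 :=
    Measurable.ite (measurableSet_le (by fun_prop) (by fun_prop)) measurable_const measurable_const
  have hlimint : Tendsto (fun ε => ∫ w, k ε w * (g w - (if ‖w‖ ≤ 1 then g 0 else 0))) (𝓝[>] 0)
      (𝓝 (∫ w, c / w ^ 2 * (g w - (if ‖w‖ ≤ 1 then g 0 else 0)))) := by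
    refine tendsto_integral_filter_of_dominated_convergence
      (fun w => B * (‖g w - (if ‖w‖ ≤ 1 then g 0 else 0)‖ / ‖w‖ ^ 2)) ?_ ?_
      ((integrable_sub_indicator_div_sq g).const_mul B) ?_
    · filter_upwards [self_mem_nhdsWithin] with ε hε
      exact ((hm ε hε).mul (hg.sub hite)).aestronglyMeasurable
    · filter_upwards [self_mem_nhdsWithin] with ε hε
      refine Eventually.of_forall fun w => ?_
      rw [norm_mul]
      calc _ ≤ B / ‖w‖ ^ 2 * ‖g w - (if ‖w‖ ≤ 1 then g 0 else 0)‖ :=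
            mul_le_mul_of_nonneg_right (hb ε hε w) (norm_nonneg _)
        _ = _ := by ring
    · filter_upwards [compl_mem_ae_iff.2 (measure_singleton (0 : ℂ))] with w hw
      exact (hlim w hw).mul_const _
  refine hlimint.congr' ?_
  filter_upwards [self_mem_nhdsWithin] with ε hε
  obtain ⟨A, hA⟩ := hbd ε hε
  have i1 : Integrable fun w => k ε w * g w :=
    g.integrable.bdd_mul (hm ε hε).aestronglyMeasurable (Eventually.of_forall hA)
  have hind : (fun w : ℂ => if ‖w‖ ≤ 1 then g 0 else 0) =
      (Metric.closedBall (0 : ℂ) 1).indicator fun _ => g 0 := by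
    funext w
    by_cases h : ‖w‖ ≤ 1
    · rw [if_pos h, Set.indicator_of_mem (mem_closedBall_zero_iff.2 h)]
    · rw [if_neg h, Set.indicator_of_notMem fun h' => h (mem_closedBall_zero_iff.1 h')]
  have i0 : Integrable fun w : ℂ => if ‖w‖ ≤ 1 then g 0 else 0 := by
    rw [hind, integrable_indicator_iff Metric.isClosed_closedBall.measurableSet]
    exact integrableOn_const (measure_closedBall_lt_top).ne
  have i2 : Integrable fun w => k ε w * (if ‖w‖ ≤ 1 then g 0 else 0) :=
    i0.bdd_mul (hm ε hε).aestronglyMeasurable (Eventually.of_forall hA)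
  -- The quarter turn preserves the disc and changes the sign of the kernel, so subtracting the
  -- constant `g 0` on the disc does not change the integral.
  have hz : ∫ w, k ε w * (if ‖w‖ ≤ 1 then g 0 else 0) = 0 := by
    have hI : ∃ u : Circle, (u : ℂ) = Complex.I := ⟨⟨Complex.I, mem_sphere_zero_iff_norm.2 Complex.norm_I⟩, rfl⟩
    obtain ⟨u, hu⟩ := hI
    have hmp := (rotation u).measurePreserving
    have h := hmp.integral_comp (rotation u).toHomeomorph.measurableEmbedding
      (fun w => k ε w * (if ‖w‖ ≤ 1 then g 0 else 0))
    have e : ∀ w, k ε (rotation u w) * (if ‖rotation u w‖ ≤ 1 then g 0 else 0) =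
        -(k ε w * (if ‖w‖ ≤ 1 then g 0 else 0)) := by
      intro w
      rw [LinearIsometryEquiv.norm_map, rotation_apply, hu, hodd ε hε, neg_mul]
    simp_rw [e, integral_neg] at h
    exact self_eq_neg.1 h.symm
  simp_rw [mul_sub]
  rw [integral_sub i1 i2, hz, sub_zero]

/-- The principal value of `-(1/π) ∫ f(ζ) / (ζ - z)² dm(ζ)`, as an absolutely convergent integral. -/
noncomputable def beurlingPV (g : ℂ → ℂ) : ℂ :=
  -(1 / (Real.pi : ℂ)) * ∫ w, 1 / w ^ 2 * (g w - (if ‖w‖ ≤ 1 then g 0 else 0))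

/-- The sharp truncations of `1 / w ^ 2` are one admissible family of kernels. The averaged kernels
below are another, and the two limits are to be compared. -/
theorem tendsto_ahlforsBeurlingTrunc (f : 𝓢(ℂ, ℂ)) (z : ℂ) :
    Tendsto (fun ε => ahlforsBeurlingTrunc f ε z) (𝓝[>] 0) (𝓝 (beurlingPV fun w => f (z + w))) := by
  set g : 𝓢(ℂ, ℂ) := SchwartzMap.compSubConstCLM ℂ (-z) f with hg
  have hgw : ∀ w, g w = f (z + w) := fun w => by
    rw [hg, SchwartzMap.compSubConstCLM_apply, sub_neg_eq_add, add_comm]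
  have h := (tendsto_integral_kernel_mul g (k := fun ε w => if ε < ‖w‖ then 1 / w ^ 2 else 0)
    (B := 1) (c := 1) ?_ ?_ ?_ ?_ ?_).const_mul (-(1 / (Real.pi : ℂ)))
  · have e : (fun w => f (z + w)) = g := funext fun w => (hgw w).symm
    rw [e, beurlingPV]
    refine h.congr fun ε => ?_
    rw [ahlforsBeurlingTrunc]
    congr 1
    have hS : MeasurableSet {ζ : ℂ | ε < ‖ζ - z‖} := measurableSet_lt (by fun_prop) (by fun_prop)
    rw [← integral_indicator hS]
    conv_rhs => rw [← integral_add_right_eq_self _ z]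
    refine integral_congr_ae (Eventually.of_forall fun w => ?_)
    have hmem : w + z ∈ {ζ : ℂ | ε < ‖ζ - z‖} ↔ ε < ‖w‖ := by
      rw [Set.mem_ofPred_eq, add_sub_cancel_right]
    by_cases hw : ε < ‖w‖
    · simp only [if_pos hw, Set.indicator_of_mem (hmem.2 hw), hgw, add_sub_cancel_right]
      rw [add_comm w z]; ring
    · simp only [if_neg hw, Set.indicator_of_notMem (mt hmem.1 hw), zero_mul]
  · intro ε _
    exact Measurable.ite (measurableSet_lt (by fun_prop) (by fun_prop)) (by fun_prop)
      measurable_const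
  · intro ε hε w
    split_ifs
    · simp
    · simp only [norm_zero]; positivity
  · intro ε hε
    refine ⟨1 / ε ^ 2, fun w => ?_⟩
    split_ifs with h
    · rw [norm_div, norm_one, norm_pow]
      gcongr
    · simp only [norm_zero]; positivity
  · intro ε _ w
    simp only [norm_mul, Complex.norm_I, one_mul, mul_pow, Complex.I_sq]
    split_ifs
    · rw [neg_mul, one_mul, div_neg]
    · simp
  · intro w hw
    refine tendsto_const_nhds.congr' ?_
    filter_upwards [nhdsWithin_le_nhds (Iio_mem_nhds (norm_pos_iff.2 hw))] with ε hε
    exact (if_pos hε).symm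

/-- The angular average of the rotated copies of `doubleConjPoissonKernel y`. -/
noncomputable def averagedKernel (y : ℝ) (w : ℂ) : ℂ :=
  ∫ θ in Set.Ioc 0 (2 * Real.pi), Complex.exp (-(2 * θ * Complex.I)) *
    doubleConjPoissonKernel y (Circle.exp (-θ) * w)

theorem measurable_averagedKernel_integrand {y : ℝ} (hy : 0 < y) :
    Measurable (Function.uncurry fun (w : ℂ) (θ : ℝ) => Complex.exp (-(2 * θ * Complex.I)) *
      (doubleConjPoissonKernel y (Circle.exp (-θ) * w) : ℂ)) := by
  have := (continuous_doubleConjPoissonKernel hy).measurable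
  simp only [Circle.coe_exp]
  unfold Function.uncurry
  fun_prop

theorem norm_averagedKernel_integrand_le {y : ℝ} (hy : 0 < y) (w : ℂ) (θ : ℝ) :
    ‖Complex.exp (-(2 * θ * Complex.I)) * (doubleConjPoissonKernel y (Circle.exp (-θ) * w) : ℂ)‖ ≤
      1 / (Real.pi * y) * (1 / (Real.pi * y)) := by
  rw [norm_mul, show -(2 * θ * Complex.I) = ((-(2 * θ) : ℝ) : ℂ) * Complex.I by
    push_cast; ring, Complex.norm_exp_ofReal_mul_I, one_mul, Complex.norm_real]
  exact abs_doubleConjPoissonKernel_le hy _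

theorem norm_averagedKernel_le {y : ℝ} (hy : 0 < y) (w : ℂ) :
    ‖averagedKernel y w‖ ≤ 1 / (Real.pi * y) * (1 / (Real.pi * y)) * (2 * Real.pi) := by
  have h := norm_setIntegral_le_of_norm_le_const (μ := volume) (s := Set.Ioc 0 (2 * Real.pi))
    measure_Ioc_lt_top fun θ _ => norm_averagedKernel_integrand_le hy w θ
  refine h.trans (le_of_eq ?_)
  rw [Measure.real, Real.volume_Ioc, sub_zero, ENNReal.toReal_ofReal (by positivity)]

theorem measurable_averagedKernel {y : ℝ} (hy : 0 < y) : Measurable (averagedKernel y) :=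
  (measurable_averagedKernel_integrand hy).stronglyMeasurable.integral_prod_right.measurable

theorem rotationAverage_one_eq {y : ℝ} (hy : 0 < y) (f : 𝓢(ℂ, ℂ)) (z : ℂ) :
    rotationAverage y 1 f z = ∫ w, averagedKernel y w * f (z - w) := by
  have hf : Integrable fun w => f (z - w) := f.integrable.comp_sub_left z
  have hint : Integrable (Function.uncurry fun (θ : ℝ) (w : ℂ) =>
      (Complex.exp (-(2 * θ * Complex.I)) *
        (doubleConjPoissonKernel y (Circle.exp (-θ) * w) : ℂ)) * f (z - w))
      ((volume.restrict (Set.Ioc 0 (2 * Real.pi))).prod volume) := by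
    have h0 := (integrable_const (μ := volume.restrict (Set.Ioc 0 (2 * Real.pi))) (1 : ℂ)).mul_prod hf
    simp only [one_mul] at h0
    exact h0.bdd_mul ((measurable_averagedKernel_integrand hy).comp
      measurable_swap).aestronglyMeasurable
      (Eventually.of_forall fun q => norm_averagedKernel_integrand_le hy q.2 q.1)
  simp only [averagedKernel, ← integral_mul_const]
  rw [← integral_integral_swap hint, rotationAverage]
  refine integral_congr_ae (Eventually.of_forall fun θ => ?_)
  simp only [doubleConjPoissonIntegral]
  rw [← integral_sub_left_eq_self _ volume z, ← integral_const_mul]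
  refine integral_congr_ae (Eventually.of_forall fun w => ?_)
  simp only [sub_sub_cancel]
  push_cast
  ring_nf

/-- Shifting the angle by `π / 2` changes the sign of the character `exp (-2 i θ)`. -/
theorem averagedKernel_I_mul (y : ℝ) (w : ℂ) :
    averagedKernel y (Complex.I * w) = -averagedKernel y w := by
  set F : ℝ → ℂ := fun θ => Complex.exp (-(2 * θ * Complex.I)) *
    doubleConjPoissonKernel y (Circle.exp (-θ) * w) with hF
  have hper : Function.Periodic F (2 * Real.pi) := by
    intro θ
    have h1 : Circle.exp (-(θ + 2 * Real.pi)) = Circle.exp (-θ) := by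
      rw [neg_add, ← sub_eq_add_neg, Circle.periodic_exp.sub_eq]
    simp only [hF, h1]
    congr 1
    rw [Complex.exp_eq_exp_iff_exists_int]
    exact ⟨-2, by push_cast; ring⟩
  have hshift : ∀ θ : ℝ, Complex.exp (-(2 * θ * Complex.I)) *
      doubleConjPoissonKernel y (Circle.exp (-θ) * (Complex.I * w)) = -F (θ - Real.pi / 2) := by
    intro θ
    have h1 : (Circle.exp (-θ) : ℂ) * (Complex.I * w) =
        (Circle.exp (-(θ - Real.pi / 2)) : ℂ) * w := by
      have h3 : Complex.exp (((-(θ - Real.pi / 2) : ℝ) : ℂ) * Complex.I) =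
          Complex.exp (((-θ : ℝ) : ℂ) * Complex.I) * Complex.I := by
        rw [show ((-(θ - Real.pi / 2) : ℝ) : ℂ) * Complex.I =
          ((-θ : ℝ) : ℂ) * Complex.I + Real.pi / 2 * Complex.I by push_cast; ring,
          Complex.exp_add, Complex.exp_pi_div_two_mul_I]
      rw [← mul_assoc, Circle.coe_exp, Circle.coe_exp, h3]
    have h2 : Complex.exp (-(2 * ((θ - Real.pi / 2 : ℝ) : ℂ) * Complex.I)) =
        -Complex.exp (-(2 * θ * Complex.I)) := by
      rw [show -(2 * ((θ - Real.pi / 2 : ℝ) : ℂ) * Complex.I) =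
        -(2 * θ * Complex.I) + Real.pi * Complex.I by push_cast; ring, Complex.exp_add,
        Complex.exp_pi_mul_I]
      ring
    simp only [hF]
    rw [h1, h2]
    ring
  have e : averagedKernel y w = ∫ θ in (0 : ℝ)..2 * Real.pi, F θ := by
    rw [intervalIntegral.integral_of_le (by positivity)]
    rfl
  rw [e, averagedKernel, ← intervalIntegral.integral_of_le (by positivity)]
  simp_rw [hshift]
  rw [intervalIntegral.integral_neg, intervalIntegral.integral_comp_sub_right]
  have := hper.intervalIntegral_add_eq (0 - Real.pi / 2) 0
  rw [zero_add] at this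
  rw [← this]
  ring_nf

theorem mul_conjPoissonKernel_bounds {y : ℝ} (hy : 0 < y) (x : ℝ) :
    0 ≤ x * conjPoissonKernel y x ∧ x * conjPoissonKernel y x ≤ 1 / Real.pi := by
  have hpi := Real.pi_pos
  have e : x * conjPoissonKernel y x = x ^ 2 / (Real.pi * (x ^ 2 + y ^ 2)) := by
    rw [conjPoissonKernel]; ring
  rw [e]
  refine ⟨by positivity, ?_⟩
  rw [div_le_div_iff₀ (by positivity) hpi]
  nlinarith [mul_pos hpi (sq_pos_of_pos hy)]

theorem tendsto_mul_conjPoissonKernel {x : ℝ} (hx : x ≠ 0) :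
    Tendsto (fun y => x * conjPoissonKernel y x) (𝓝[>] 0) (𝓝 (1 / Real.pi)) := by
  have hpi := Real.pi_pos
  have hc : ContinuousAt (fun y : ℝ => x * (x / (Real.pi * (x ^ 2 + y ^ 2)))) 0 := by
    refine continuousAt_const.mul (continuousAt_const.div (by fun_prop) ?_)
    positivity
  have h := hc.tendsto.mono_left (nhdsWithin_le_nhds (s := Set.Ioi (0 : ℝ)))
  have e : x * (x / (Real.pi * (x ^ 2 + 0 ^ 2))) = 1 / Real.pi := by
    rw [zero_pow two_ne_zero, add_zero]
    field_simp
  rw [e] at h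
  exact h

/-- The profile of `averagedKernel`: `|w|² averagedKernel y w = (conj w / w) I profile y |w|`. -/
noncomputable def averagedKernelProfile (y r : ℝ) : ℝ :=
  ∫ β in (0 : ℝ)..2 * Real.pi, 2 * ((r * Real.cos β * conjPoissonKernel y (r * Real.cos β)) *
    (r * Real.sin β * conjPoissonKernel y (r * Real.sin β)))

theorem norm_averagedKernelProfile_integrand_le {y : ℝ} (hy : 0 < y) (r β : ℝ) :
    ‖2 * ((r * Real.cos β * conjPoissonKernel y (r * Real.cos β)) *
      (r * Real.sin β * conjPoissonKernel y (r * Real.sin β)))‖ ≤ 2 / Real.pi ^ 2 := by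
  obtain ⟨h1, h2⟩ := mul_conjPoissonKernel_bounds hy (r * Real.cos β)
  obtain ⟨h3, h4⟩ := mul_conjPoissonKernel_bounds hy (r * Real.sin β)
  rw [Real.norm_of_nonneg (by positivity)]
  calc _ ≤ 2 * (1 / Real.pi * (1 / Real.pi)) := by gcongr
    _ = _ := by field_simp

theorem abs_averagedKernelProfile_le {y : ℝ} (hy : 0 < y) (r : ℝ) :
    |averagedKernelProfile y r| ≤ 4 / Real.pi := by
  have := intervalIntegral.norm_integral_le_of_norm_le_const (a := 0) (b := 2 * Real.pi)
    fun β _ => norm_averagedKernelProfile_integrand_le hy r β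
  refine this.trans (le_of_eq ?_)
  rw [sub_zero, abs_of_pos (by positivity)]
  field_simp
  norm_num

/-- Each factor tends to `1 / π` away from the countably many zeros of `cos` and `sin`; the limit is
`2π · 2 / π²`. -/
theorem tendsto_averagedKernelProfile {r : ℝ} (hr : 0 < r) :
    Tendsto (fun y => averagedKernelProfile y r) (𝓝[>] 0) (𝓝 (4 / Real.pi)) := by
  have h : Tendsto (fun y => averagedKernelProfile y r) (𝓝[>] 0)
      (𝓝 (∫ _β in (0 : ℝ)..2 * Real.pi, 2 * ((1 / Real.pi) * (1 / Real.pi)))) := by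
    refine intervalIntegral.tendsto_integral_filter_of_dominated_convergence
      (fun _ => 2 / Real.pi ^ 2) ?_ ?_ intervalIntegrable_const ?_
    · filter_upwards [self_mem_nhdsWithin] with y hy
      have := (continuous_conjPoissonKernel (show 0 < y from hy)).measurable
      exact Measurable.aestronglyMeasurable (by fun_prop)
    · filter_upwards [self_mem_nhdsWithin] with y hy
      exact Eventually.of_forall fun β _ => norm_averagedKernelProfile_integrand_le hy r β
    · have hc : ∀ᵐ β : ℝ, Real.cos β ≠ 0 := by
        have : {β : ℝ | Real.cos β = 0}.Countable := by
          refine (Set.countable_range fun k : ℤ => (2 * k + 1) * Real.pi / 2).mono fun β hβ => ?_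
          obtain ⟨k, hk⟩ := Real.cos_eq_zero_iff.1 hβ
          exact ⟨k, hk.symm⟩
        exact compl_mem_ae_iff.2 (this.measure_zero volume)
      have hs : ∀ᵐ β : ℝ, Real.sin β ≠ 0 := by
        have : {β : ℝ | Real.sin β = 0}.Countable := by
          refine (Set.countable_range fun k : ℤ => (k : ℝ) * Real.pi).mono fun β hβ => ?_
          obtain ⟨k, hk⟩ := Real.sin_eq_zero_iff.1 hβ
          exact ⟨k, hk⟩
        exact compl_mem_ae_iff.2 (this.measure_zero volume)
      filter_upwards [hc, hs] with β h1 h2 _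
      exact ((tendsto_mul_conjPoissonKernel (mul_ne_zero hr.ne' h1)).mul
        (tendsto_mul_conjPoissonKernel (mul_ne_zero hr.ne' h2))).const_mul 2
  convert h using 2
  rw [intervalIntegral.integral_const, smul_eq_mul, sub_zero]
  field_simp
  norm_num

/-- After `β = α - θ`, split `exp (2 i β) = cos 2β + 2 i sin β cos β`. The cosine part is odd in
`β`, the conjugate Poisson kernel being odd, and integrates to zero; the sine part provides the
factors `r cos β` and `r sin β` that make the profile bounded. -/
theorem averagedKernel_eq {y : ℝ} (hy : 0 < y) {w : ℂ} (hw : w ≠ 0) :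
    averagedKernel y w = Complex.I * averagedKernelProfile y ‖w‖ / w ^ 2 := by
  set r := ‖w‖ with hr
  set α := w.arg with hα
  have hr0 : r ≠ 0 := norm_ne_zero_iff.2 hw
  have hwe : w = r * Complex.exp (α * Complex.I) := (Complex.norm_mul_exp_arg_mul_I w).symm
  set Q := conjPoissonKernel y with hQ
  have hQc : Continuous Q := continuous_conjPoissonKernel hy
  set G : ℝ → ℂ := fun β => Complex.exp (2 * β * Complex.I) *
    (Q (r * Real.cos β) * Q (r * Real.sin β) : ℝ) with hG
  have hGper : Function.Periodic G (2 * Real.pi) := by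
    intro β
    simp only [hG, Real.cos_add_two_pi, Real.sin_add_two_pi]
    congr 1
    rw [Complex.exp_eq_exp_iff_exists_int]
    exact ⟨2, by push_cast; ring⟩
  have hsub : ∀ θ : ℝ, Complex.exp (-(2 * θ * Complex.I)) *
      doubleConjPoissonKernel y (Circle.exp (-θ) * w) =
        Complex.exp (-(2 * α * Complex.I)) * G (α - θ) := by
    intro θ
    have h1 : (Circle.exp (-θ) : ℂ) * w =
        (r * Real.cos (α - θ) : ℝ) + (r * Real.sin (α - θ) : ℝ) * Complex.I := by
      rw [hwe, Circle.coe_exp, mul_left_comm, ← Complex.exp_add,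
        show ((-θ : ℝ) : ℂ) * Complex.I + α * Complex.I = ((α - θ : ℝ) : ℂ) * Complex.I by
          push_cast; ring, Complex.exp_mul_I]
      push_cast
      ring
    have h2 : Complex.exp (-(2 * θ * Complex.I)) = Complex.exp (-(2 * α * Complex.I)) *
        Complex.exp (2 * ((α - θ : ℝ) : ℂ) * Complex.I) := by
      rw [← Complex.exp_add]
      congr 1
      push_cast
      ring
    rw [h1, h2, mul_assoc]
    have hre : ∀ a b : ℝ, ((a : ℂ) + b * Complex.I).re = a := fun a b => by simp
    have him : ∀ a b : ℝ, ((a : ℂ) + b * Complex.I).im = b := fun a b => by simp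
    simp only [hG, doubleConjPoissonKernel, ← hQ, hre, him]
  have hreal : ∫ β in (0 : ℝ)..2 * Real.pi, G β = Complex.I * averagedKernelProfile y r / r ^ 2 := by
    have hodd : ∫ β in (0 : ℝ)..2 * Real.pi,
        ((Real.cos (2 * β) * (Q (r * Real.cos β) * Q (r * Real.sin β)) : ℝ) : ℂ) = 0 := by
      set H : ℝ → ℂ := fun β =>
        ((Real.cos (2 * β) * (Q (r * Real.cos β) * Q (r * Real.sin β)) : ℝ) : ℂ) with hH
      have hHper : Function.Periodic H (2 * Real.pi) := by
        intro β
        simp only [hH, Real.cos_add_two_pi, Real.sin_add_two_pi]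
        rw [show 2 * (β + 2 * Real.pi) = 2 * β + (2 : ℕ) * (2 * Real.pi) by push_cast; ring,
          Real.cos_add_nat_mul_two_pi]
      have hneg : ∀ β, H (-β) = -H β := by
        intro β
        simp only [hH, Real.cos_neg, Real.sin_neg, mul_neg]
        rw [hQ, conjPoissonKernel_neg]
        push_cast
        ring
      have h1 := intervalIntegral.integral_comp_neg (a := 0) (b := 2 * Real.pi) H
      simp_rw [hneg, intervalIntegral.integral_neg] at h1
      have h2 := hHper.intervalIntegral_add_eq (-(2 * Real.pi)) 0
      rw [neg_add_cancel, zero_add] at h2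
      rw [neg_zero, h2] at h1
      exact self_eq_neg.1 h1.symm
    have hsplit : ∀ β : ℝ, G β =
        ((Real.cos (2 * β) * (Q (r * Real.cos β) * Q (r * Real.sin β)) : ℝ) : ℂ) +
        Complex.I / r ^ 2 * ((2 * ((r * Real.cos β * Q (r * Real.cos β)) *
          (r * Real.sin β * Q (r * Real.sin β))) : ℝ) : ℂ) := by
      intro β
      have : Complex.exp (2 * β * Complex.I) = (Real.cos (2 * β) : ℂ) +
          2 * Real.sin β * Real.cos β * Complex.I := by
        rw [show (2 * β * Complex.I : ℂ) = ((2 * β : ℝ) : ℂ) * Complex.I by push_cast; ring,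
          Complex.exp_mul_I, ← Complex.ofReal_cos, ← Complex.ofReal_sin, Real.sin_two_mul]
        push_cast
        ring
      simp only [hG]
      rw [this]
      have : (r : ℂ) ≠ 0 := Complex.ofReal_ne_zero.2 hr0
      push_cast
      field_simp
    simp_rw [hsplit]
    rw [intervalIntegral.integral_add, hodd, zero_add, intervalIntegral.integral_const_mul,
      intervalIntegral.integral_ofReal, averagedKernelProfile]
    · ring
    · exact Continuous.intervalIntegrable (by fun_prop) _ _
    · exact Continuous.intervalIntegrable (by fun_prop) _ _
  rw [averagedKernel, ← intervalIntegral.integral_of_le (by positivity)]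
  simp_rw [hsub]
  rw [intervalIntegral.integral_const_mul, intervalIntegral.integral_comp_sub_left]
  have h3 := hGper.intervalIntegral_add_eq (α - 2 * Real.pi) 0
  rw [sub_add_cancel, zero_add] at h3
  rw [sub_zero, h3, hreal]
  have h4 : w ^ 2 = r ^ 2 * Complex.exp (2 * α * Complex.I) := by
    conv_lhs => rw [hwe]
    rw [mul_pow, ← Complex.exp_nat_mul]
    congr 2
    push_cast
    ring
  rw [h4, Complex.exp_neg]
  have := Complex.exp_ne_zero (2 * α * Complex.I)
  have : (r : ℂ) ≠ 0 := Complex.ofReal_ne_zero.2 hr0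
  field_simp

theorem tendsto_rotationAverage_one (f : 𝓢(ℂ, ℂ)) (z : ℂ) :
    Tendsto (fun y => rotationAverage y 1 f z) (𝓝[>] 0)
      (𝓝 (-(4 * Complex.I) * beurlingPV fun w => f (z + w))) := by
  set g : 𝓢(ℂ, ℂ) := SchwartzMap.compSubConstCLM ℂ (-z) f with hg
  have hgw : ∀ w, g w = f (z + w) := fun w => by
    rw [hg, SchwartzMap.compSubConstCLM_apply, sub_neg_eq_add, add_comm]
  have e : (fun w => f (z + w)) = g := funext fun w => (hgw w).symm
  -- The averages involve `f (z - w)`, the principal value `f (z + w)`; two quarter turns show that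
  -- the kernel is even.
  have hev : ∀ y w, averagedKernel y (-w) = averagedKernel y w := by
    intro y w
    rw [← neg_neg (averagedKernel y w), ← averagedKernel_I_mul, ← averagedKernel_I_mul,
      ← mul_assoc, Complex.I_mul_I, neg_one_mul]
  have h := tendsto_integral_kernel_mul g (k := averagedKernel) (B := 4 / Real.pi)
    (c := 4 * Complex.I / Real.pi) (fun y hy => measurable_averagedKernel hy) ?_
    (fun y hy => ⟨_, norm_averagedKernel_le hy⟩) (fun y _ => averagedKernel_I_mul y) ?_
  · have e2 : -(4 * Complex.I) * beurlingPV (fun w => f (z + w)) =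
        ∫ w, 4 * Complex.I / Real.pi / w ^ 2 * (g w - (if ‖w‖ ≤ 1 then g 0 else 0)) := by
      rw [e, beurlingPV, ← integral_const_mul, ← integral_const_mul]
      refine integral_congr_ae (Eventually.of_forall fun w => ?_)
      simp only
      ring
    rw [e2]
    refine h.congr' ?_
    filter_upwards [self_mem_nhdsWithin] with y hy
    rw [rotationAverage_one_eq hy]
    conv_rhs => rw [← integral_neg_eq_self]
    refine integral_congr_ae (Eventually.of_forall fun w => ?_)
    simp only [hev, hgw, sub_eq_add_neg, neg_neg]
  · intro y hy w
    rcases eq_or_ne w 0 with rfl | hw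
    · have := averagedKernel_I_mul y 0
      rw [mul_zero, self_eq_neg] at this
      simp [this]
    · rw [averagedKernel_eq hy hw, norm_div, norm_mul, Complex.norm_I, one_mul, norm_pow,
        Complex.norm_real]
      gcongr
      exact abs_averagedKernelProfile_le hy _
  · intro w hw
    have h1 : Tendsto (fun y => Complex.I * (averagedKernelProfile y ‖w‖ : ℂ) / w ^ 2) (𝓝[>] 0)
        (𝓝 (Complex.I * ((4 / Real.pi : ℝ) : ℂ) / w ^ 2)) :=
      (((Complex.continuous_ofReal.tendsto _).comp
        (tendsto_averagedKernelProfile (norm_pos_iff.2 hw))).const_mul _).div_const _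
    have e3 : Complex.I * ((4 / Real.pi : ℝ) : ℂ) / w ^ 2 = 4 * Complex.I / Real.pi / w ^ 2 := by
      push_cast; ring
    rw [← e3]
    refine h1.congr' ?_
    filter_upwards [self_mem_nhdsWithin] with y hy
    exact (averagedKernel_eq hy hw).symm

/-- The averages with `n = 1` have two limits, one computed on the frequency side and one on the
kernel side; both carry the factor `-4 i`. -/
theorem multiplierOperator_eq_beurlingPV (f : 𝓢(ℂ, ℂ)) (z : ℂ) :
    multiplierOperator (fun ξ => (starRingEnd ℂ) ξ / ξ) f z = beurlingPV fun w => f (z + w) := by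
  have h := tendsto_nhds_unique (tendsto_rotationAverage f odd_one z)
    (tendsto_rotationAverage_one f z)
  simp only [zpow_one, Int.cast_one, div_one] at h
  exact mul_left_cancel₀ (by simp) h

/-! ### Multiplier operators on Schwartz functions and Wirtinger derivatives -/

theorem norm_conj_div_zpow_le (n : ℤ) (ξ : ℂ) : ‖((starRingEnd ℂ) ξ / ξ) ^ n‖ ≤ 1 := by
  rcases eq_or_ne ξ 0 with rfl | hξ
  · rw [div_zero]
    rcases eq_or_ne n 0 with rfl | hn
    · simp
    · rw [zero_zpow n hn, norm_zero]; exact zero_le_one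
  · rw [norm_zpow, norm_div, RCLike.norm_conj, div_self (norm_ne_zero_iff.2 hξ), one_zpow]

theorem measurable_conj_div_zpow (n : ℤ) : Measurable fun ξ : ℂ => ((starRingEnd ℂ) ξ / ξ) ^ n := by
  have : Measurable fun ξ : ℂ => (starRingEnd ℂ) ξ := Complex.continuous_conj.measurable
  have h1 : Measurable fun ξ : ℂ => (starRingEnd ℂ) ξ / ξ := this.div measurable_id
  cases n with
  | ofNat n => simpa using h1.pow_const n
  | negSucc n => simp only [zpow_negSucc]; exact (h1.pow_const (n + 1)).inv

theorem integrable_mul_fourier_schwartz {m : ℂ → ℂ} (hm : Measurable m) (hb : ∀ ξ, ‖m ξ‖ ≤ 1)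
    (f : 𝓢(ℂ, ℂ)) : Integrable fun ξ => m ξ * 𝓕 (f : ℂ → ℂ) ξ :=
  (integrable_fourier_schwartz f).bdd_mul hm.aestronglyMeasurable (Eventually.of_forall hb)

theorem multiplierOperator_apply (m : ℂ → ℂ) (f : ℂ → ℂ) (z : ℂ) :
    multiplierOperator m f z = 𝓕 (fun ξ => m ξ * 𝓕 f ξ) (-z) := by
  rw [multiplierOperator, Real.fourierInv_eq_fourier_neg]

theorem continuous_multiplierOperator {m : ℂ → ℂ} (hm : Measurable m) (hb : ∀ ξ, ‖m ξ‖ ≤ 1)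
    (f : 𝓢(ℂ, ℂ)) : Continuous (multiplierOperator m f) := by
  have h : Continuous (𝓕 (fun ξ => m ξ * 𝓕 (f : ℂ → ℂ) ξ)) :=
    VectorFourier.fourierIntegral_continuous Real.continuous_fourierChar
      (by exact continuous_inner) (integrable_mul_fourier_schwartz hm hb f)
  have e : multiplierOperator m f = fun z => 𝓕 (fun ξ => m ξ * 𝓕 (f : ℂ → ℂ) ξ) (-z) :=
    funext fun z => multiplierOperator_apply m f z
  rw [e]
  exact h.comp continuous_neg

theorem multiplierOperator_add {m : ℂ → ℂ} (hm : Measurable m) (hb : ∀ ξ, ‖m ξ‖ ≤ 1)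
    (f g : 𝓢(ℂ, ℂ)) :
    multiplierOperator m (f + g : 𝓢(ℂ, ℂ)) = multiplierOperator m f + multiplierOperator m g := by
  funext z
  rw [Pi.add_apply, multiplierOperator_apply, multiplierOperator_apply, multiplierOperator_apply]
  have e : (fun ξ => m ξ * 𝓕 ((f + g : 𝓢(ℂ, ℂ)) : ℂ → ℂ) ξ) =
      (fun ξ => m ξ * 𝓕 (f : ℂ → ℂ) ξ) + fun ξ => m ξ * 𝓕 (g : ℂ → ℂ) ξ := by
    funext ξ
    rw [← SchwartzMap.fourier_coe, ← SchwartzMap.fourier_coe, ← SchwartzMap.fourier_coe,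
      FourierTransform.fourier_add, add_apply, mul_add, Pi.add_apply]
  rw [e]
  exact congrFun (VectorFourier.fourierIntegral_add (L := innerₗ ℂ) (μ := volume) Real.continuous_fourierChar
      (by exact continuous_inner) (integrable_mul_fourier_schwartz hm hb f)
      (integrable_mul_fourier_schwartz hm hb g)) (-z)

theorem multiplierOperator_smul (m : ℂ → ℂ) (c : ℂ) (f : 𝓢(ℂ, ℂ)) :
    multiplierOperator m (c • f : 𝓢(ℂ, ℂ)) = c • multiplierOperator m f := by
  funext z
  rw [Pi.smul_apply, multiplierOperator_apply, multiplierOperator_apply]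
  have e : (fun ξ => m ξ * 𝓕 ((c • f : 𝓢(ℂ, ℂ)) : ℂ → ℂ) ξ) =
      c • fun ξ => m ξ * 𝓕 (f : ℂ → ℂ) ξ := by
    funext ξ
    rw [← SchwartzMap.fourier_coe, ← SchwartzMap.fourier_coe,
      FourierTransform.fourier_smul, smul_apply, Pi.smul_apply, smul_eq_mul,
      smul_eq_mul, mul_left_comm]
  rw [e]
  exact congrFun (VectorFourier.fourierIntegral_const_smul _ _ _ _ c) (-z)

theorem multiplierOperator_eq_of_fourier {m : ℂ → ℂ} {f g : 𝓢(ℂ, ℂ)}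
    (h : ∀ ξ, m ξ * 𝓕 f ξ = 𝓕 g ξ) : multiplierOperator m f = g := by
  have e : (fun ξ => m ξ * 𝓕 (f : ℂ → ℂ) ξ) = 𝓕 g := by
    funext ξ
    rw [← h, SchwartzMap.fourier_coe]
  rw [multiplierOperator, e, ← SchwartzMap.fourierInv_coe, FourierTransform.fourierInv_fourier_eq]

/-- Multipliers with an even symbol are symmetric. -/
theorem integral_multiplierOperator_mul {m : ℂ → ℂ} (hm : Measurable m) (hb : ∀ ξ, ‖m ξ‖ ≤ 1)
    (heven : ∀ ξ, m (-ξ) = m ξ) (f g : 𝓢(ℂ, ℂ)) :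
    ∫ z, multiplierOperator m f z * g z = ∫ z, f z * multiplierOperator m g z := by
  have hswap : ∀ F G : ℂ → ℂ, Integrable F → Integrable G →
      ∫ z, 𝓕 F z * G z = ∫ z, F z * 𝓕 G z := by
    intro F G hF hG
    have h := VectorFourier.integral_bilin_fourierIntegral_eq_flip (ContinuousLinearMap.mul ℂ ℂ)
      (L := innerₗ ℂ) (μ := volume) (ν := volume)
      Real.continuous_fourierChar (by exact continuous_inner) hF hG
    simpa using! h
  -- This form is invariant under exchanging `f` and `g` together with `ξ ↦ -ξ`, as the symbol is
  -- even.
  have key : ∀ f g : 𝓢(ℂ, ℂ), ∫ z, multiplierOperator m f z * g z =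
      ∫ ξ, m ξ * (𝓕 (f : ℂ → ℂ) ξ * 𝓕 (g : ℂ → ℂ) (-ξ)) := by
    intro f g
    rw [← integral_neg_eq_self]
    simp only [multiplierOperator_apply, neg_neg]
    rw [hswap _ (fun z => g (-z)) (integrable_mul_fourier_schwartz hm hb f) g.integrable.comp_neg]
    refine integral_congr_ae (Eventually.of_forall fun ξ => ?_)
    have : 𝓕 (fun z => g (-z)) ξ = 𝓕 (g : ℂ → ℂ) (-ξ) := by
      rw [← Real.fourierInv_eq_fourier_neg, Real.fourierInv_eq_fourier_comp_neg]
    simp only [this, mul_assoc]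
  rw [key f g]
  simp_rw [mul_comm (f _)]
  rw [key g f, ← integral_neg_eq_self]
  refine integral_congr_ae (Eventually.of_forall fun ξ => ?_)
  simp only [heven, neg_neg]
  ring

open LineDeriv in
/-- Twice the Wirtinger derivative `∂/∂ conj z`. -/
noncomputable def wirtingerBar : 𝓢(ℂ, ℂ) →ₗ[ℂ] 𝓢(ℂ, ℂ) where
  toFun f := ∂_{(1 : ℂ)} f + Complex.I • ∂_{Complex.I} f
  map_add' f g := by rw [lineDerivOp_add, lineDerivOp_add, smul_add]; abel
  map_smul' c f := by
    rw [lineDerivOp_smul, lineDerivOp_smul, RingHom.id_apply, smul_add, smul_comm c]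

open LineDeriv in
/-- Twice the Wirtinger derivative `∂/∂z`. -/
noncomputable def wirtinger : 𝓢(ℂ, ℂ) →ₗ[ℂ] 𝓢(ℂ, ℂ) where
  toFun f := ∂_{(1 : ℂ)} f - Complex.I • ∂_{Complex.I} f
  map_add' f g := by rw [lineDerivOp_add, lineDerivOp_add, smul_add]; abel
  map_smul' c f := by
    rw [lineDerivOp_smul, lineDerivOp_smul, RingHom.id_apply, smul_sub, smul_comm c]

open LineDeriv in
theorem fourier_lineDerivOp_apply (f : 𝓢(ℂ, ℂ)) (v ξ : ℂ) :
    𝓕 (∂_{v} f) ξ = 2 * Real.pi * Complex.I * ((inner ℝ ξ v : ℝ) * 𝓕 f ξ) := by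
  rw [SchwartzMap.fourier_lineDerivOp_eq, smul_apply, SchwartzMap.smulLeftCLM_apply_apply
    (by fun_prop)]
  simp

theorem fourier_wirtingerBar_apply (f : 𝓢(ℂ, ℂ)) (ξ : ℂ) :
    𝓕 (wirtingerBar f) ξ = 2 * Real.pi * Complex.I * (ξ * 𝓕 f ξ) := by
  have h1 : (inner ℝ ξ 1 : ℝ) = ξ.re := by simp [Complex.inner]
  have h2 : (inner ℝ ξ Complex.I : ℝ) = ξ.im := by simp [Complex.inner]
  simp only [wirtingerBar, LinearMap.coe_mk, AddHom.coe_mk]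
  rw [FourierTransform.fourier_add, FourierTransform.fourier_smul, add_apply,
    smul_apply, fourier_lineDerivOp_apply, fourier_lineDerivOp_apply, h1, h2]
  rw [smul_eq_mul]
  linear_combination (2 * Real.pi * Complex.I * 𝓕 f ξ) * Complex.re_add_im ξ

theorem fourier_wirtinger_apply (f : 𝓢(ℂ, ℂ)) (ξ : ℂ) :
    𝓕 (wirtinger f) ξ = 2 * Real.pi * Complex.I * ((starRingEnd ℂ) ξ * 𝓕 f ξ) := by
  have h1 : (inner ℝ ξ 1 : ℝ) = ξ.re := by simp [Complex.inner]
  have h2 : (inner ℝ ξ Complex.I : ℝ) = ξ.im := by simp [Complex.inner]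
  have h3 : (starRingEnd ℂ) ξ = ξ.re - ξ.im * Complex.I := by
    apply Complex.ext <;> simp
  simp only [wirtinger, LinearMap.coe_mk, AddHom.coe_mk]
  rw [sub_eq_add_neg, ← neg_smul, FourierTransform.fourier_add, FourierTransform.fourier_smul,
    add_apply,
    smul_apply, fourier_lineDerivOp_apply, fourier_lineDerivOp_apply, h1, h2, h3,
    smul_eq_mul]
  ring

theorem fourier_wirtingerBar_iterate (n : ℕ) (f : 𝓢(ℂ, ℂ)) (ξ : ℂ) :
    𝓕 (wirtingerBar^[n] f) ξ = (2 * Real.pi * Complex.I) ^ n * (ξ ^ n * 𝓕 f ξ) := by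
  induction n with
  | zero => simp
  | succ n ih =>
    rw [Function.iterate_succ_apply', fourier_wirtingerBar_apply, ih]
    ring

theorem fourier_wirtinger_iterate (n : ℕ) (f : 𝓢(ℂ, ℂ)) (ξ : ℂ) :
    𝓕 (wirtinger^[n] f) ξ =
      (2 * Real.pi * Complex.I) ^ n * ((starRingEnd ℂ) ξ ^ n * 𝓕 f ξ) := by
  induction n with
  | zero => simp
  | succ n ih =>
    rw [Function.iterate_succ_apply', fourier_wirtinger_apply, ih]
    ring

/-- The derivatives have symbols `2πi ξ` and `2πi conj ξ`. On such functions the multiplier stays in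
the Schwartz class in spite of its singularity at the origin, so products and powers can be computed
there. -/
theorem multiplierOperator_wirtingerBar_iterate (n : ℕ) (f : 𝓢(ℂ, ℂ)) :
    multiplierOperator (fun ξ => ((starRingEnd ℂ) ξ / ξ) ^ (n : ℤ)) (wirtingerBar^[n] f : 𝓢(ℂ, ℂ)) =
      (wirtinger^[n] f : 𝓢(ℂ, ℂ)) := by
  refine multiplierOperator_eq_of_fourier fun ξ => ?_
  rw [fourier_wirtingerBar_iterate, fourier_wirtinger_iterate, zpow_natCast, div_pow]
  rcases eq_or_ne ξ 0 with rfl | hξ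
  · rcases eq_or_ne n 0 with rfl | hn
    · simp
    · simp [hn]
  · field_simp

theorem multiplierOperator_wirtinger_iterate (n : ℕ) (f : 𝓢(ℂ, ℂ)) :
    multiplierOperator (fun ξ => ((starRingEnd ℂ) ξ / ξ) ^ (-n : ℤ)) (wirtinger^[n] f : 𝓢(ℂ, ℂ)) =
      (wirtingerBar^[n] f : 𝓢(ℂ, ℂ)) := by
  refine multiplierOperator_eq_of_fourier fun ξ => ?_
  rw [fourier_wirtingerBar_iterate, fourier_wirtinger_iterate, zpow_neg, zpow_natCast, div_pow,
    inv_div]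
  rcases eq_or_ne ξ 0 with rfl | hξ
  · rcases eq_or_ne n 0 with rfl | hn
    · simp
    · simp [hn]
  · have : (starRingEnd ℂ) ξ ≠ 0 := (map_ne_zero _).2 hξ
    field_simp

/-! ### Extension to `L^p`, existence and uniqueness of the transform -/

theorem exists_multiplierLp {p : ℝ≥0∞} [Fact (1 ≤ p)] (hp : 1 < p) (hp_top : p ≠ ∞) :
    ∃ (C : ℝ) (T : ℤ → Lp ℂ p (volume : Measure ℂ) →L[ℂ] Lp ℂ p (volume : Measure ℂ)), 0 ≤ C ∧
      ∀ n, Odd n → ‖T n‖ ≤ C * |(n : ℝ)| ∧ ∀ f : 𝓢(ℂ, ℂ), T n (f.toLp p volume) =ᵐ[volume]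
        multiplierOperator (fun ξ => ((starRingEnd ℂ) ξ / ξ) ^ n) f := by
  obtain ⟨C, hC⟩ := exists_eLpNorm_multiplierOperator_le hp hp_top
  have key : ∀ n : ℤ, ∃ T : Lp ℂ p (volume : Measure ℂ) →L[ℂ] Lp ℂ p (volume : Measure ℂ),
      Odd n → ‖T‖ ≤ C * |(n : ℝ)| ∧ ∀ f : 𝓢(ℂ, ℂ), T (f.toLp p volume) =ᵐ[volume]
        multiplierOperator (fun ξ => ((starRingEnd ℂ) ξ / ξ) ^ n) f := by
    intro n
    by_cases hn : Odd n
    swap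
    · exact ⟨0, fun h => absurd h hn⟩
    set m : ℂ → ℂ := fun ξ => ((starRingEnd ℂ) ξ / ξ) ^ n with hmdef
    have hm : Measurable m := measurable_conj_div_zpow n
    have hb : ∀ ξ, ‖m ξ‖ ≤ 1 := norm_conj_div_zpow_le n
    have hfin : ∀ f : 𝓢(ℂ, ℂ), C * ‖(n : ℝ)‖ₑ * eLpNorm f p volume < ∞ := fun f =>
      ENNReal.mul_lt_top (ENNReal.mul_lt_top ENNReal.coe_lt_top enorm_lt_top) (f.memLp p volume).2
    have hmem : ∀ f : 𝓢(ℂ, ℂ), MemLp (multiplierOperator m f) p volume := fun f =>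
      ⟨(continuous_multiplierOperator hm hb f).aestronglyMeasurable,
        (hC n hn f).trans_lt (hfin f)⟩
    let L : 𝓢(ℂ, ℂ) →ₗ[ℂ] Lp ℂ p (volume : Measure ℂ) :=
      { toFun := fun f => (hmem f).toLp
        map_add' := fun f g => by
          rw [← MemLp.toLp_add]
          exact MemLp.toLp_congr _ _ (by rw [multiplierOperator_add hm hb])
        map_smul' := fun c f => by
          rw [RingHom.id_apply, ← MemLp.toLp_const_smul]
          exact MemLp.toLp_congr _ _ (by rw [multiplierOperator_smul]) }
    let e : 𝓢(ℂ, ℂ) →ₗ[ℂ] Lp ℂ p (volume : Measure ℂ) :=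
      (SchwartzMap.toLpCLM ℂ ℂ p (volume : Measure ℂ)).toLinearMap
    have he : DenseRange e := SchwartzMap.denseRange_toLpCLM (F := ℂ) hp_top
    have hL : ∀ f, ‖L f‖ ≤ C * |(n : ℝ)| * ‖e f‖ := by
      intro f
      have h1 : ‖L f‖ = (eLpNorm (multiplierOperator m f) p volume).toReal :=
        Lp.norm_toLp _ (hmem f)
      have h2 : ‖e f‖ = (eLpNorm f p volume).toReal := SchwartzMap.norm_toLp
      rw [h1, h2]
      refine (ENNReal.toReal_mono (hfin f).ne (hC n hn f)).trans (le_of_eq ?_)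
      rw [ENNReal.toReal_mul, ENNReal.toReal_mul, toReal_enorm, Real.norm_eq_abs,
        ENNReal.coe_toReal]
    refine ⟨L.extendOfNorm e, fun _ => ⟨LinearMap.opNorm_extendOfNorm_le he (by positivity) hL,
      fun f => ?_⟩⟩
    have h3 : L.extendOfNorm e (f.toLp p volume) = L f :=
      LinearMap.extendOfNorm_eq he ⟨_, hL⟩ f
    rw [h3]
    exact (hmem f).coeFn_toLp
  choose T hT using key
  exact ⟨C, T, C.2, hT⟩

theorem ContinuousLinearMap.eq_of_forall_schwartz {p : ℝ≥0∞} [Fact (1 ≤ p)] (hp_top : p ≠ ∞)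
    {X : Type*} [NormedAddCommGroup X] [NormedSpace ℂ X]
    {S T : Lp ℂ p (volume : Measure ℂ) →L[ℂ] X}
    (h : ∀ f : 𝓢(ℂ, ℂ), S (f.toLp p volume) = T (f.toLp p volume)) : S = T := by
  have he : DenseRange (SchwartzMap.toLpCLM ℝ ℂ p (volume : Measure ℂ)) :=
    SchwartzMap.denseRange_toLpCLM (F := ℂ) hp_top
  exact DFunLike.coe_injective (he.equalizer S.continuous T.continuous (funext h))

theorem isAhlforsBeurling_iff {p : ℝ≥0∞} [Fact (1 ≤ p)]
    {T : Lp ℂ p (volume : Measure ℂ) →L[ℂ] Lp ℂ p (volume : Measure ℂ)} :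
    IsAhlforsBeurling p T ↔ ∀ f : 𝓢(ℂ, ℂ), T (f.toLp p volume) =ᵐ[volume]
      multiplierOperator (fun ξ => (starRingEnd ℂ) ξ / ξ) f := by
  refine forall_congr' fun f => eventually_congr (Eventually.of_forall fun z => ?_)
  have h := tendsto_ahlforsBeurlingTrunc f z
  rw [← multiplierOperator_eq_beurlingPV] at h
  exact ⟨fun h' => tendsto_nhds_unique h' h, fun h' => h' ▸ h⟩

theorem existsUnique_isAhlforsBeurling {p : ℝ≥0∞} [Fact (1 ≤ p)] (hp : 1 < p) (hp_top : p ≠ ∞) :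
    ∃! T : Lp ℂ p (volume : Measure ℂ) →L[ℂ] Lp ℂ p (volume : Measure ℂ),
      IsAhlforsBeurling p T := by
  obtain ⟨C, T, -, hT⟩ := exists_multiplierLp hp hp_top
  refine ⟨T 1, isAhlforsBeurling_iff.2 fun f => ?_, fun S hS => ?_⟩
  · simpa only [zpow_one] using (hT 1 odd_one).2 f
  · refine ContinuousLinearMap.eq_of_forall_schwartz hp_top fun f => Lp.ext ?_
    refine (isAhlforsBeurling_iff.1 hS f).trans ?_
    simpa only [zpow_one] using ((hT 1 odd_one).2 f).symm

/-! ### Functionals on `L^p` and translates of test functions -/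

theorem SchwartzMap.norm_sub_le_seminorm {E F : Type*} [NormedAddCommGroup E] [NormedSpace ℝ E]
    [NormedAddCommGroup F] [NormedSpace ℝ F] (g : 𝓢(E, F)) (x y : E) :
    ‖g x - g y‖ ≤ SchwartzMap.seminorm ℝ 0 1 g * ‖x - y‖ :=
  Convex.norm_image_sub_le_of_norm_fderiv_le (𝕜 := ℝ) (f := g) (s := Set.univ)
    (fun x _ => g.differentiableAt)
    (fun x _ => by
      have := g.norm_iteratedFDeriv_le_seminorm ℝ 1 x
      rwa [norm_iteratedFDeriv_one] at this) convex_univ trivial trivial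

theorem SchwartzMap.norm_taylor_le {E F : Type*} [NormedAddCommGroup E] [NormedSpace ℝ E]
    [NormedAddCommGroup F] [NormedSpace ℝ F] (g : 𝓢(E, F)) (x v : E) :
    ‖g (x - v) - g x + fderiv ℝ g x v‖ ≤
      SchwartzMap.seminorm ℝ 0 1 (SchwartzMap.fderivCLM ℝ E F g) * ‖v‖ * ‖v‖ := by
  set M := SchwartzMap.seminorm ℝ 0 1 (SchwartzMap.fderivCLM ℝ E F g) with hM
  have hM0 : 0 ≤ M := apply_nonneg _ _
  have h := (convex_closedBall x ‖v‖).norm_image_sub_le_of_norm_fderiv_le' (𝕜 := ℝ) (f := g)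
    (C := M * ‖v‖) (φ := fderiv ℝ g x) (x := x) (y := x - v)
    (fun y _ => g.differentiableAt) (fun y hy => ?_) (by simp) (by simp)
  · simpa using h
  · have := (SchwartzMap.fderivCLM ℝ E F g).norm_sub_le_seminorm y x
    rw [SchwartzMap.fderivCLM_apply, SchwartzMap.fderivCLM_apply] at this
    exact this.trans (mul_le_mul_of_nonneg_left (by simpa [dist_eq_norm] using hy) hM0)

theorem eLpNorm_le_of_bound_of_support {p : ℝ≥0∞} (hp0 : p ≠ 0) (hp_top : p ≠ ∞) {g : ℂ → ℂ}
    {s : Set ℂ} (hs : MeasurableSet s) {A : ℝ} (hA : 0 ≤ A) (hg : ∀ z, ‖g z‖ ≤ A)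
    (hsupp : ∀ z, z ∉ s → g z = 0) :
    eLpNorm g p volume ≤ ENNReal.ofReal A * volume s ^ (1 / p.toReal) := by
  have h1 : eLpNorm g p volume ≤ eLpNorm (s.indicator fun _ => A) p volume := by
    refine eLpNorm_mono fun z => ?_
    by_cases hz : z ∈ s
    · rw [Set.indicator_of_mem hz, Real.norm_of_nonneg hA]
      exact hg z
    · rw [hsupp z hz, norm_zero]
      exact norm_nonneg _
  refine h1.trans (le_of_eq ?_)
  rw [eLpNorm_indicator_const hs hp0 hp_top, Real.enorm_of_nonneg hA]

-- The Taylor remainder is uniformly `O(‖v‖²)` and, as `‖v‖ ≤ 1`, is supported in a fixed ball of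
-- radius `R + 1`; so the uniform bound is also an `L^p` bound.
open LineDeriv in
theorem exists_norm_translate_taylor_le {p : ℝ≥0∞} [Fact (1 ≤ p)] (hp_top : p ≠ ∞)
    {ψ : 𝓢(ℂ, ℂ)} (hψ : HasCompactSupport ψ) : ∃ K : ℝ, ∀ v : ℂ, ‖v‖ ≤ 1 →
      ‖(SchwartzMap.compSubConstCLM ℂ v ψ - ψ + ∂_{v} ψ).toLp p volume‖ ≤ K * ‖v‖ ^ 2 := by
  obtain ⟨R, hR⟩ := hψ.isCompact.isBounded.subset_closedBall (0 : ℂ)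
  have hzero : ∀ z, R < ‖z‖ → ψ z = 0 := fun z hz =>
    image_eq_zero_of_notMem_tsupport fun h => by
      have := hR h
      rw [mem_closedBall_zero_iff] at this
      exact absurd this (not_le.2 hz)
  have hzero' : ∀ z, R < ‖z‖ → fderiv ℝ ψ z = 0 := fun z hz => by
    have : z ∉ tsupport (fderiv ℝ ψ) := fun h => by
      have := hR (tsupport_fderiv_subset ℝ h)
      rw [mem_closedBall_zero_iff] at this
      exact absurd this (not_le.2 hz)
    exact image_eq_zero_of_notMem_tsupport this
  set M := SchwartzMap.seminorm ℝ 0 1 (SchwartzMap.fderivCLM ℝ ℂ ℂ ψ) with hM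
  have hM0 : 0 ≤ M := apply_nonneg _ _
  set B := (volume (Metric.closedBall (0 : ℂ) (R + 1)) ^ (1 / p.toReal)).toReal with hB
  have hp0 : p ≠ 0 := (zero_lt_one.trans_le Fact.out).ne'
  refine ⟨M * B, fun v hv => ?_⟩
  set χ := SchwartzMap.compSubConstCLM ℂ v ψ - ψ + ∂_{v} ψ with hχ
  have hχz : ∀ z, χ z = ψ (z - v) - ψ z + fderiv ℝ ψ z v := fun z => rfl
  have h2 := eLpNorm_le_of_bound_of_support hp0 hp_top (g := χ)
    (Metric.isClosed_closedBall (x := (0 : ℂ)) (ε := R + 1)).measurableSet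
    (A := M * ‖v‖ * ‖v‖) (by positivity) (fun z => by rw [hχz]; exact ψ.norm_taylor_le z v)
    (fun z hz => by
      rw [mem_closedBall_zero_iff, not_le] at hz
      have h3 : R < ‖z - v‖ := by
        have := norm_sub_norm_le z v
        linarith
      rw [hχz, hzero _ h3, hzero z (by linarith), hzero' z (by linarith)]
      simp)
  rw [SchwartzMap.norm_toLp]
  refine (ENNReal.toReal_mono ?_ h2).trans (le_of_eq ?_)
  · exact (ENNReal.mul_lt_top ENNReal.ofReal_lt_top (ENNReal.rpow_lt_top_of_nonneg (by positivity)
      measure_closedBall_lt_top.ne)).ne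
  · rw [ENNReal.toReal_mul, ENNReal.toReal_ofReal (by positivity)]
    ring

-- Turns information about `ℓ` on derivatives of translates into a differential equation for the
-- function `u ↦ ℓ(φ(· - u))` of the translation vector.
open LineDeriv in
theorem hasFDerivAt_apply_translate {p : ℝ≥0∞} [Fact (1 ≤ p)]
    (hp_top : p ≠ ∞) (ℓ : Lp ℂ p (volume : Measure ℂ) →L[ℂ] ℂ)
    {φ : 𝓢(ℂ, ℂ)} (hφ : HasCompactSupport φ) (w : ℂ) :
    ∃ L : ℂ →L[ℝ] ℂ, (∀ v, L v = -ℓ ((∂_{v} (SchwartzMap.compSubConstCLM ℂ w φ)).toLp p volume)) ∧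
      HasFDerivAt (fun u => ℓ ((SchwartzMap.compSubConstCLM ℂ u φ).toLp p volume)) L w := by
  set ψ := SchwartzMap.compSubConstCLM ℂ w φ with hψdef
  have hψ : HasCompactSupport ψ := hφ.comp_homeomorph (Homeomorph.subRight w)
  set J := SchwartzMap.toLpCLM ℂ ℂ p (volume : Measure ℂ) with hJ
  obtain ⟨L, hL⟩ : ∃ L : ℂ →L[ℝ] ℂ, ∀ v, L v = -ℓ (J (∂_{v} ψ)) := by
    let L0 : ℂ →ₗ[ℝ] ℂ :=
      { toFun := fun v => -ℓ (J (∂_{v} ψ))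
        map_add' := fun u v => by rw [lineDerivOp_left_add, map_add, map_add, neg_add]
        map_smul' := fun r v => by
          rw [lineDerivOp_left_smul, ← Complex.coe_smul, map_smul, map_smul, RingHom.id_apply,
            Complex.coe_smul, smul_neg] }
    exact ⟨LinearMap.toContinuousLinearMap L0, fun v => rfl⟩
  refine ⟨L, hL, ?_⟩
  obtain ⟨K, hK⟩ := exists_norm_translate_taylor_le hp_top hψ
  have hO : (fun u => ℓ (J (SchwartzMap.compSubConstCLM ℂ u φ)) - ℓ (J ψ) - (L u - L w))
      =O[𝓝 w] fun u => ‖u - w‖ ^ 2 := by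
    refine Asymptotics.IsBigO.of_bound (‖ℓ‖ * K) ?_
    filter_upwards [Metric.closedBall_mem_nhds w one_pos] with u hu
    have hv : ‖u - w‖ ≤ 1 := by simpa [dist_eq_norm] using hu
    have htrans : SchwartzMap.compSubConstCLM ℂ u φ = SchwartzMap.compSubConstCLM ℂ (u - w) ψ := by
      rw [hψdef, SchwartzMap.compSubConstCLM_comp, add_sub_cancel]
    have e : ℓ (J (SchwartzMap.compSubConstCLM ℂ u φ)) - ℓ (J ψ) - (L u - L w) =
        ℓ (J (SchwartzMap.compSubConstCLM ℂ (u - w) ψ - ψ + ∂_{u - w} ψ)) := by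
      rw [← map_sub L, hL, htrans, sub_neg_eq_add, map_add, map_add, map_sub, map_sub]
    rw [e, Real.norm_of_nonneg (sq_nonneg _), mul_assoc]
    exact (ℓ.le_opNorm _).trans (mul_le_mul_of_nonneg_left (hK _ hv) (norm_nonneg _))
  have h0 : HasFDerivAt (𝕜 := ℝ)
      (fun u => ℓ (J (SchwartzMap.compSubConstCLM ℂ u φ)) - ℓ (J ψ) - (L u - L w))
      (0 : ℂ →L[ℝ] ℂ) w := hO.hasFDerivAt one_lt_two
  have h2 := (h0.add (L.hasFDerivAt (x := w))).add_const (ℓ (J ψ) - L w)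
  rw [zero_add] at h2
  refine h2.congr_of_eventuallyEq (Eventually.of_forall fun u => ?_)
  change ℓ (J (SchwartzMap.compSubConstCLM ℂ u φ)) =
    ℓ (J (SchwartzMap.compSubConstCLM ℂ u φ)) - ℓ (J ψ) - (L u - L w) + L u + (ℓ (J ψ) - L w)
  ring

theorem norm_toLp_translate {p : ℝ≥0∞} (φ : 𝓢(ℂ, ℂ)) (w : ℂ) :
    ‖(SchwartzMap.compSubConstCLM ℂ w φ).toLp p volume‖ = ‖φ.toLp p volume‖ := by
  rw [SchwartzMap.norm_toLp, SchwartzMap.norm_toLp]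
  congr 1
  exact eLpNorm_comp_measurePreserving φ.continuous.aestronglyMeasurable
    (measurePreserving_sub_right volume w)

theorem enorm_sum_rpow_of_subsingleton {ι : Type*} (s : Finset ι) (a : ι → ℂ) {r : ℝ} (hr : 0 < r)
    (h : ∀ i ∈ s, ∀ j ∈ s, a i ≠ 0 → a j ≠ 0 → i = j) :
    ‖∑ i ∈ s, a i‖ₑ ^ r = ∑ i ∈ s, ‖a i‖ₑ ^ r := by
  by_cases h0 : ∃ i ∈ s, a i ≠ 0
  · obtain ⟨i, hi, hai⟩ := h0
    have h1 : ∀ j ∈ s, j ≠ i → a j = 0 := fun j hj hji => by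
      by_contra haj
      exact hji (h j hj i hi haj hai)
    rw [Finset.sum_eq_single_of_mem i hi h1,
      Finset.sum_eq_single_of_mem i hi fun j hj hji => by simp [h1 j hj hji, hr]]
  · push Not at h0
    rw [Finset.sum_eq_zero h0, Finset.sum_eq_zero fun i hi => by simp [h0 i hi, hr]]
    simp [hr]

theorem norm_sum_translate_le {p : ℝ≥0∞} [Fact (1 ≤ p)] (hp_top : p ≠ ∞)
    {φ : 𝓢(ℂ, ℂ)} (hφ : HasCompactSupport φ) {v : ℂ} (hv : v ≠ 0) : ∃ t : ℝ, ∀ N : ℕ,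
      ‖∑ k ∈ Finset.range N, (SchwartzMap.compSubConstCLM ℂ ((k * t : ℝ) • v) φ).toLp p volume‖ ≤
        (N : ℝ) ^ (1 / p.toReal) * ‖φ.toLp p volume‖ := by
  obtain ⟨R, hR0, hR⟩ : ∃ R, 0 < R ∧ ∀ z, R < ‖z‖ → φ z = 0 := by
    obtain ⟨R, hR⟩ := hφ.isCompact.isBounded.subset_closedBall (0 : ℂ)
    refine ⟨max R 1, by positivity, fun z hz => image_eq_zero_of_notMem_tsupport fun h => ?_⟩
    have := hR h
    rw [mem_closedBall_zero_iff] at this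
    exact absurd (this.trans (le_max_left _ _)) (not_le.2 hz)
  have hv0 : 0 < ‖v‖ := norm_pos_iff.2 hv
  have hp0 : p ≠ 0 := (zero_lt_one.trans_le Fact.out).ne'
  have hpr : 0 < p.toReal := ENNReal.toReal_pos hp0 hp_top
  -- Consecutive translates are `3R` apart, more than the diameter `2R` of a ball containing the
  -- support, so at each point at most one of them is nonzero and the `p`-th powers of the norms
  -- add.
  set t := 3 * R / ‖v‖ with ht
  refine ⟨t, fun N => ?_⟩
  set J := SchwartzMap.toLpCLM ℂ ℂ p (volume : Measure ℂ) with hJ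
  set τ : ℕ → 𝓢(ℂ, ℂ) := fun k => SchwartzMap.compSubConstCLM ℂ ((k * t : ℝ) • v) φ with hτ
  have e : ∑ k ∈ Finset.range N, (τ k).toLp p volume = J (∑ k ∈ Finset.range N, τ k) :=
    (map_sum J _ _).symm
  have hfar : ∀ z : ℂ, ∀ i j : ℕ, τ i z ≠ 0 → τ j z ≠ 0 → i = j := by
    intro z i j hi hj
    by_contra hij
    have h1 : ‖z - (i * t : ℝ) • v‖ ≤ R := by
      by_contra h; exact hi (hR _ (not_le.1 h))
    have h2 : ‖z - (j * t : ℝ) • v‖ ≤ R := by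
      by_contra h; exact hj (hR _ (not_le.1 h))
    have h3 : ‖((i * t - j * t : ℝ)) • v‖ ≤ 2 * R := by
      have e1 : ((i * t - j * t : ℝ)) • v = (z - (j * t : ℝ) • v) - (z - (i * t : ℝ) • v) := by
        rw [sub_smul]; abel
      rw [e1]
      exact (norm_sub_le _ _).trans (by linarith)
    rw [norm_smul, ← sub_mul, norm_mul, Real.norm_of_nonneg (show 0 ≤ t by positivity), mul_assoc,
      show t * ‖v‖ = 3 * R by rw [ht]; field_simp] at h3
    have h4 : (1 : ℝ) ≤ ‖(i - j : ℝ)‖ := by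
      have : (1 : ℤ) ≤ |(i : ℤ) - j| := Int.one_le_abs (sub_ne_zero.2 (by exact_mod_cast hij))
      rw [Real.norm_eq_abs]
      exact_mod_cast this
    nlinarith
  have hsum : ∀ z, (∑ k ∈ Finset.range N, τ k) z = ∑ k ∈ Finset.range N, τ k z := fun z => by
    simp
  have hint : ∫⁻ z, ‖(∑ k ∈ Finset.range N, τ k) z‖ₑ ^ p.toReal =
      N * ∫⁻ z, ‖φ z‖ₑ ^ p.toReal := by
    have h1 : ∀ z, ‖(∑ k ∈ Finset.range N, τ k) z‖ₑ ^ p.toReal =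
        ∑ k ∈ Finset.range N, ‖τ k z‖ₑ ^ p.toReal := fun z => by
      rw [hsum]
      exact enorm_sum_rpow_of_subsingleton _ _ hpr fun i _ j _ => hfar z i j
    simp_rw [h1]
    rw [lintegral_finsetSum]
    · have h2 : ∀ k ∈ Finset.range N, ∫⁻ z, ‖τ k z‖ₑ ^ p.toReal = ∫⁻ z, ‖φ z‖ₑ ^ p.toReal :=
        fun k _ => lintegral_sub_right_eq_self (fun z => ‖φ z‖ₑ ^ p.toReal) _
      rw [Finset.sum_congr rfl h2, Finset.sum_const, Finset.card_range, nsmul_eq_mul]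
    · intro k _
      have := (τ k).continuous.measurable
      fun_prop
  rw [e]
  have hn1 : ‖J (∑ k ∈ Finset.range N, τ k)‖ =
      (eLpNorm (∑ k ∈ Finset.range N, τ k : 𝓢(ℂ, ℂ)) p volume).toReal := SchwartzMap.norm_toLp
  rw [hn1, SchwartzMap.norm_toLp, eLpNorm_eq_lintegral_rpow_enorm_toReal hp0 hp_top,
    eLpNorm_eq_lintegral_rpow_enorm_toReal hp0 hp_top, hint,
    ENNReal.mul_rpow_of_nonneg _ _ (by positivity), ENNReal.toReal_mul, ← ENNReal.toReal_rpow,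
    ENNReal.toReal_natCast]

/-- Summing over `N` translates gives `N |c| ≤ ‖ℓ‖ N^(1/p) ‖φ‖`, which forces `c = 0` because `p >
1`. For `p = 1` the integral is a counterexample. -/
theorem apply_eq_zero_of_apply_translate_eq {p : ℝ≥0∞} [Fact (1 ≤ p)]
    (hp : 1 < p) (hp_top : p ≠ ∞)
    (ℓ : Lp ℂ p (volume : Measure ℂ) →L[ℂ] ℂ)
    {φ : 𝓢(ℂ, ℂ)} (hφ : HasCompactSupport φ) {v : ℂ} (hv : v ≠ 0)
    (h : ∀ t : ℝ, ℓ ((SchwartzMap.compSubConstCLM ℂ (t • v) φ).toLp p volume) =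
      ℓ (φ.toLp p volume)) : ℓ (φ.toLp p volume) = 0 := by
  obtain ⟨t, ht⟩ := norm_sum_translate_le (p := p) hp_top hφ hv
  set c := ℓ (φ.toLp p volume) with hc
  by_contra hc0
  have hp1 : 1 < p.toReal := by
    rw [← ENNReal.toReal_one]
    exact (ENNReal.toReal_lt_toReal ENNReal.one_ne_top hp_top).2 hp
  have hbd : ∀ N : ℕ, (N : ℝ) * ‖c‖ ≤ ‖ℓ‖ * ((N : ℝ) ^ (1 / p.toReal) * ‖φ.toLp p volume‖) := by
    intro N
    have h1 := (ℓ.le_opNorm _).trans (mul_le_mul_of_nonneg_left (ht N) (norm_nonneg ℓ))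
    rw [map_sum] at h1
    simp only [h] at h1
    rwa [Finset.sum_const, Finset.card_range, nsmul_eq_mul, norm_mul, Complex.norm_natCast] at h1
  have hlim : Tendsto (fun N : ℕ => (N : ℝ) ^ (1 - 1 / p.toReal)) atTop atTop := by
    refine (tendsto_rpow_atTop ?_).comp tendsto_natCast_atTop_atTop
    rw [sub_pos, div_lt_one (by linarith)]
    exact hp1
  obtain ⟨N, hN, hN1⟩ := ((hlim.eventually_gt_atTop (‖ℓ‖ * ‖φ.toLp p volume‖ / ‖c‖)).and
    (eventually_ge_atTop 1)).exists
  have hNpos : (0 : ℝ) < N := by exact_mod_cast hN1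
  have hcpos : 0 < ‖c‖ := norm_pos_iff.2 hc0
  rw [Real.rpow_sub hNpos, Real.rpow_one, div_lt_div_iff₀ hcpos (by positivity)] at hN
  have := hbd N
  nlinarith

theorem ContinuousLinearMap.apply_eq_re_add_im (L : ℂ →L[ℝ] ℂ) (v : ℂ) :
    L v = v.re * L 1 + v.im * L Complex.I := by
  have h : v = v.re • (1 : ℂ) + v.im • Complex.I := by
    simp [Complex.re_add_im]
  conv_lhs => rw [h]
  rw [map_add, map_smul, map_smul, Complex.real_smul, Complex.real_smul]

theorem isBounded_range_apply_translate {p : ℝ≥0∞} [Fact (1 ≤ p)]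
    (ℓ : Lp ℂ p (volume : Measure ℂ) →L[ℂ] ℂ) (φ : 𝓢(ℂ, ℂ)) : Bornology.IsBounded
      (Set.range fun u => ℓ ((SchwartzMap.compSubConstCLM ℂ u φ).toLp p volume)) := by
  refine (isBounded_iff_forall_norm_le).2 ⟨‖ℓ‖ * ‖φ.toLp p volume‖, ?_⟩
  rintro _ ⟨u, rfl⟩
  rw [← norm_toLp_translate φ u]
  exact ℓ.le_opNorm _

open LineDeriv

theorem apply_eq_zero_of_apply_lineDerivOp_eq_zero {p : ℝ≥0∞} [Fact (1 ≤ p)]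
    (hp : 1 < p) (hp_top : p ≠ ∞) (ℓ : Lp ℂ p (volume : Measure ℂ) →L[ℂ] ℂ)
    {φ : 𝓢(ℂ, ℂ)} (hφ : HasCompactSupport φ) {v : ℂ} (hv : v ≠ 0)
    (h : ∀ w, ℓ ((∂_{v} (SchwartzMap.compSubConstCLM ℂ w φ)).toLp p volume) = 0) :
    ℓ (φ.toLp p volume) = 0 := by
  refine apply_eq_zero_of_apply_translate_eq hp hp_top ℓ hφ hv fun t => ?_
  have hd : ∀ t : ℝ, HasDerivAt
      (fun t : ℝ => ℓ ((SchwartzMap.compSubConstCLM ℂ (t • v) φ).toLp p volume)) 0 t := by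
    intro t
    obtain ⟨L, hL, hd⟩ := hasFDerivAt_apply_translate hp_top ℓ hφ (t • v)
    have h1 : HasDerivAt (fun t : ℝ => t • v) v t := by
      simpa using (hasDerivAt_id t).smul_const v
    have h2 := hd.comp_hasDerivAt t h1
    rwa [hL, h, neg_zero] at h2
  have := is_const_of_deriv_eq_zero (fun t => (hd t).differentiableAt) (fun t => (hd t).deriv) t 0
  simpa only [zero_smul, SchwartzMap.compSubConstCLM_zero, ContinuousLinearMap.id_apply] using this

/-- The hypothesis is the Cauchy-Riemann equation for `u ↦ ℓ(φ(· - u))`. This function is bounded,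
so by Liouville's theorem it is constant, and the previous argument on translates applies. -/
theorem apply_eq_zero_of_apply_wirtingerBar_eq_zero {p : ℝ≥0∞} [Fact (1 ≤ p)]
    (hp : 1 < p) (hp_top : p ≠ ∞) (ℓ : Lp ℂ p (volume : Measure ℂ) →L[ℂ] ℂ)
    {φ : 𝓢(ℂ, ℂ)} (hφ : HasCompactSupport φ)
    (h : ∀ w, ℓ ((wirtingerBar (SchwartzMap.compSubConstCLM ℂ w φ)).toLp p volume) = 0) :
    ℓ (φ.toLp p volume) = 0 := by
  refine apply_eq_zero_of_apply_translate_eq hp hp_top ℓ hφ one_ne_zero fun t => ?_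
  set H : ℂ → ℂ := fun u => ℓ ((SchwartzMap.compSubConstCLM ℂ u φ).toLp p volume) with hH
  have hdiff : Differentiable ℂ H := by
    intro w
    obtain ⟨L, hL, hd⟩ := hasFDerivAt_apply_translate hp_top ℓ hφ w
    set J := SchwartzMap.toLpCLM ℂ ℂ p (volume : Measure ℂ)
    set ψ := SchwartzMap.compSubConstCLM ℂ w φ
    have h1 : ℓ (J (∂_{(1 : ℂ)} ψ)) + Complex.I * ℓ (J (∂_{Complex.I} ψ)) = 0 := by
      have := h w
      rw [← smul_eq_mul, ← map_smul, ← map_smul, ← map_add, ← map_add]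
      exact this
    have hL1 : L 1 = -ℓ (J (∂_{(1 : ℂ)} ψ)) := hL 1
    have hLI : L Complex.I = -ℓ (J (∂_{Complex.I} ψ)) := hL Complex.I
    have h2 : L Complex.I = Complex.I * L 1 := by
      rw [hL1, hLI]
      linear_combination Complex.I * h1 - ℓ (J (∂_{Complex.I} ψ)) * Complex.I_mul_I
    have h3 : (ContinuousLinearMap.toSpanSingleton ℂ (L 1)).restrictScalars ℝ = L := by
      ext v
      change v * L 1 = L v
      rw [L.apply_eq_re_add_im v, h2]
      linear_combination (-(L 1)) * Complex.re_add_im v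
    exact (hasFDerivAt_of_restrictScalars ℝ hd h3).differentiableAt
  have := hdiff.apply_eq_apply_of_bounded (isBounded_range_apply_translate ℓ φ) (t • 1) 0
  simpa only [hH, SchwartzMap.compSubConstCLM_zero, ContinuousLinearMap.id_apply] using this

/-- Here the function of the translation vector is antiholomorphic; composing it with conjugation
brings back Liouville's theorem. -/
theorem apply_eq_zero_of_apply_wirtinger_eq_zero {p : ℝ≥0∞} [Fact (1 ≤ p)]
    (hp : 1 < p) (hp_top : p ≠ ∞) (ℓ : Lp ℂ p (volume : Measure ℂ) →L[ℂ] ℂ)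
    {φ : 𝓢(ℂ, ℂ)} (hφ : HasCompactSupport φ)
    (h : ∀ w, ℓ ((wirtinger (SchwartzMap.compSubConstCLM ℂ w φ)).toLp p volume) = 0) :
    ℓ (φ.toLp p volume) = 0 := by
  refine apply_eq_zero_of_apply_translate_eq hp hp_top ℓ hφ one_ne_zero fun t => ?_
  set H : ℂ → ℂ := fun u => ℓ ((SchwartzMap.compSubConstCLM ℂ u φ).toLp p volume) with hH
  have hdiff : Differentiable ℂ fun u => H (Complex.conjCLE u) := by
    intro w
    obtain ⟨L, hL, hd⟩ := hasFDerivAt_apply_translate hp_top ℓ hφ (Complex.conjCLE w)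
    set J := SchwartzMap.toLpCLM ℂ ℂ p (volume : Measure ℂ)
    set ψ := SchwartzMap.compSubConstCLM ℂ (Complex.conjCLE w) φ
    have h1 : ℓ (J (∂_{(1 : ℂ)} ψ)) - Complex.I * ℓ (J (∂_{Complex.I} ψ)) = 0 := by
      have := h (Complex.conjCLE w)
      rw [← smul_eq_mul, ← map_smul, ← map_smul, ← map_sub, ← map_sub]
      exact this
    have hL1 : L 1 = -ℓ (J (∂_{(1 : ℂ)} ψ)) := hL 1
    have hLI : L Complex.I = -ℓ (J (∂_{Complex.I} ψ)) := hL Complex.I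
    have h2 : L Complex.I = -(Complex.I * L 1) := by
      rw [hL1, hLI]
      linear_combination (-Complex.I) * h1 - ℓ (J (∂_{Complex.I} ψ)) * Complex.I_mul_I
    have hd2 : HasFDerivAt (fun u => H (Complex.conjCLE u))
        (L.comp (Complex.conjCLE : ℂ →L[ℝ] ℂ)) w :=
      hd.comp w Complex.conjCLE.hasFDerivAt
    have h3 : (ContinuousLinearMap.toSpanSingleton ℂ (L 1)).restrictScalars ℝ = L.comp (Complex.conjCLE : ℂ →L[ℝ] ℂ) := by
      ext v
      change v * L 1 = L ((starRingEnd ℂ) v)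
      rw [L.apply_eq_re_add_im ((starRingEnd ℂ) v), Complex.conj_re, Complex.conj_im, Complex.ofReal_neg, h2]
      linear_combination (-(L 1)) * Complex.re_add_im v
    exact (hasFDerivAt_of_restrictScalars ℝ hd2 h3).differentiableAt
  have hb : Bornology.IsBounded (Set.range fun u => H (Complex.conjCLE u)) :=
    (isBounded_range_apply_translate ℓ φ).subset 
      (Set.range_comp_subset_range Complex.conjCLE H)
  have := hdiff.apply_eq_apply_of_bounded hb (t • 1) 0
  simpa [hH] using this

/-! ### Density of derivatives in `L^p` -/

theorem ContinuousLinearMap.eq_zero_of_forall_hasCompactSupport {p : ℝ≥0∞} [Fact (1 ≤ p)]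
    (hp_top : p ≠ ∞) {ℓ : Lp ℂ p (volume : Measure ℂ) →L[ℂ] ℂ}
    (h : ∀ φ : 𝓢(ℂ, ℂ), HasCompactSupport φ → ℓ (φ.toLp p volume) = 0) : ℓ = 0 := by
  refine DFunLike.coe_injective (Continuous.ext_on
    (Lp.dense_hasCompactSupport_contDiff (F := ℂ) (μ := (volume : Measure ℂ)) hp_top)
    ℓ.continuous continuous_zero ?_)
  rintro f ⟨g, hfg, hg, hg'⟩
  have e : f = (hg.toSchwartzMap hg').toLp p volume :=
    Lp.ext (hfg.trans (SchwartzMap.coeFn_toLp (hg.toSchwartzMap hg') p volume).symm)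
  rw [e]
  exact h _ hg

theorem ContinuousLinearMap.eq_of_forall_dual {X Y : Type*} [NormedAddCommGroup X]
    [NormedSpace ℂ X] [NormedAddCommGroup Y] [NormedSpace ℂ Y] {S T : Y →L[ℂ] X}
    (h : ∀ g : X →L[ℂ] ℂ, g.comp (S - T) = 0) : S = T := by
  ext y
  rw [← sub_eq_zero]
  exact SeparatingDual.eq_zero_of_forall_dual_eq_zero (R := ℂ) fun g => DFunLike.congr_fun (h g) y

/-- Hahn-Banach in the quotient by the closure of the range: every functional composed with the
quotient map kills the range, hence is zero, hence so is the quotient map. -/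
theorem ContinuousLinearMap.denseRange_of_forall_dual {X Y : Type*} [NormedAddCommGroup X]
    [NormedSpace ℂ X] [NormedAddCommGroup Y] [NormedSpace ℂ Y] {R : Y →L[ℂ] X}
    (h : ∀ ℓ : X →L[ℂ] ℂ, (∀ y, ℓ (R y) = 0) → ℓ = 0) : DenseRange R := by
  set K := (LinearMap.range (R : Y →ₗ[ℂ] X)).topologicalClosure with hK
  have : IsClosed (K : Set X) := Submodule.isClosed_topologicalClosure _
  have hmem : ∀ y, R y ∈ K := fun y => Submodule.le_topologicalClosure _ ⟨y, rfl⟩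
  have h0 : K.mkQL = 0 := ContinuousLinearMap.eq_of_forall_dual fun g => by
    rw [sub_zero]
    refine h _ fun y => ?_
    have : K.mkQL (R y) = 0 := (Submodule.Quotient.mk_eq_zero K).2 (hmem y)
    rw [ContinuousLinearMap.comp_apply, this, map_zero]
  intro x
  have hx : x ∈ K := (Submodule.Quotient.mk_eq_zero K).1 (DFunLike.congr_fun h0 x)
  exact hx

theorem HasCompactSupport.lineDerivOp {φ : 𝓢(ℂ, ℂ)} (hφ : HasCompactSupport φ) (v : ℂ) :
    HasCompactSupport (∂_{v} φ : 𝓢(ℂ, ℂ)) :=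
  hφ.of_isClosed_subset (isClosed_tsupport _) (SchwartzMap.tsupport_lineDerivOp_subset v φ)

theorem HasCompactSupport.wirtingerBar {φ : 𝓢(ℂ, ℂ)} (hφ : HasCompactSupport φ) :
    HasCompactSupport (wirtingerBar φ) := by
  have h2 : HasCompactSupport fun z => Complex.I * (∂_{Complex.I} φ : 𝓢(ℂ, ℂ)) z :=
    (hφ.lineDerivOp Complex.I).mul_left
  exact (hφ.lineDerivOp 1).add h2

theorem HasCompactSupport.wirtinger {φ : 𝓢(ℂ, ℂ)} (hφ : HasCompactSupport φ) :
    HasCompactSupport (wirtinger φ) := by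
  have h2 : HasCompactSupport fun z => Complex.I * (∂_{Complex.I} φ : 𝓢(ℂ, ℂ)) z :=
    (hφ.lineDerivOp Complex.I).mul_left
  exact (hφ.lineDerivOp 1).sub h2

theorem lineDerivOp_translate (φ : 𝓢(ℂ, ℂ)) (v w : ℂ) :
    ∂_{v} (SchwartzMap.compSubConstCLM ℂ w φ) = SchwartzMap.compSubConstCLM ℂ w (∂_{v} φ) := by
  ext z
  rw [SchwartzMap.lineDerivOp_apply_eq_fderiv, SchwartzMap.compSubConstCLM_apply,
    SchwartzMap.lineDerivOp_apply_eq_fderiv]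
  have : (SchwartzMap.compSubConstCLM ℂ w φ : ℂ → ℂ) = fun z => φ (z - w) := rfl
  rw [this, fderiv_comp_sub]

theorem wirtingerBar_translate (φ : 𝓢(ℂ, ℂ)) (w : ℂ) :
    wirtingerBar (SchwartzMap.compSubConstCLM ℂ w φ) =
      SchwartzMap.compSubConstCLM ℂ w (wirtingerBar φ) := by
  simp only [wirtingerBar, LinearMap.coe_mk, AddHom.coe_mk, lineDerivOp_translate, map_add, map_smul]

theorem wirtinger_translate (φ : 𝓢(ℂ, ℂ)) (w : ℂ) :
    wirtinger (SchwartzMap.compSubConstCLM ℂ w φ) =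
      SchwartzMap.compSubConstCLM ℂ w (wirtinger φ) := by
  simp only [wirtinger, LinearMap.coe_mk, AddHom.coe_mk, lineDerivOp_translate, map_sub, map_smul]

/-- Removes one `D` at a time: `D^[n] φ` again has compact support and its translates are of the
same form, so `hstep` applies to it. -/
theorem eq_zero_of_forall_apply_iterate {p : ℝ≥0∞} [Fact (1 ≤ p)] (hp_top : p ≠ ∞)
    {D : 𝓢(ℂ, ℂ) →ₗ[ℂ] 𝓢(ℂ, ℂ)} (hsupp : ∀ φ : 𝓢(ℂ, ℂ), HasCompactSupport φ → HasCompactSupport (D φ))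
    (hcomm : ∀ (φ : 𝓢(ℂ, ℂ)) w, D (SchwartzMap.compSubConstCLM ℂ w φ) = SchwartzMap.compSubConstCLM ℂ w (D φ))
    (hstep : ∀ (ℓ : Lp ℂ p (volume : Measure ℂ) →L[ℂ] ℂ) (φ : 𝓢(ℂ, ℂ)), HasCompactSupport φ →
      (∀ w, ℓ ((D (SchwartzMap.compSubConstCLM ℂ w φ)).toLp p volume) = 0) →
        ℓ (φ.toLp p volume) = 0)
    {n : ℕ} {ℓ : Lp ℂ p (volume : Measure ℂ) →L[ℂ] ℂ}
    (h : ∀ φ : 𝓢(ℂ, ℂ), HasCompactSupport φ → ℓ ((D^[n] φ).toLp p volume) = 0) : ℓ = 0 := by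
  induction n with
  | zero => exact ContinuousLinearMap.eq_zero_of_forall_hasCompactSupport hp_top h
  | succ n ih =>
    refine ih fun φ hφ => hstep ℓ _ ?_ fun w => ?_
    · clear ih h
      induction n with
      | zero => exact hφ
      | succ n ih => rw [Function.iterate_succ_apply']; exact hsupp _ ih
    · have hc : Function.Commute D (SchwartzMap.compSubConstCLM ℂ w) := fun φ => hcomm φ w
      rw [← (hc.iterate_left n) φ, ← Function.iterate_succ_apply' D]
      exact h _ (hφ.comp_homeomorph (Homeomorph.subRight w))

theorem ContinuousLinearMap.eq_of_forall_wirtingerBar_iterate {p : ℝ≥0∞} [Fact (1 ≤ p)]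
    (hp : 1 < p) (hp_top : p ≠ ∞) {X : Type*} [NormedAddCommGroup X] [NormedSpace ℂ X]
    {S T : Lp ℂ p (volume : Measure ℂ) →L[ℂ] X} (n : ℕ)
    (h : ∀ φ : 𝓢(ℂ, ℂ), S ((wirtingerBar^[n] φ).toLp p volume) =
      T ((wirtingerBar^[n] φ).toLp p volume)) : S = T :=
  eq_of_forall_dual fun g => eq_zero_of_forall_apply_iterate hp_top (D := wirtingerBar) (n := n)
    (fun _ hφ => hφ.wirtingerBar) wirtingerBar_translate
    (fun ℓ _ hφ => apply_eq_zero_of_apply_wirtingerBar_eq_zero hp hp_top ℓ hφ)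
    fun φ _ => by rw [comp_apply, sub_apply, h, sub_self, map_zero]

theorem ContinuousLinearMap.eq_of_forall_wirtinger_iterate {p : ℝ≥0∞} [Fact (1 ≤ p)]
    (hp : 1 < p) (hp_top : p ≠ ∞) {X : Type*} [NormedAddCommGroup X] [NormedSpace ℂ X]
    {S T : Lp ℂ p (volume : Measure ℂ) →L[ℂ] X} (n : ℕ)
    (h : ∀ φ : 𝓢(ℂ, ℂ), S ((wirtinger^[n] φ).toLp p volume) =
      T ((wirtinger^[n] φ).toLp p volume)) : S = T :=
  eq_of_forall_dual fun g => eq_zero_of_forall_apply_iterate hp_top (D := wirtinger) (n := n)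
    (fun _ hφ => hφ.wirtinger) wirtinger_translate
    (fun ℓ _ hφ => apply_eq_zero_of_apply_wirtinger_eq_zero hp hp_top ℓ hφ)
    fun φ _ => by rw [comp_apply, sub_apply, h, sub_self, map_zero]

theorem eq_zero_of_forall_apply_lineDerivOp {p : ℝ≥0∞} [Fact (1 ≤ p)]
    (hp : 1 < p) (hp_top : p ≠ ∞) {ℓ : Lp ℂ p (volume : Measure ℂ) →L[ℂ] ℂ} {v : ℂ} (hv : v ≠ 0)
    (h : ∀ φ : 𝓢(ℂ, ℂ), ℓ ((∂_{v} φ).toLp p volume) = 0) : ℓ = 0 :=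
  ContinuousLinearMap.eq_zero_of_forall_hasCompactSupport hp_top fun _ hφ =>
    apply_eq_zero_of_apply_lineDerivOp_eq_zero hp hp_top ℓ hφ hv fun _ => h _

/-! ### Powers of the transform and the inclusion of the spectrum in the circle -/

theorem commute_wirtingerBar_wirtinger : Function.Commute wirtingerBar wirtinger := by
  intro f
  have h : 𝓕 (wirtingerBar (wirtinger f)) = 𝓕 (wirtinger (wirtingerBar f)) := by
    ext ξ
    rw [fourier_wirtingerBar_apply, fourier_wirtinger_apply, fourier_wirtinger_apply,
      fourier_wirtingerBar_apply]
    ring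
  have h2 := congrArg (fun g : 𝓢(ℂ, ℂ) => (𝓕⁻ g : 𝓢(ℂ, ℂ))) h
  simpa only [FourierTransform.fourierInv_fourier_eq] using h2

/-- Each application of `A` trades one `D` for an `E`, which is moved inside past the remaining
`D`s. -/
theorem pow_apply_iterate {p : ℝ≥0∞} [Fact (1 ≤ p)]
    {A : Lp ℂ p (volume : Measure ℂ) →L[ℂ] Lp ℂ p (volume : Measure ℂ)} {D E : 𝓢(ℂ, ℂ) → 𝓢(ℂ, ℂ)}
    (hA : ∀ f, A ((D f).toLp p volume) = (E f).toLp p volume) (hc : Function.Commute D E) (n : ℕ)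
    (f : 𝓢(ℂ, ℂ)) : (A ^ n) ((D^[n] f).toLp p volume) = (E^[n] f).toLp p volume := by
  induction n generalizing f with
  | zero => simp
  | succ n ih =>
    rw [pow_succ, mul_apply_eq_comp, Function.iterate_succ_apply', hA,
      ← (hc.iterate_left n) f, ih, ← Function.iterate_succ_apply]

/-- If the odd powers of `A` grow at most linearly, then the spectrum of `A` is contained in the
closed unit disc. -/
theorem norm_le_one_of_mem_spectrum {X : Type*} [NormedAddCommGroup X] [NormedSpace ℂ X]
    [CompleteSpace X] {A : X →L[ℂ] X} {C : ℝ} (hA : ∀ n : ℕ, Odd n → ‖A ^ n‖ ≤ C * n) {l : ℂ}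
    (hl : l ∈ spectrum ℂ A) : ‖l‖ ≤ 1 := by
  by_contra! hl1
  -- Powers of a spectral value are spectral values of the powers; geometric growth along odd
  -- exponents contradicts the linear bound.
  have hbd : ∀ k : ℕ, ‖l‖ ^ (2 * k + 1) ≤ C * (2 * k + 1 : ℕ) := by
    intro k
    have h1 := spectrum.norm_le_norm_mul_of_mem (spectrum.pow_mem_pow A (2 * k + 1) hl)
    rw [norm_pow] at h1
    refine h1.trans (le_trans ?_ (hA _ ⟨k, rfl⟩))
    exact mul_le_of_le_one_right (norm_nonneg _) ContinuousLinearMap.norm_id_le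
  have h2 : Tendsto (fun n : ℕ => C * ((n : ℝ) ^ 1 / ‖l‖ ^ n)) atTop (𝓝 (C * 0)) :=
    (tendsto_pow_const_div_const_pow_of_one_lt 1 hl1).const_mul C
  rw [mul_zero] at h2
  have h3 : Tendsto (fun k : ℕ => 2 * k + 1) atTop atTop :=
    tendsto_atTop_mono (fun k => by simp only [id]; omega) tendsto_id
  obtain ⟨k, hk⟩ := ((h2.comp h3).eventually (gt_mem_nhds one_pos)).exists
  have hpos : 0 < ‖l‖ ^ (2 * k + 1) := by positivity
  have hk' : C * ((2 * k + 1 : ℕ) : ℝ) < ‖l‖ ^ (2 * k + 1) := by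
    have h4 : C * (((2 * k + 1 : ℕ) : ℝ) ^ 1 / ‖l‖ ^ (2 * k + 1)) < 1 := hk
    rwa [pow_one, ← mul_div_assoc, div_lt_one hpos] at h4
  exact absurd (hbd k) (not_le.2 hk')

theorem toLp_eq_of_multiplierOperator_eq {p : ℝ≥0∞} {f : Lp ℂ p (volume : Measure ℂ)}
    {m : ℂ → ℂ} {g h : 𝓢(ℂ, ℂ)} (hf : f =ᵐ[volume] multiplierOperator m g)
    (hgh : multiplierOperator m g = h) : f = h.toLp p volume :=
  Lp.ext (by rw [hgh] at hf; exact hf.trans (h.coeFn_toLp p volume).symm)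

theorem IsAhlforsBeurling.apply_wirtingerBar {p : ℝ≥0∞} [Fact (1 ≤ p)]
    {T : Lp ℂ p (volume : Measure ℂ) →L[ℂ] Lp ℂ p (volume : Measure ℂ)}
    (hT : IsAhlforsBeurling p T) (f : 𝓢(ℂ, ℂ)) :
    T ((wirtingerBar f).toLp p volume) = (wirtinger f).toLp p volume := by
  refine toLp_eq_of_multiplierOperator_eq (isAhlforsBeurling_iff.1 hT _) ?_
  simpa using multiplierOperator_wirtingerBar_iterate 1 f

/-- The inverse is the multiplier operator for `n = -1`. Every identity between operators is checked
on iterated Wirtinger derivatives, which suffice by density; so odd powers of `T` and of its inverse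
are the multiplier operators already bounded. -/
theorem IsAhlforsBeurling.exists_pow_bound {p : ℝ≥0∞} [Fact (1 ≤ p)] (hp : 1 < p) (hp_top : p ≠ ∞)
    {T : Lp ℂ p (volume : Measure ℂ) →L[ℂ] Lp ℂ p (volume : Measure ℂ)}
    (hT : IsAhlforsBeurling p T) :
    ∃ (S : Lp ℂ p (volume : Measure ℂ) →L[ℂ] Lp ℂ p (volume : Measure ℂ)) (C : ℝ),
      S * T = 1 ∧ T * S = 1 ∧ (∀ n : ℕ, Odd n → ‖T ^ n‖ ≤ C * n) ∧
        ∀ n : ℕ, Odd n → ‖S ^ n‖ ≤ C * n := by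
  obtain ⟨C, A, hC, hA⟩ := exists_multiplierLp hp hp_top
  have hodd : Odd (-1 : ℤ) := odd_neg_one
  have hS : ∀ f, A (-1) ((wirtinger f).toLp p volume) = (wirtingerBar f).toLp p volume := fun f => by
    refine toLp_eq_of_multiplierOperator_eq ((hA (-1) hodd).2 _) ?_
    simpa using multiplierOperator_wirtinger_iterate 1 f
  refine ⟨A (-1), C, ?_, ?_, fun n hn => ?_, fun n hn => ?_⟩
  · refine ContinuousLinearMap.eq_of_forall_wirtingerBar_iterate hp hp_top 1 fun f => ?_
    rw [Function.iterate_one, mul_apply_eq_comp, hT.apply_wirtingerBar, hS]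
    rfl
  · refine ContinuousLinearMap.eq_of_forall_wirtinger_iterate hp hp_top 1 fun f => ?_
    rw [Function.iterate_one, mul_apply_eq_comp, hS, hT.apply_wirtingerBar]
    rfl
  · have hn' : Odd (n : ℤ) := by exact_mod_cast hn
    have e : T ^ n = A n := by
      refine ContinuousLinearMap.eq_of_forall_wirtingerBar_iterate hp hp_top n fun f => ?_
      rw [pow_apply_iterate hT.apply_wirtingerBar commute_wirtingerBar_wirtinger]
      exact (toLp_eq_of_multiplierOperator_eq ((hA n hn').2 _)
        (multiplierOperator_wirtingerBar_iterate n f)).symm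
    rw [e]
    refine (hA n hn').1.trans (le_of_eq ?_)
    simp
  · have hn' : Odd (-n : ℤ) := Odd.neg (by exact_mod_cast hn)
    have e : A (-1) ^ n = A (-n) := by
      refine ContinuousLinearMap.eq_of_forall_wirtinger_iterate hp hp_top n fun f => ?_
      rw [pow_apply_iterate hS fun f => (commute_wirtingerBar_wirtinger f).symm]
      exact (toLp_eq_of_multiplierOperator_eq ((hA (-n) hn').2 _)
        (multiplierOperator_wirtinger_iterate n f)).symm
    rw [e]
    refine (hA _ hn').1.trans (le_of_eq ?_)
    simp

theorem spectrum_subset_sphere_of_pow_bound {X : Type*} [NormedAddCommGroup X] [NormedSpace ℂ X]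
    [CompleteSpace X] (U : (X →L[ℂ] X)ˣ) {C : ℝ}
    (h1 : ∀ n : ℕ, Odd n → ‖(U : X →L[ℂ] X) ^ n‖ ≤ C * n)
    (h2 : ∀ n : ℕ, Odd n → ‖(↑U⁻¹ : X →L[ℂ] X) ^ n‖ ≤ C * n) :
    spectrum ℂ (U : X →L[ℂ] X) ⊆ Metric.sphere (0 : ℂ) 1 := by
  intro l hl
  have hl0 : l ≠ 0 := by
    rintro rfl
    exact spectrum.zero_notMem ℂ U.isUnit hl
  have hle := norm_le_one_of_mem_spectrum h1 hl
  lift l to ℂˣ using hl0.isUnit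
  have hge := norm_le_one_of_mem_spectrum h2 (spectrum.inv_mem_iff.1 hl)
  rw [Units.val_inv_eq_inv_val, norm_inv, inv_le_one₀ (norm_pos_iff.2 l.ne_zero)] at hge
  rw [mem_sphere_zero_iff_norm]
  exact le_antisymm hle hge

theorem IsAhlforsBeurling.spectrum_subset_sphere {p : ℝ≥0∞} [Fact (1 ≤ p)] (hp : 1 < p)
    (hp_top : p ≠ ∞) {T : Lp ℂ p (volume : Measure ℂ) →L[ℂ] Lp ℂ p (volume : Measure ℂ)}
    (hT : IsAhlforsBeurling p T) : spectrum ℂ T ⊆ Metric.sphere (0 : ℂ) 1 := by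
  obtain ⟨S, C, hST, hTS, h1, h2⟩ := hT.exists_pow_bound hp hp_top
  exact spectrum_subset_sphere_of_pow_bound ⟨T, S, hTS, hST⟩ h1 h2

/-! ### Dense range and trivial kernel on the circle -/

/-- Dividing by `μ`, the coefficients of the two partial derivatives become `conj μ - μ = -2i Im μ`
and `-i (conj μ + μ) = -2i Re μ`: a common factor times real numbers. -/
theorem wirtinger_sub_smul_wirtingerBar {μ : ℂ} (hμ : ‖μ‖ = 1) (f : 𝓢(ℂ, ℂ)) :
    wirtinger f - μ ^ 2 • wirtingerBar f =
      (-(2 * Complex.I * μ)) • ∂_{(μ.im + μ.re * Complex.I : ℂ)} f := by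
  have hv : (μ.im + μ.re * Complex.I : ℂ) = μ.im • (1 : ℂ) + μ.re • Complex.I := by simp
  have hn : (μ.re : ℂ) ^ 2 + (μ.im : ℂ) ^ 2 = 1 := by
    have h : μ.re ^ 2 + μ.im ^ 2 = 1 := by
      have := Complex.sq_norm μ
      rw [hμ, Complex.normSq_apply] at this
      linarith
    exact_mod_cast h
  have hre : μ = μ.re + μ.im * Complex.I := (Complex.re_add_im μ).symm
  have hI := Complex.I_sq
  rw [hv, lineDerivOp_left_add, lineDerivOp_left_smul, lineDerivOp_left_smul]
  ext z
  simp only [wirtinger, wirtingerBar, LinearMap.coe_mk, AddHom.coe_mk, sub_apply, add_apply,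
    smul_apply, smul_eq_mul, Complex.real_smul]
  generalize (∂_{(1 : ℂ)} f : 𝓢(ℂ, ℂ)) z = a
  generalize (∂_{Complex.I} f : 𝓢(ℂ, ℂ)) z = b
  generalize (μ.re : ℂ) = x at *
  generalize (μ.im : ℂ) = y at *
  subst hre
  linear_combination (a - Complex.I * b) * (-hn) + ((a - Complex.I * b) * y ^ 2) * hI

theorem exists_sq_eq_of_norm_eq_one {l : ℂ} (hl : ‖l‖ = 1) : ∃ μ : ℂ, ‖μ‖ = 1 ∧ μ ^ 2 = l := by
  obtain ⟨μ, hμ⟩ := IsAlgClosed.exists_pow_nat_eq l two_pos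
  refine ⟨μ, ?_, hμ⟩
  have : ‖μ‖ ^ 2 = 1 := by rw [← norm_pow, hμ, hl]
  exact (pow_eq_one_iff_of_nonneg (norm_nonneg _) two_ne_zero).1 this

theorem im_add_re_mul_I_ne_zero {μ : ℂ} (hμ : ‖μ‖ = 1) : (μ.im + μ.re * Complex.I : ℂ) ≠ 0 := by
  intro h
  have h1 : μ.im = 0 := by simpa using congrArg Complex.re h
  have h2 : μ.re = 0 := by simpa using congrArg Complex.im h
  have : μ = 0 := Complex.ext h2 h1
  simp [this] at hμ

/-- On Wirtinger derivatives `T - μ²` produces all derivatives in one real direction, and no nonzero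
functional kills all of those. -/
theorem IsAhlforsBeurling.denseRange_sub_smul {p : ℝ≥0∞} [Fact (1 ≤ p)] (hp : 1 < p)
    (hp_top : p ≠ ∞) {T : Lp ℂ p (volume : Measure ℂ) →L[ℂ] Lp ℂ p (volume : Measure ℂ)}
    (hT : IsAhlforsBeurling p T) {l : ℂ} (hl : ‖l‖ = 1) :
    DenseRange (T - l • ContinuousLinearMap.id ℂ (Lp ℂ p (volume : Measure ℂ))) := by
  obtain ⟨μ, hμ, rfl⟩ := exists_sq_eq_of_norm_eq_one hl
  have hc : -(2 * Complex.I * μ) ≠ 0 := by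
    have : μ ≠ 0 := norm_ne_zero_iff.1 (by rw [hμ]; exact one_ne_zero)
    simp [this]
  refine ContinuousLinearMap.denseRange_of_forall_dual fun ℓ hℓ => ?_
  refine eq_zero_of_forall_apply_lineDerivOp hp hp_top (im_add_re_mul_I_ne_zero hμ) fun f => ?_
  set J := SchwartzMap.toLpCLM ℂ ℂ p (volume : Measure ℂ) with hJ
  have h1 : (T - μ ^ 2 • ContinuousLinearMap.id ℂ (Lp ℂ p (volume : Measure ℂ)))
      (J (wirtingerBar f)) =
      (-(2 * Complex.I * μ)) • J (∂_{(μ.im + μ.re * Complex.I : ℂ)} f) := by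
    rw [← map_smul, ← wirtinger_sub_smul_wirtingerBar hμ, map_sub, map_smul]
    change T ((wirtingerBar f).toLp p volume) - μ ^ 2 • J (wirtingerBar f) = _
    rw [hT.apply_wirtingerBar]
    rfl
  have h2 := hℓ (J (wirtingerBar f))
  rw [h1, map_smul, smul_eq_mul] at h2
  exact (mul_eq_zero.1 h2).resolve_left hc

/-- The symbol is even, so `T` is symmetric for the pairing of `L^p` with `L^q`. For `x` in the
kernel the functional `P x` on `L^q` then kills all derivatives in one direction and vanishes; since
`1 < q < ∞`, the density argument applies there too. -/
theorem IsAhlforsBeurling.eq_zero_of_sub_smul_apply {p : ℝ≥0∞} [Fact (1 ≤ p)] (hp : 1 < p)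
    (hp_top : p ≠ ∞) {T : Lp ℂ p (volume : Measure ℂ) →L[ℂ] Lp ℂ p (volume : Measure ℂ)}
    (hT : IsAhlforsBeurling p T) {l : ℂ} (hl : ‖l‖ = 1) {x : Lp ℂ p (volume : Measure ℂ)}
    (hx : (T - l • ContinuousLinearMap.id ℂ (Lp ℂ p (volume : Measure ℂ))) x = 0) : x = 0 := by
  obtain ⟨μ, hμ, rfl⟩ := exists_sq_eq_of_norm_eq_one hl
  have hc : -(2 * Complex.I * μ) ≠ 0 := by
    have : μ ≠ 0 := norm_ne_zero_iff.1 (by rw [hμ]; exact one_ne_zero)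
    simp [this]
  set q := ENNReal.conjExponent p with hq
  have hpq : ENNReal.HolderConjugate p q := inferInstance
  have hq1 : 1 < q := (ENNReal.HolderConjugate.lt_top_iff_one_lt p q).1 hp_top.lt_top
  have hq_top : q ≠ ∞ := ((ENNReal.HolderConjugate.lt_top_iff_one_lt q p).2 hp).ne
  have : Fact (1 ≤ q) := ⟨hq1.le⟩
  set P := (ContinuousLinearMap.mul ℂ ℂ).lpPairing (volume : Measure ℂ) p q with hP
  have hPs : ∀ f g : 𝓢(ℂ, ℂ), P (f.toLp p volume) (g.toLp q volume) = ∫ z, f z * g z := by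
    intro f g
    rw [hP, ContinuousLinearMap.lpPairing_eq_integral]
    refine integral_congr_ae ?_
    filter_upwards [f.coeFn_toLp p volume, g.coeFn_toLp q volume] with z h1 h2
    rw [h1, h2, ContinuousLinearMap.mul_apply']
  have hadj : ∀ f : 𝓢(ℂ, ℂ), (P.flip ((wirtingerBar f).toLp q volume)).comp T =
      P.flip ((wirtinger f).toLp q volume) := by
    intro f
    refine ContinuousLinearMap.eq_of_forall_schwartz hp_top fun g => ?_
    rw [ContinuousLinearMap.comp_apply, ContinuousLinearMap.flip_apply,
      ContinuousLinearMap.flip_apply, hPs, hP, ContinuousLinearMap.lpPairing_eq_integral]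
    have hM : multiplierOperator (fun ξ => (starRingEnd ℂ) ξ / ξ) (wirtingerBar f) =
        wirtinger f := by
      simpa using multiplierOperator_wirtingerBar_iterate 1 f
    rw [← hM, ← integral_multiplierOperator_mul (by simpa using measurable_conj_div_zpow 1)
      (by simpa using norm_conj_div_zpow_le 1) (fun ξ => by rw [map_neg, neg_div_neg_eq])]
    refine integral_congr_ae ?_
    filter_upwards [isAhlforsBeurling_iff.1 hT g, (wirtingerBar f).coeFn_toLp q volume] with z h1 h2
    rw [h1, h2, ContinuousLinearMap.mul_apply']
  have hTx : T x = μ ^ 2 • x := sub_eq_zero.1 hx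
  have hzero : P x = 0 := by
    refine eq_zero_of_forall_apply_lineDerivOp hq1 hq_top (im_add_re_mul_I_ne_zero hμ) fun f => ?_
    set J := SchwartzMap.toLpCLM ℂ ℂ q (volume : Measure ℂ) with hJ
    have h1 : P (T x) (J (wirtingerBar f)) = P x (J (wirtinger f)) := DFunLike.congr_fun (hadj f) x
    have h2 : P x (J (wirtinger f - μ ^ 2 • wirtingerBar f)) = 0 := by
      rw [map_sub, map_sub, ← h1, hTx, map_smul, map_smul, map_smul]
      exact sub_self _
    rw [wirtinger_sub_smul_wirtingerBar hμ, map_smul, map_smul, smul_eq_mul] at h2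
    exact (mul_eq_zero.1 h2).resolve_left hc
  have hae : ∀ᵐ z : ℂ, x z = 0 := by
    refine ae_eq_zero_of_integral_contDiff_smul_eq_zero
      ((Lp.memLp x).locallyIntegrable Fact.out) fun g hg hg' => ?_
    set G : ℂ → ℂ := fun z => (g z : ℂ) with hG
    have hGs : HasCompactSupport G := hg'.comp_left Complex.ofReal_zero
    have hGd : ContDiff ℝ ((⊤ : ℕ∞) : WithTop ℕ∞) G := Complex.ofRealCLM.contDiff.comp hg
    have h3 : P x ((hGs.toSchwartzMap hGd).toLp q volume) = 0 := by rw [hzero]; rfl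
    rw [hP, ContinuousLinearMap.lpPairing_eq_integral] at h3
    rw [← h3]
    refine integral_congr_ae ?_
    filter_upwards [(hGs.toSchwartzMap hGd).coeFn_toLp q volume] with z hz
    rw [hz, ContinuousLinearMap.mul_apply', mul_comm]
    rfl
  have hae' : x =ᵐ[volume] (0 : ℂ → ℂ) := hae
  exact Lp.ext (hae'.trans (Lp.coeFn_zero ℂ p volume).symm)

/-! ### Rotation symmetry and the conclusion -/

theorem multiplierOperator_comp_rotation (u : Circle) (f : ℂ → ℂ) (z : ℂ) :
    multiplierOperator (fun ξ => (starRingEnd ℂ) ξ / ξ) (fun w => f (u * w)) z =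
      (u : ℂ) ^ 2 * multiplierOperator (fun ξ => (starRingEnd ℂ) ξ / ξ) f (u * z) := by
  have hu : (u : ℂ) ≠ 0 := u.coe_ne_zero
  have hconj : (u : ℂ) * (starRingEnd ℂ) (u : ℂ) = 1 := by
    rw [Complex.mul_conj, Circle.normSq_coe, Complex.ofReal_one]
  have e : (fun ξ : ℂ => (starRingEnd ℂ) ξ / ξ * 𝓕 (fun w => f (u * w)) ξ) =
      fun ξ => (fun η => (u : ℂ) ^ 2 * ((starRingEnd ℂ) η / η * 𝓕 f η)) (u * ξ) := by
    funext ξ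
    have h1 : 𝓕 (fun w => f (u * w)) ξ = 𝓕 f (u * ξ) :=
      Real.fourier_comp_linearIsometry (rotation u) f ξ
    have h2 : (starRingEnd ℂ) ξ / ξ = (u : ℂ) ^ 2 * ((starRingEnd ℂ) (u * ξ) / (u * ξ)) := by
      rcases eq_or_ne ξ 0 with rfl | hξ
      · simp
      · rw [map_mul]
        field_simp
        linear_combination (-(starRingEnd ℂ) ξ) * hconj
    simp only [h1]
    rw [h2]
    ring
  rw [multiplierOperator, e]
  refine (fourierInv_comp_rotation
    (fun η => (u : ℂ) ^ 2 * ((starRingEnd ℂ) η / η * 𝓕 f η)) u z).trans ?_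
  rw [multiplierOperator, Real.fourierInv_eq',
    Real.fourierInv_eq', ← integral_const_mul]
  refine integral_congr_ae (Eventually.of_forall fun ξ => ?_)
  simp only [smul_eq_mul]
  ring

/-- The symbol is multiplied by a character under rotation, so `T` is similar to `u² T`. -/
theorem IsAhlforsBeurling.sq_mul_mem_spectrum {p : ℝ≥0∞} [Fact (1 ≤ p)]
    (hp_top : p ≠ ∞) {T : Lp ℂ p (volume : Measure ℂ) →L[ℂ] Lp ℂ p (volume : Measure ℂ)}
    (hT : IsAhlforsBeurling p T) (u : Circle) {l : ℂ} (hl : l ∈ spectrum ℂ T) :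
    (u : ℂ) ^ 2 * l ∈ spectrum ℂ T := by
  let R : Circle → Lp ℂ p (volume : Measure ℂ) →L[ℂ] Lp ℂ p (volume : Measure ℂ) := fun u =>
    (Lp.compMeasurePreservingₗᵢ ℂ (rotation u)
      (rotation u).measurePreserving).toContinuousLinearMap
  let r : Circle → 𝓢(ℂ, ℂ) → 𝓢(ℂ, ℂ) := fun u =>
    SchwartzMap.compCLMOfContinuousLinearEquiv ℂ (rotation u).toContinuousLinearEquiv
  have hr : ∀ u f z, r u f z = f (u * z) := fun _ _ _ => rfl
  have hR : ∀ u f, R u (f.toLp p volume) = (r u f).toLp p volume := fun _ _ => rfl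
  have hRR : ∀ u, R u * R u⁻¹ = 1 := fun u =>
    ContinuousLinearMap.eq_of_forall_schwartz hp_top fun f => by
      have : r u (r u⁻¹ f) = f := by
        ext z
        rw [hr, hr, Circle.coe_inv, inv_mul_cancel_left₀ u.coe_ne_zero]
      rw [mul_apply_eq_comp, hR, hR, this]
      rfl
  have hcomm : T * R u = (u : ℂ) ^ 2 • (R u * T) := by
    refine ContinuousLinearMap.eq_of_forall_schwartz hp_top fun f => Lp.ext ?_
    rw [mul_apply_eq_comp, hR]
    have h1 := isAhlforsBeurling_iff.1 hT (r u f)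
    have h2 := isAhlforsBeurling_iff.1 hT f
    have h3 := (rotation u).measurePreserving.quasiMeasurePreserving.ae h2
    have h4 := Lp.coeFn_compMeasurePreserving (T (f.toLp p volume)) (rotation u).measurePreserving
    have h5 := Lp.coeFn_smul ((u : ℂ) ^ 2) (R u (T (f.toLp p volume)))
    filter_upwards [h1, h3, h4, h5] with z h1 h3 h4 h5
    have h6 := multiplierOperator_comp_rotation u f z
    rw [h1]
    change _ = ((u : ℂ) ^ 2 • R u (T (f.toLp p volume)) : Lp ℂ p (volume : Measure ℂ)) z
    rw [h5, Pi.smul_apply]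
    change _ = (u : ℂ) ^ 2 • (Lp.compMeasurePreserving (rotation u) _ (T (f.toLp p volume))) z
    rw [h4, Function.comp_apply, h3, rotation_apply, smul_eq_mul, ← h6]
    rfl
  let V : (Lp ℂ p (volume : Measure ℂ) →L[ℂ] Lp ℂ p (volume : Measure ℂ))ˣ :=
    ⟨R u, R u⁻¹, hRR u, by simpa using hRR u⁻¹⟩
  have hconj : R u⁻¹ * T * R u = (u : ℂ) ^ 2 • T := by
    rw [mul_assoc, hcomm, mul_smul_comm, ← mul_assoc, show R u⁻¹ * R u = 1 by simpa using hRR u⁻¹,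
      one_mul]
  have h1 : spectrum ℂ (R u⁻¹ * T * R u) = spectrum ℂ T := spectrum.units_conjugate' (u := V)
  rw [hconj] at h1
  rw [← h1]
  have hu : (u : ℂ) ^ 2 ≠ 0 := pow_ne_zero _ u.coe_ne_zero
  exact (spectrum.smul_mem_smul_iff (r := Units.mk0 _ hu)).2 hl

theorem nontrivial_Lp {p : ℝ≥0∞} (hp0 : p ≠ 0) (hp_top : p ≠ ∞) :
    Nontrivial (Lp ℂ p (volume : Measure ℂ)) := by
  have hs : MeasurableSet (Metric.ball (0 : ℂ) 1) := measurableSet_ball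
  have hfin : volume (Metric.ball (0 : ℂ) 1) ≠ ∞ := measure_ball_lt_top.ne
  refine ⟨indicatorConstLp p hs hfin 1, 0, fun h => ?_⟩
  have h1 : ‖indicatorConstLp p hs hfin (1 : ℂ)‖ = 0 := by
    rw [h]
    exact Lp.norm_zero
  rw [norm_indicatorConstLp hp0 hp_top, norm_one, one_mul] at h1
  have h2 : 0 < volume.real (Metric.ball (0 : ℂ) 1) :=
    ENNReal.toReal_pos (Metric.measure_ball_pos volume 0 one_pos).ne' hfin
  exact (Real.rpow_pos_of_pos h2 _).ne' h1

/-- The spectrum is nonempty, as the space is nontrivial, and every quotient of two points of the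
circle is the square of a unimodular number; so one spectral value yields them all. -/
theorem IsAhlforsBeurling.spectrum_eq_sphere {p : ℝ≥0∞} [Fact (1 ≤ p)] (hp : 1 < p)
    (hp_top : p ≠ ∞) {T : Lp ℂ p (volume : Measure ℂ) →L[ℂ] Lp ℂ p (volume : Measure ℂ)}
    (hT : IsAhlforsBeurling p T) : spectrum ℂ T = Metric.sphere (0 : ℂ) 1 := by
  have hsub := hT.spectrum_subset_sphere hp hp_top
  refine hsub.antisymm fun l hl => ?_
  have := nontrivial_Lp (zero_lt_one.trans hp).ne' hp_top
  obtain ⟨k, hk⟩ := spectrum.nonempty T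
  have hk1 := mem_sphere_zero_iff_norm.1 (hsub hk)
  have hl1 := mem_sphere_zero_iff_norm.1 hl
  have hk0 : k ≠ 0 := norm_ne_zero_iff.1 (by rw [hk1]; exact one_ne_zero)
  obtain ⟨μ, hμ, hμl⟩ := exists_sq_eq_of_norm_eq_one (l := l / k)
    (by rw [norm_div, hk1, hl1, div_one])
  have h := hT.sq_mul_mem_spectrum hp_top ⟨μ, mem_sphere_zero_iff_norm.2 hμ⟩ hk
  change μ ^ 2 * k ∈ spectrum ℂ T at h
  rwa [hμl, div_mul_cancel₀ _ hk0] at h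

theorem theorem5p2 (p : ℝ≥0∞) [Fact (1 ≤ p)] (hp : 1 < p) (hp_top : p ≠ ∞) :
    (∃! T : Lp ℂ p (volume : Measure ℂ) →L[ℂ] Lp ℂ p (volume : Measure ℂ),
      IsAhlforsBeurling p T) ∧
    ∀ T : Lp ℂ p (volume : Measure ℂ) →L[ℂ] Lp ℂ p (volume : Measure ℂ),
      IsAhlforsBeurling p T →
        spectrum ℂ T = continuousSpectrum T ∧ spectrum ℂ T = Metric.sphere (0 : ℂ) 1 := by
  refine ⟨existsUnique_isAhlforsBeurling hp hp_top, fun T hT => ?_⟩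
  have hs := hT.spectrum_eq_sphere hp hp_top
  refine ⟨Set.Subset.antisymm (fun l hl => ?_) fun l hl => hl.1, hs⟩
  have hl1 : ‖l‖ = 1 := mem_sphere_zero_iff_norm.1 (hs ▸ hl)
  exact ⟨hl, fun x hx => hT.eq_zero_of_sub_smul_apply hp hp_top hl1 hx,
    hT.denseRange_sub_smul hp hp_top hl1⟩
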